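/- Let $\Lambda=(-1,1)$, $1<\alpha<2$, $0\le p\le 1$ and $c>0$. Let $\mu,\nu\in[\alpha-2,0]$ be the exponents determined by $\mu+\nu=\alpha-2$ and $p\sin(\pi\mu)=(1-p)\sin(\pi\nu)$, and put $C_{\alpha,p}=(\sin\pi\mu+\sin\pi\nu)/\sin\pi\alpha$. For $v\in L^1(\Lambda)$ define the two-sided Riemann–Liouville fractional integral and derivative $$\mathcal I_p^{2-\alpha}v(x)=\frac{C_{\alpha,p}}{\Gamma(2-\alpha)}\Big(p\int_{-1}^x\frac{v(y)}{(x-y)^{\alpha-1}}\,dy+(1-p)\int_x^1\frac{v(y)}{(y-x)^{\alpha-1}}\,dy\Big),\qquad \mathcal D_p^{\alpha-1}v=\frac{d}{dx}\mathcal I_p^{2-\alpha}v ,$$ the derivative being taken in the weak sense, and let $$H_{RL}^{\alpha-1}(\Lambda)=\{v\in L^1(\Lambda):\ \mathcal I_p^{2-\alpha}v\in L^2(\Lambda),\ \mathcal D_p^{\alpha-1}v\in L^2(\Lambda)\},\qquad \|v\|_{H_{RL}^{\alpha-1}(\Lambda)}^2=\|\mathcal I_p^{2-\alpha}v\|_{L^2(\Lambda)}^2+\|\mathcal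 D_p^{\alpha-1}v\|_{L^2(\Lambda)}^2 .$$ Let $H^{-1}(\Lambda)$ denote the dual space of $H^1(\Lambda)$, with the dual norm and the duality pairing $\langle\cdot,\cdot\rangle$. **Theorem.** There are constants $K,C>0$, depending only on $\alpha$, $p$ and $c$, such that for all $f\in H^{-1}(\Lambda)$ and $g_1,g_2\in\mathbb R$ there is exactly one $u\in H_{RL}^{\alpha-1}(\Lambda)$ with $$c\int_\Lambda u\,\mathcal I_p^{2-\alpha}v\,dx+\int_\Lambda \mathcal D_p^{\alpha-1}u\,\mathcal D_p^{\alpha-1}v\,dx=\langle f,\mathcal I_p^{2-\alpha}v\rangle+g_2\,\mathcal I_p^{2-\alpha}v(1)-g_1\,\mathcal I_p^{2-\alpha}v(-1)\qquad\text{for all } v\in H_{RL}^{\alpha-1}(\Lambda),$$ where $\mathcal I_p^{2-\alpha}v(\pm1)$ are the boundary values of the continuous representative of $\mathcal I_p^{2-\alpha}v\in H^1(\Lambda)$. (This is the weak form of $-\frac{d}{dx}\mathcal D_p^{\alpha-1}u+cu=f$ in $\Lambda$ with the fractional Neumann conditions $\mathcal D_p^{\alpha-1}u(-1)=g_1$,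 $\mathcal D_p^{\alpha-1}u(1)=g_2$.) Moreover this solution satisfies $$\|u\|_{H_{RL}^{\alpha-1}(\Lambda)}\le K\big(\|f\|_{H^{-1}(\Lambda)}+C(|g_1|+|g_2|)\big).$$ -/

import Mathlib

open MeasureTheory Set
open scoped ENNReal ContDiff

noncomputable section

namespace FracNeumann

/-- The interval `Λ = (-1, 1)`. -/
abbrev Lam : Set ℝ := Ioo (-1) 1

/-- Lebesgue measure on `Λ`. -/
abbrev muLam : Measure ℝ := volume.restrict Lam

/-- `g` is the weak derivative of `w` on `Λ`. -/
def HasWeakDeriv (w g : ℝ → ℝ) : Prop :=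
  ∀ φ : ℝ → ℝ, ContDiff ℝ ∞ φ → HasCompactSupport φ → tsupport φ ⊆ Lam →
    ∫ x in Lam, w x * deriv φ x = -∫ x in Lam, g x * φ x

theorem HasWeakDeriv.congr {w w' g g' : ℝ → ℝ} (h : HasWeakDeriv w g)
    (hw : w =ᵐ[muLam] w') (hg : g =ᵐ[muLam] g') : HasWeakDeriv w' g' := by
  intro φ h1 h2 h3
  have e1 : ∫ x in Lam, w' x * deriv φ x = ∫ x in Lam, w x * deriv φ x :=
    integral_congr_ae (by filter_upwards [hw] with x hx; rw [hx])
  have e2 : ∫ x in Lam, g' x * φ x = ∫ x in Lam, g x * φ x :=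
    integral_congr_ae (by filter_upwards [hg] with x hx; rw [hx])
  rw [e1, e2]
  exact h φ h1 h2 h3

theorem integrable_mul_of_continuous {w ψ : ℝ → ℝ} (hw : Integrable w muLam)
    (hψ : Continuous ψ) (hc : HasCompactSupport ψ) :
    Integrable (fun x => w x * ψ x) muLam := by
  obtain ⟨C, hC⟩ := hc.exists_bound_of_continuous hψ
  exact hw.mul_bdd hψ.aestronglyMeasurable (Filter.Eventually.of_forall hC)

theorem integrable_of_L2 (w : Lp ℝ 2 muLam) : Integrable w muLam :=
  (Lp.memLp w).integrable (by norm_num)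

/-- The Sobolev space `H¹(Λ)`, as the space of pairs `(w, w')` in `L²(Λ) × L²(Λ)` with `w'` the
weak derivative of `w`, normed by `‖w‖² = ‖w‖²_{L²} + ‖w'‖²_{L²}`. -/
def H1 : Submodule ℝ (WithLp 2 (Lp ℝ 2 muLam × Lp ℝ 2 muLam)) where
  carrier := {z | HasWeakDeriv z.fst z.snd}
  zero_mem' := by
    have h0 : ((0 : Lp ℝ 2 muLam) : ℝ → ℝ) =ᵐ[muLam] 0 := Lp.coeFn_zero _ _ _
    have key : HasWeakDeriv 0 0 := fun φ _ _ _ => by simp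
    exact key.congr h0.symm h0.symm
  add_mem' := by
    intro a b ha hb
    have key : HasWeakDeriv ((a.fst : ℝ → ℝ) + b.fst) ((a.snd : ℝ → ℝ) + b.snd) := by
      intro φ h1 h2 h3
      have hd : Continuous (deriv φ) := h1.continuous_deriv (by simp)
      simp only [Pi.add_apply, add_mul]
      rw [integral_add (integrable_mul_of_continuous (integrable_of_L2 _) hd h2.deriv)
          (integrable_mul_of_continuous (integrable_of_L2 _) hd h2.deriv),
        integral_add (integrable_mul_of_continuous (integrable_of_L2 _) h1.continuous h2)
          (integrable_mul_of_continuous (integrable_of_L2 _) h1.continuous h2),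
        ha φ h1 h2 h3, hb φ h1 h2 h3]
      ring
    exact key.congr (Lp.coeFn_add _ _).symm (Lp.coeFn_add _ _).symm
  smul_mem' := by
    intro r a ha
    have key : HasWeakDeriv (r • (a.fst : ℝ → ℝ)) (r • (a.snd : ℝ → ℝ)) := by
      intro φ h1 h2 h3
      simp only [Pi.smul_apply, smul_eq_mul, mul_assoc]
      rw [integral_const_mul, integral_const_mul, ha φ h1 h2 h3]
      ring
    exact key.congr (Lp.coeFn_smul _ _).symm (Lp.coeFn_smul _ _).symm

/-- The space `H⁻¹(Λ)`: the topological dual of `H¹(Λ)`, with the dual norm. -/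
abbrev HNegOne : Type := H1 →L[ℝ] ℝ

theorem ae_const_of_integral_mul_deriv_eq_zero {h : ℝ → ℝ} (hh : Integrable h muLam)
    (H : ∀ φ : ℝ → ℝ, ContDiff ℝ ∞ φ → HasCompactSupport φ → tsupport φ ⊆ Lam →
      ∫ x in Lam, h x * deriv φ x = 0) :
    ∃ c : ℝ, h =ᵐ[muLam] fun _ => c := by
  let f : ContDiffBump (0 : ℝ) := ⟨1 / 4, 1 / 2, by norm_num, by norm_num⟩
  let ψ : ℝ → ℝ := f.normed volume
  have hψ1 : ContDiff ℝ ∞ ψ := f.contDiff_normed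
  have hψ2 : HasCompactSupport ψ := f.hasCompactSupport_normed
  have hψ3 : tsupport ψ ⊆ Lam := by
    have : tsupport ψ = Metric.closedBall 0 (1 / 2) := f.tsupport_normed_eq
    rw [this, Real.closedBall_eq_Icc]
    intro x hx
    constructor <;> [linarith [hx.1]; linarith [hx.2]]
  have hψ4 : ∫ x, ψ x = 1 := f.integral_normed
  refine ⟨∫ x in Lam, h x * ψ x, ?_⟩
  set c := ∫ x in Lam, h x * ψ x with hc
  have hint : IntegrableOn (fun x => h x - c) Lam :=
    hh.sub (integrable_const c)
  have main : ∀ᵐ x ∂(volume : Measure ℝ), x ∈ Lam → h x - c = 0 := by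
    refine isOpen_Ioo.ae_eq_zero_of_integral_contDiff_smul_eq_zero
      hint.locallyIntegrableOn ?_
    intro η h1 h2 h3
    let k : ℝ → ℝ := fun x => η x - (∫ t, η t) * ψ x
    have k1 : ContDiff ℝ ∞ k := h1.sub (contDiff_const.mul hψ1)
    have k0 : ∀ x, x ∉ tsupport η ∪ tsupport ψ → k x = 0 := by
      intro x hx
      rw [mem_union, not_or] at hx
      simp [k, image_eq_zero_of_notMem_tsupport hx.1, image_eq_zero_of_notMem_tsupport hx.2]
    have hK : IsCompact (tsupport η ∪ tsupport ψ) := h2.isCompact.union hψ2.isCompact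
    have hKs : tsupport η ∪ tsupport ψ ⊆ Lam := union_subset h3 hψ3
    have hKn : (tsupport η ∪ tsupport ψ).Nonempty := by
      refine ⟨0, Or.inr ?_⟩
      have : tsupport ψ = Metric.closedBall 0 (1 / 2) := f.tsupport_normed_eq
      rw [this]
      exact Metric.mem_closedBall_self (by norm_num)
    obtain ⟨a, haK, ha⟩ := hK.exists_isLeast hKn
    obtain ⟨b, hbK, hb⟩ := hK.exists_isGreatest hKn
    have ha1 := hKs haK
    have hb1 := hKs hbK
    have kint : ∫ x, k x = 0 := by
      have e1 : Integrable η := h1.continuous.integrable_of_hasCompactSupport h2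
      have e2 : Integrable ψ := hψ1.continuous.integrable_of_hasCompactSupport hψ2
      simp only [k]
      rw [integral_sub e1 (e2.const_mul _), integral_const_mul, hψ4]
      ring
    let φ : ℝ → ℝ := fun x => ∫ t in (-1 : ℝ)..x, k t
    have dφ : deriv φ = k := by
      funext x
      exact Continuous.deriv_integral k k1.continuous _ _
    have φ1 : ContDiff ℝ ∞ φ := by
      rw [contDiff_infty_iff_deriv]
      refine ⟨fun x => ?_, by rw [dφ]; exact k1⟩
      exact (intervalIntegral.integral_hasDerivAt_right (k1.continuous.intervalIntegrable _ _)
        (k1.continuous.stronglyMeasurableAtFilter _ _)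
        k1.continuous.continuousAt).differentiableAt
    have φs : Function.support φ ⊆ Icc a b := by
      intro x hx
      by_contra hxab
      apply hx
      rw [mem_Icc, not_and_or, not_le, not_le] at hxab
      rcases hxab with hxa | hxb
      · have : ∫ t in (-1 : ℝ)..x, k t = ∫ t in (-1 : ℝ)..x, (0 : ℝ) := by
          refine intervalIntegral.integral_congr fun t ht => k0 t fun htK => ?_
          have hta := ha htK
          have := ht.2
          rcases max_choice (-1 : ℝ) x with hm | hm
          · rw [hm] at this
            linarith [ha1.1]
          · rw [hm] at this
            linarith
        simpa using this
      · have hle : (-1 : ℝ) ≤ x := by linarith [hb1.1]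
        change ∫ t in (-1 : ℝ)..x, k t = 0
        rw [intervalIntegral.integral_of_le hle,
          setIntegral_eq_integral_of_forall_compl_eq_zero, kint]
        intro t ht
        refine k0 t fun htK => ht ⟨?_, ?_⟩
        · exact (hKs htK).1
        · exact (hb htK).trans hxb.le
    have φ2 : HasCompactSupport φ :=
      HasCompactSupport.intro isCompact_Icc fun x hx => by
        by_contra hne
        exact hx (φs hne)
    have φ3 : tsupport φ ⊆ Lam := by
      refine (closure_minimal φs isClosed_Icc).trans fun x hx => ?_
      exact ⟨lt_of_lt_of_le ha1.1 hx.1, lt_of_le_of_lt hx.2 hb1.2⟩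
    have hz := H φ φ1 φ2 φ3
    rw [dφ] at hz
    have i1 := integrable_mul_of_continuous hh h1.continuous h2
    have i2 := integrable_mul_of_continuous hh hψ1.continuous hψ2
    have hz2 : ∫ x in Lam, h x * η x = (∫ t, η t) * c := by
      have : ∫ x in Lam, h x * k x
          = (∫ x in Lam, h x * η x) - (∫ t, η t) * c := by
        rw [hc, ← integral_const_mul, ← integral_sub i1 (i2.const_mul _)]
        refine integral_congr_ae (Filter.Eventually.of_forall fun x => ?_)
        simp only [k]
        ring
      linarith
    have hηL : ∫ x in Lam, η x = ∫ x, η x :=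
      setIntegral_eq_integral_of_forall_compl_eq_zero fun x hx =>
        image_eq_zero_of_notMem_tsupport fun h => hx (h3 h)
    have hηi : Integrable η muLam :=
      (h1.continuous.integrable_of_hasCompactSupport h2).restrict
    have : ∫ x, η x • (h x - c) = ∫ x in Lam, (h x * η x - c * η x) := by
      rw [← setIntegral_eq_integral_of_forall_compl_eq_zero (s := Lam)]
      · refine integral_congr_ae (Filter.Eventually.of_forall fun x => ?_)
        simp only [smul_eq_mul]
        ring
      · intro x hx
        rw [image_eq_zero_of_notMem_tsupport fun h => hx (h3 h), zero_smul]
    rw [this, integral_sub i1 (hηi.const_mul c), integral_const_mul, hηL, hz2]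
    ring
  have main' := (ae_restrict_iff' (μ := volume) (measurableSet_Ioo (a := (-1 : ℝ)) (b := 1))).2 main
  filter_upwards [main'] with x hx
  linarith

/-- Every `w ∈ H¹(Λ)` has a representative which is continuous on `[-1, 1]`. -/
theorem H1.exists_continuous_rep (w : H1) :
    ∃ W : ℝ → ℝ, ContinuousOn W (Icc (-1) 1) ∧ w.1.fst =ᵐ[muLam] W := by
  have hg : Integrable w.1.snd muLam := integrable_of_L2 _
  have hg' : IntervalIntegrable w.1.snd volume (-1) 1 := by
    rw [intervalIntegrable_iff_integrableOn_Ioo_of_le (by norm_num)]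
    exact hg
  let G : ℝ → ℝ := fun x => ∫ t in (-1 : ℝ)..x, w.1.snd t
  have hGac : AbsolutelyContinuousOnInterval G (-1) 1 :=
    hg'.absolutelyContinuousOnInterval_intervalIntegral (by simp)
  have hGc : ContinuousOn G (Icc (-1) 1) := by
    have := hGac.continuousOn
    rwa [uIcc_of_le (by norm_num)] at this
  have hGd : ∀ᵐ x ∂(volume : Measure ℝ), x ∈ uIcc (-1 : ℝ) 1 → HasDerivAt G (w.1.snd x) x := by
    filter_upwards [hg'.ae_hasDerivAt_integral] with x hx hxm
    exact hx hxm _ (by simp)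
  have hGi : Integrable G muLam :=
    ((hGc.integrableOn_Icc).mono_set Ioo_subset_Icc_self)
  obtain ⟨c, hcc⟩ := ae_const_of_integral_mul_deriv_eq_zero
    (h := fun x => w.1.fst x - G x) ((integrable_of_L2 _).sub hGi) (by
      intro φ h1 h2 h3
      have hd : Continuous (deriv φ) := h1.continuous_deriv (by simp)
      have e := w.2 φ h1 h2 h3
      have hφac : AbsolutelyContinuousOnInterval φ (-1) 1 :=
        ContDiffOn.absolutelyContinuousOnInterval
          ((h1.of_le (by exact_mod_cast le_top)).contDiffOn)
      have ibp := hGac.integral_mul_deriv_eq_deriv_mul hφac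
      have z1 : φ 1 = 0 := image_eq_zero_of_notMem_tsupport fun h => by
        have := (h3 h).2
        norm_num at this
      have z2 : φ (-1) = 0 := image_eq_zero_of_notMem_tsupport fun h => by
        have := (h3 h).1
        norm_num at this
      rw [z1, z2, intervalIntegral.integral_of_le (by norm_num),
        intervalIntegral.integral_of_le (by norm_num), integral_Ioc_eq_integral_Ioo,
        integral_Ioc_eq_integral_Ioo] at ibp
      have e2 : ∫ x in Lam, deriv G x * φ x = ∫ x in Lam, w.1.snd x * φ x := by
        refine integral_congr_ae ((ae_restrict_iff' measurableSet_Ioo).2 ?_)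
        filter_upwards [hGd] with x hx hxm
        rw [(hx (by rw [uIcc_of_le (by norm_num)]; exact Ioo_subset_Icc_self hxm)).deriv]
      simp only [sub_mul]
      rw [integral_sub (integrable_mul_of_continuous (integrable_of_L2 _) hd h2.deriv)
        (integrable_mul_of_continuous hGi hd h2.deriv), e]
      rw [e2] at ibp
      linarith)
  refine ⟨fun x => G x + c, hGc.add continuousOn_const, ?_⟩
  filter_upwards [hcc] with x hx
  linarith

/-- The boundary values of `w ∈ H¹(Λ)`: the values at the points of `[-1, 1]` of the continuous
representative of `w`. -/
def trace (w : H1) : ℝ → ℝ := (H1.exists_continuous_rep w).choose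

/-- The left fractional integral of order `σ` on `(-1, 1)`. -/
def leftInt (σ : ℝ) (v : ℝ → ℝ) (x : ℝ) : ℝ :=
  1 / Real.Gamma σ * ∫ y in Ioo (-1) x, v y / (x - y) ^ (1 - σ)

/-- The right fractional integral of order `σ` on `(-1, 1)`. -/
def rightInt (σ : ℝ) (v : ℝ → ℝ) (x : ℝ) : ℝ :=
  1 / Real.Gamma σ * ∫ y in Ioo x 1, v y / (y - x) ^ (1 - σ)

/-- The normalizing constant `C_{α,p}`, where `μ, ν ∈ [α - 2, 0]` are the exponents determined by
`μ + ν = α - 2` and `p sin (π μ) = (1 - p) sin (π ν)`. -/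
def normConst (α μ ν : ℝ) : ℝ :=
  (Real.sin (Real.pi * μ) + Real.sin (Real.pi * ν)) / Real.sin (Real.pi * α)

/-- The two-sided Riemann-Liouville fractional integral
`C_{α,p} (p ₋₁I_x^ρ + (1 - p) ₓI_1^ρ)` of order `ρ`. -/
def twoSidedInt (α p μ ν ρ : ℝ) (v : ℝ → ℝ) (x : ℝ) : ℝ :=
  normConst α μ ν * (p * leftInt ρ v x + (1 - p) * rightInt ρ v x)

/-- The space `H_RL^{α-1}(Λ)`: the classes `v` of integrable functions on `Λ` whose two-sided
fractional integral of order `2 - α` is in `L²(Λ)` and has a weak derivative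
(the two-sided Riemann-Liouville derivative of order `α - 1` of `v`) in `L²(Λ)`. -/
def HRL (α p μ ν : ℝ) : Set (Lp ℝ 1 muLam) :=
  {v | MemLp (twoSidedInt α p μ ν (2 - α) v) 2 muLam ∧
    ∃ g : Lp ℝ 2 muLam, HasWeakDeriv (twoSidedInt α p μ ν (2 - α) v) g}

variable {α p μ ν : ℝ}

/-- The two-sided Riemann-Liouville fractional derivative of order `α - 1` of
`v ∈ H_RL^{α-1}(Λ)`. -/
def rlDeriv (v : HRL α p μ ν) : Lp ℝ 2 muLam := v.2.2.choose

/-- The two-sided fractional integral of order `2 - α` of `v ∈ H_RL^{α-1}(Λ)`, as an element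
of `H¹(Λ)`. -/
def fracInt (v : HRL α p μ ν) : H1 :=
  ⟨WithLp.toLp 2 (v.2.1.toLp _, rlDeriv v),
    v.2.2.choose_spec.congr v.2.1.coeFn_toLp.symm Filter.EventuallyEq.rfl⟩

/-- The norm of `H_RL^{α-1}(Λ)`. -/
def hrlNorm (v : HRL α p μ ν) : ℝ :=
  √((∫ x in Lam, (twoSidedInt α p μ ν (2 - α) v.1 x) ^ 2) + ∫ x in Lam, (rlDeriv v x) ^ 2)

/-- The bilinear form `c (u, I_p^{2-α} v) + (D_p^{α-1} u, D_p^{α-1} v)`. -/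
def bilin (c : ℝ) (u v : HRL α p μ ν) : ℝ :=
  c * (∫ x in Lam, u.1 x * twoSidedInt α p μ ν (2 - α) v.1 x) +
    ∫ x in Lam, rlDeriv u x * rlDeriv v x

/-- The functional `⟨f, I_p^{2-α} v⟩ + g₂ I_p^{2-α} v(1) - g₁ I_p^{2-α} v(-1)`. -/
def neumannFunctional (f : HNegOne) (g₁ g₂ : ℝ) (v : HRL α p μ ν) : ℝ :=
  f (fracInt v) + g₂ * trace (fracInt v) 1 - g₁ * trace (fracInt v) (-1)

/-- `u` is a solution of the weak form of
`-(D_p^{α-1} u)' + c u = f` in `Λ`, `D_p^{α-1} u(-1) = g₁`, `D_p^{α-1} u(1) = g₂`. -/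
def IsWeakSolution (c : ℝ) (f : HNegOne) (g₁ g₂ : ℝ) (u : HRL α p μ ν) : Prop :=
  ∀ v : HRL α p μ ν, bilin c u v = neumannFunctional f g₁ g₂ v

end FracNeumann

end

/-!
Write `σ = 2 - α ∈ (0, 1)` and let `I` be the two-sided fractional integral of order `σ`. The map
`v ↦ I v` turns the norm of `H_RL^{α-1}(Λ)` into the norm of `H¹(Λ)`, so the whole problem can be
rewritten for `w = I u` and the test functions `z = I v`. If `I` is a bijection onto `H¹(Λ)` with
inverse `A`, the equation becomes

  `c ∫ (A w) z + ∫ w' z' = ⟨f, z⟩ + g₂ z(1) - g₁ z(-1)` for all `z ∈ H¹(Λ)`,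

and the theorem is the Lax–Milgram theorem together with the bound of `z(±1)` by the norm of `z`.
Two facts are needed: the bijectivity of `I`, with `A : H¹(Λ) → L¹(Λ)` bounded, and the coercivity
of the form on the left.

*Bijectivity.* Let `ω = (1 - x)^μ (1 + x)^ν`. The condition on `μ` and `ν` says exactly that
`I ω` is a positive constant (`exists_const_image`). Since the kernel is homogeneous, the
commutator of `I` with multiplication by `x` is, up to constants, `-σ` times a primitive of `I`
(`fracOp_id_mul`). Hence `I` maps `ω` times the polynomials of degree at most `n` onto the
polynomials of degree at most `n`, triangularly and with diagonal entries proportional to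
`∏ (1 - σ / k)` (`AbelData.exists_image`). The transpose of `I` has the same structure for the
weight `ω* = (1 - x)^ν (1 + x)^μ`, and therefore `I` maps `ω` times the orthogonal polynomials for
`ω` to the orthogonal polynomials for `ω*`. These diagonalize the form `∫ (1 - x²) ω* r' s'`, with
eigenvalues of order `n²`, while the diagonal entries of `I` decay no faster than `1 / n`. So for
`r = I (ω q)`

  `δ ∫ ω q² ≤ ∫ ω* r² + ∫ (1 - x²) ω* r'²`

with some `δ > 0` (`AbelData.energy_estimate`). The right-hand side is bounded by the square of the
norm of `r` in `H¹(Λ)`, and the left-hand side controls the norm of `ω q` in `L¹(Λ)`. By density of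
the polynomials in `H¹(Λ)` this gives a bounded right inverse `A` of `I`
(`AbelData.exists_inverse`). Injectivity of `I` on `L¹(Λ)` follows by transposition, since the
transpose reaches all polynomials (`AbelData.ae_eq_zero_of_fracOp`).

*Coercivity.* The symmetric part of the kernel of `I` is a positive multiple of `|x - y|^(σ - 1)`,
which is a positive multiple of `∫ (x - s)₊^(σ/2 - 1) (y - s)₊^(σ/2 - 1) ds`, so `∫ (I u) u ≥ 0`,
and `∫ (A w) w ≥ 0` (`AbelData.pairing_nonneg`). The form `∫ |w'|²` is coercive modulo constants,
and `∫ (A 1) 1 > 0` because `A 1` is a positive multiple of `ω` (`AbelData.exists_coercive`).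
-/

noncomputable section

namespace FracNeumann

/-! ### Fractional integrals of the Jacobi weight -/

theorem integral_rpow_mul_one_sub_rpow {a b : ℝ} (ha : 0 < a) (hb : 0 < b) :
    ∫ z in Ioo (0 : ℝ) 1, z ^ (a - 1) * (1 - z) ^ (b - 1) = ProbabilityTheory.beta a b := by
  rw [ProbabilityTheory.beta_eq_betaIntegralReal a b ha hb, Complex.betaIntegral,
    intervalIntegral.integral_of_le (by norm_num), integral_Ioc_eq_integral_Ioo,
    ← RCLike.re_to_complex, ← integral_re]
  · refine setIntegral_congr_fun measurableSet_Ioo fun x hx => ?_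
    obtain ⟨h0, h1⟩ := hx
    norm_cast
    rw [← Complex.ofReal_cpow, ← Complex.ofReal_cpow, RCLike.re_to_complex,
      Complex.re_mul_ofReal, Complex.ofReal_re]
    all_goals linarith
  · have := Complex.betaIntegral_convergent (u := a) (v := b) (by simpa) (by simpa)
    rw [intervalIntegrable_iff_integrableOn_Ioo_of_le (by norm_num)] at this
    exact this

theorem integrableOn_rpow_mul_one_sub_rpow {a b : ℝ} (ha : 0 < a) (hb : 0 < b) :
    IntegrableOn (fun z : ℝ => z ^ (a - 1) * (1 - z) ^ (b - 1)) (Ioo 0 1) := by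
  refine not_imp_comm.1 integral_undef ?_
  rw [integral_rpow_mul_one_sub_rpow ha hb]
  exact (ProbabilityTheory.beta_pos ha hb).ne'

/-- An Euler-type integral whose exponents add up so that the substitution
`y = (2 - r) z / (2 - r z)`, which maps `(0, 1)` onto itself, turns it into a beta integral. -/
theorem integral_moebius {σ μ ν r : ℝ} (hσ : 0 < σ) (hν : -1 < ν) (hs : μ + ν = -σ)
    (hr : r ∈ Ioo (0 : ℝ) 2) :
    ∫ z in Ioo (0 : ℝ) 1, (1 - z) ^ (σ - 1) * z ^ ν * (2 - r * z) ^ (μ - 1)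
      = 2 ^ (-σ) * (2 - r) ^ (-ν - 1) * ProbabilityTheory.beta (ν + 1) σ := by
  obtain ⟨hr0, hr2⟩ := hr
  let φ : ℝ → ℝ := fun z => (2 - r) * z / (2 - r * z)
  have hpos : ∀ z ∈ Ioo (0 : ℝ) 1, 0 < 2 - r * z := fun z hz => by nlinarith [hz.1, hz.2]
  have himg : φ '' Ioo 0 1 = Ioo 0 1 := by
    ext y
    constructor
    · rintro ⟨z, hz, rfl⟩
      have h := hpos z hz
      refine ⟨div_pos (mul_pos (by linarith) hz.1) h, ?_⟩
      rw [div_lt_one h]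
      nlinarith [hz.2]
    · rintro ⟨h0, h1⟩
      have hp : 0 < 2 - r + r * y := by nlinarith
      refine ⟨2 * y / (2 - r + r * y), ⟨by positivity, ?_⟩, ?_⟩
      · rw [div_lt_one hp]; nlinarith
      · have h3 : 2 - r ≠ 0 := by linarith
        have : 2 - r * (2 * y / (2 - r + r * y)) = 2 * (2 - r) / (2 - r + r * y) := by
          field_simp; ring
        simp only [φ]
        rw [this]
        field_simp
  have hder : ∀ z ∈ Ioo (0 : ℝ) 1,
      HasDerivWithinAt φ (2 * (2 - r) / (2 - r * z) ^ 2) (Ioo 0 1) z := by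
    intro z hz
    have h := hpos z hz
    have h1 : HasDerivAt (fun z : ℝ => (2 - r) * z) (2 - r) z := by
      simpa using (hasDerivAt_id z).const_mul (2 - r)
    have h2 : HasDerivAt (fun z : ℝ => 2 - r * z) (-r) z := by
      simpa using ((hasDerivAt_id z).const_mul r).const_sub 2
    have h3 := h1.div h2 h.ne'
    exact (h3.congr_deriv (by congr 1; ring)).hasDerivWithinAt
  have hinj : InjOn φ (Ioo 0 1) := by
    intro z hz w hw hzw
    have h := hpos z hz
    have h' := hpos w hw
    simp only [φ] at hzw
    rw [div_eq_div_iff h.ne' h'.ne'] at hzw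
    have : (2 - r) * 2 * (z - w) = 0 := by linarith
    have h2 : (2 - r) * 2 ≠ 0 := by nlinarith
    have := (mul_eq_zero.1 this).resolve_left h2
    linarith
  have key := integral_image_eq_integral_abs_deriv_smul measurableSet_Ioo hder hinj
    (fun y => y ^ (ν + 1 - 1) * (1 - y) ^ (σ - 1))
  rw [himg, integral_rpow_mul_one_sub_rpow (by linarith) hσ] at key
  rw [key, ← integral_const_mul]
  refine setIntegral_congr_fun measurableSet_Ioo fun z hz => ?_
  have h := hpos z hz
  have h2r : 0 < 2 - r := by linarith
  have hz1 : 0 < 1 - z := by linarith [hz.2]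
  have hz0 : 0 < z := hz.1
  have e1 : 1 - φ z = 2 * (1 - z) / (2 - r * z) := by
    simp only [φ]; field_simp; ring
  have hμ : μ - 1 = -ν - σ - 1 := by linarith
  simp only [smul_eq_mul]
  rw [e1, abs_of_pos (by positivity)]
  simp only [φ]
  rw [Real.div_rpow (by positivity) h.le, Real.div_rpow (by positivity) h.le,
    Real.mul_rpow h2r.le hz.1.le, Real.mul_rpow (by norm_num) hz1.le, hμ,
    show ν + 1 - 1 = ν by ring, show -ν - σ - 1 = -(ν + (σ - 1) + (2 : ℕ)) by push_cast; ring,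
    Real.rpow_neg h.le, Real.rpow_add h, Real.rpow_add h, Real.rpow_natCast,
    show -ν - 1 = -(ν + 1) by ring, Real.rpow_neg h2r.le, Real.rpow_add h2r, Real.rpow_one,
    Real.rpow_neg (by norm_num), Real.rpow_sub (by norm_num : (0 : ℝ) < 2), Real.rpow_one]
  have : (0 : ℝ) < 2 ^ σ := by positivity
  have : (0 : ℝ) < (2 - r) ^ ν := by positivity
  have : (0 : ℝ) < (2 - r * z) ^ ν := by positivity
  have : (0 : ℝ) < (2 - r * z) ^ (σ - 1) := by positivity
  field_simp

/-- The function `s ↦ s^(-μ) (2 - s z)^μ` as the integral of its derivative; it vanishes at `s = 0`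
because `μ < 0`. -/
theorem integral_rpow_mul_two_sub_rpow {μ s z : ℝ} (hμ : μ < 0) (hs : s ∈ Ioo (0 : ℝ) 2)
    (hz : z ∈ Ioo (0 : ℝ) 1) :
    s ^ (-μ) * (2 - s * z) ^ μ
      = ∫ r in Ioo 0 s, -2 * μ * (r ^ (-μ - 1) * (2 - r * z) ^ (μ - 1)) := by
  have hp : ∀ r ∈ Icc 0 s, 0 < 2 - r * z := fun r hr => by nlinarith [hr.1, hr.2, hs.2, hz.1, hz.2]
  have hcont : ContinuousOn (fun r : ℝ => r ^ (-μ) * (2 - r * z) ^ μ) (Icc 0 s) := by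
    refine ContinuousOn.mul ?_ ?_
    · exact (Real.continuous_rpow_const (by linarith)).continuousOn
    · exact ContinuousOn.rpow_const (by fun_prop) fun r hr => Or.inl (hp r hr).ne'
  have hd : ∀ r ∈ Ioo 0 s, HasDerivAt (fun r : ℝ => r ^ (-μ) * (2 - r * z) ^ μ)
      (-2 * μ * (r ^ (-μ - 1) * (2 - r * z) ^ (μ - 1))) r := by
    intro r hr
    have h := hp r ⟨hr.1.le, hr.2.le⟩
    have h1 := Real.hasDerivAt_rpow_const (x := r) (p := -μ) (Or.inl hr.1.ne')
    have h0 : HasDerivAt (fun r : ℝ => 2 - r * z) (-z) r := by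
      simpa using ((hasDerivAt_id r).mul_const z).const_sub 2
    have h2 := h0.rpow_const (p := μ) (Or.inl h.ne')
    refine (h1.mul h2).congr_deriv ?_
    rw [Real.rpow_sub_one h.ne', Real.rpow_sub_one hr.1.ne']
    have := hr.1.ne'
    field_simp
    ring
  have hint : IntervalIntegrable (fun r : ℝ => -2 * μ * (r ^ (-μ - 1) * (2 - r * z) ^ (μ - 1)))
      volume 0 s := by
    refine IntervalIntegrable.const_mul ?_ _
    refine (intervalIntegral.intervalIntegrable_rpow' (by linarith)).mul_continuousOn ?_
    rw [uIcc_of_le hs.1.le]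
    exact ContinuousOn.rpow_const (by fun_prop) fun r hr => Or.inl (hp r hr).ne'
  rw [← integral_Ioc_eq_integral_Ioo, ← intervalIntegral.integral_of_le hs.1.le,
    intervalIntegral.integral_eq_sub_of_hasDerivAt_of_le hs.1.le hcont hd hint,
    Real.zero_rpow (by linarith)]
  ring

/-- The Jacobi weight `(1 - y)^μ (1 + y)^ν`. -/
def jacobiWeight (μ ν y : ℝ) : ℝ := (1 - y) ^ μ * (1 + y) ^ ν

theorem jacobiWeight_neg (μ ν y : ℝ) : jacobiWeight μ ν (-y) = jacobiWeight ν μ y := by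
  rw [jacobiWeight, jacobiWeight, mul_comm, sub_neg_eq_add, ← sub_eq_add_neg]

theorem jacobiWeight_pos (μ ν : ℝ) {y : ℝ} (hy : y ∈ Lam) : 0 < jacobiWeight μ ν y :=
  mul_pos (Real.rpow_pos_of_pos (by linarith [hy.2]) _)
    (Real.rpow_pos_of_pos (by linarith [hy.1]) _)

theorem measurable_jacobiWeight (μ ν : ℝ) : Measurable (jacobiWeight μ ν) := by
  unfold jacobiWeight; fun_prop

/-- The left-sided integral of the Jacobi weight after the substitution `y = (1 + x) z - 1`. -/
theorem integral_left_scaled {σ μ ν x : ℝ} (hs : μ + ν = -σ) (hx : x ∈ Lam) :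
    ∫ y in Ioo (-1) x, (x - y) ^ (σ - 1) * jacobiWeight μ ν y
      = ∫ z in Ioo (0 : ℝ) 1, (1 - z) ^ (σ - 1) * z ^ ν *
          ((1 + x) ^ (-μ) * (2 - (1 + x) * z) ^ μ) := by
  have h1 : 0 < 1 + x := by linarith [hx.1]
  have h := intervalIntegral.smul_integral_comp_mul_add (a := 0) (b := 1)
    (fun y => (x - y) ^ (σ - 1) * jacobiWeight μ ν y) (1 + x) (-1)
  rw [show (1 + x) * 0 + -1 = -1 by ring, show (1 + x) * 1 + -1 = x by ring,
    intervalIntegral.integral_of_le (by linarith : (-1 : ℝ) ≤ x),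
    intervalIntegral.integral_of_le (by norm_num : (0 : ℝ) ≤ 1),
    integral_Ioc_eq_integral_Ioo, integral_Ioc_eq_integral_Ioo] at h
  rw [← h, smul_eq_mul, ← integral_const_mul]
  refine setIntegral_congr_fun measurableSet_Ioo fun z hz => ?_
  have hz0 : 0 < z := hz.1
  have hz1 : 0 < 1 - z := by linarith [hz.2]
  simp only [jacobiWeight]
  rw [show x - ((1 + x) * z + -1) = (1 + x) * (1 - z) by ring,
    show 1 - ((1 + x) * z + -1) = 2 - (1 + x) * z by ring,
    show 1 + ((1 + x) * z + -1) = (1 + x) * z by ring,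
    Real.mul_rpow h1.le hz1.le, Real.mul_rpow h1.le hz0.le,
    show -μ = 1 + (σ - 1) + ν by linarith, Real.rpow_add h1, Real.rpow_add h1, Real.rpow_one]
  ring

theorem intervalIntegrable_jacobi {μ ν s : ℝ} (hμ : μ < 0) (hs : s ∈ Ioo (0 : ℝ) 2) :
    IntervalIntegrable (fun r : ℝ => r ^ (-μ - 1) * (2 - r) ^ (-ν - 1)) volume 0 s := by
  refine (intervalIntegral.intervalIntegrable_rpow' (by linarith)).mul_continuousOn ?_
  rw [uIcc_of_le hs.1.le]
  exact ContinuousOn.rpow_const (by fun_prop) fun r hr => Or.inl (by linarith [hr.2, hs.2])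

/-- The left-sided fractional integral of the Jacobi weight is a multiple of the incomplete beta
integral over `(0, 1 + x)`. The factor depending on `x` is written as an integral over `r`, and
after exchanging the integrals the one over `z` is given by `integral_moebius`. -/
theorem integral_left_eq {σ μ ν x : ℝ} (hσ : 0 < σ) (hν : -1 < ν) (hμ : μ < 0)
    (hs : μ + ν = -σ) (hx : x ∈ Lam) :
    ∫ y in Ioo (-1) x, (x - y) ^ (σ - 1) * jacobiWeight μ ν y
      = (-2 * μ * 2 ^ (-σ) * ProbabilityTheory.beta (ν + 1) σ) *
        ∫ r in (0 : ℝ)..(1 + x), r ^ (-μ - 1) * (2 - r) ^ (-ν - 1) := by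
  set s := 1 + x with hsx
  have hs0 : s ∈ Ioo (0 : ℝ) 2 := ⟨by linarith [hx.1], by linarith [hx.2]⟩
  rw [integral_left_scaled hs hx, ← hsx]
  have e1 : ∫ z in Ioo (0 : ℝ) 1, (1 - z) ^ (σ - 1) * z ^ ν * (s ^ (-μ) * (2 - s * z) ^ μ)
      = ∫ z in Ioo (0 : ℝ) 1, ∫ r in Ioo 0 s, (-2 * μ) *
        ((z ^ (ν + 1 - 1) * (1 - z) ^ (σ - 1)) * r ^ (-μ - 1) * (2 - r * z) ^ (μ - 1)) := by
    refine setIntegral_congr_fun measurableSet_Ioo fun z hz => ?_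
    rw [integral_rpow_mul_two_sub_rpow hμ hs0 hz, ← integral_const_mul]
    refine integral_congr_ae (Filter.Eventually.of_forall fun r => ?_)
    simp only
    rw [add_sub_cancel_right]
    ring
  have hr : IntegrableOn (fun r : ℝ => r ^ (-μ - 1)) (Ioo 0 s) := by
    rw [← intervalIntegrable_iff_integrableOn_Ioo_of_le hs0.1.le]
    exact intervalIntegral.intervalIntegrable_rpow' (by linarith)
  have hint : Integrable (Function.uncurry fun z r : ℝ => (-2 * μ) *
        ((z ^ (ν + 1 - 1) * (1 - z) ^ (σ - 1)) * r ^ (-μ - 1) * (2 - r * z) ^ (μ - 1)))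
      ((volume.restrict (Ioo 0 1)).prod (volume.restrict (Ioo 0 s))) := by
    have h0 := (integrableOn_rpow_mul_one_sub_rpow (a := ν + 1) (by linarith) hσ).mul_prod hr
    refine Integrable.const_mul ?_ _
    refine h0.mul_bdd (c := (2 - s) ^ (μ - 1))
      ((by fun_prop : Measurable fun q : ℝ × ℝ => 2 - q.2 * q.1).pow_const _).aestronglyMeasurable ?_
    rw [Measure.prod_restrict, ae_restrict_iff' (measurableSet_Ioo.prod measurableSet_Ioo)]
    refine Filter.Eventually.of_forall fun ⟨z, r⟩ ⟨hz, hr⟩ => ?_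
    have h1 : 2 - s ≤ 2 - r * z := by nlinarith [hz.1, hz.2, hr.1, hr.2]
    have h2 : 0 < 2 - s := by linarith [hs0.2]
    rw [Real.norm_of_nonneg (Real.rpow_nonneg (h2.le.trans h1) _)]
    exact Real.rpow_le_rpow_of_nonpos h2 h1 (by linarith)
  rw [e1, integral_integral_swap hint, intervalIntegral.integral_of_le hs0.1.le,
    integral_Ioc_eq_integral_Ioo, ← integral_const_mul]
  refine setIntegral_congr_fun measurableSet_Ioo fun r hr => ?_
  have := integral_moebius hσ hν hs ⟨hr.1, hr.2.trans hs0.2⟩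
  rw [integral_const_mul]
  calc -2 * μ * ∫ z in Ioo (0 : ℝ) 1,
          z ^ (ν + 1 - 1) * (1 - z) ^ (σ - 1) * r ^ (-μ - 1) * (2 - r * z) ^ (μ - 1)
      = -2 * μ * (r ^ (-μ - 1) *
          ∫ z in Ioo (0 : ℝ) 1, (1 - z) ^ (σ - 1) * z ^ ν * (2 - r * z) ^ (μ - 1)) := by
        rw [← integral_const_mul (r ^ (-μ - 1))]
        congr 1
        refine integral_congr_ae (Filter.Eventually.of_forall fun z => ?_)
        simp only [add_sub_cancel_right]
        ring
    _ = _ := by rw [this]; ring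

/-- The case `μ = 0` of the left-sided fractional integral of the Jacobi weight: it is constant. -/
theorem integral_left_eq_of_zero {σ ν x : ℝ} (hσ : 0 < σ) (hν : -1 < ν)
    (hs : ν = -σ) (hx : x ∈ Lam) :
    ∫ y in Ioo (-1) x, (x - y) ^ (σ - 1) * jacobiWeight 0 ν y
      = ProbabilityTheory.beta (ν + 1) σ := by
  rw [integral_left_scaled (by linarith) hx,
    ← integral_rpow_mul_one_sub_rpow (by linarith : 0 < ν + 1) hσ]
  refine integral_congr_ae (Filter.Eventually.of_forall fun z => ?_)
  simp only [neg_zero, Real.rpow_zero, add_sub_cancel_right]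
  ring

theorem integral_left_pos {σ μ ν x : ℝ} (hσ : 0 < σ) (hν : -1 < ν) (hμ : μ ≤ 0)
    (hs : μ + ν = -σ) (hx : x ∈ Lam) :
    0 < ∫ y in Ioo (-1) x, (x - y) ^ (σ - 1) * jacobiWeight μ ν y := by
  have hB := ProbabilityTheory.beta_pos (by linarith : 0 < ν + 1) hσ
  rcases hμ.eq_or_lt with rfl | h
  · rw [integral_left_eq_of_zero hσ hν (by linarith) hx]
    exact hB
  · rw [integral_left_eq hσ hν h hs hx]
    have h1 : 0 < -2 * μ := by linarith
    refine mul_pos (by positivity) ?_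
    have hs0 : 1 + x ∈ Ioo (0 : ℝ) 2 := ⟨by linarith [hx.1], by linarith [hx.2]⟩
    refine intervalIntegral.intervalIntegral_pos_of_pos_on (intervalIntegrable_jacobi h hs0)
      (fun r hr => ?_) hs0.1
    exact mul_pos (Real.rpow_pos_of_pos hr.1 _)
      (Real.rpow_pos_of_pos (by linarith [hr.2, hs0.2]) _)

theorem integral_right_eq_left {σ μ ν x : ℝ} (hx : x ∈ Lam) :
    ∫ y in Ioo x 1, (y - x) ^ (σ - 1) * jacobiWeight μ ν y
      = ∫ y in Ioo (-1) (-x), (-x - y) ^ (σ - 1) * jacobiWeight ν μ y := by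
  have h := intervalIntegral.integral_comp_neg (a := -1) (b := -x)
    (fun y => (y - x) ^ (σ - 1) * jacobiWeight μ ν y)
  rw [neg_neg, neg_neg, intervalIntegral.integral_of_le (by linarith [hx.2]),
    intervalIntegral.integral_of_le hx.2.le,
    integral_Ioc_eq_integral_Ioo, integral_Ioc_eq_integral_Ioo] at h
  rw [← h]
  refine integral_congr_ae (Filter.Eventually.of_forall fun y => ?_)
  simp only [jacobiWeight_neg]
  congr 2
  ring

theorem neg_mem_Lam {x : ℝ} (hx : x ∈ Lam) : -x ∈ Lam :=
  ⟨by linarith [hx.2], by linarith [hx.1]⟩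

theorem sin_pi_mul_neg {t : ℝ} (h1 : -1 < t) (h0 : t < 0) : Real.sin (Real.pi * t) < 0 := by
  have : 0 < Real.sin (Real.pi * (-t)) :=
    Real.sin_pos_of_pos_of_lt_pi (by nlinarith [Real.pi_pos]) (by nlinarith [Real.pi_pos])
  rw [mul_neg, Real.sin_neg] at this
  linarith

/-- The sine condition says that the constants in front of the left and the right incomplete beta
integrals agree, by the reflection formula in the form `Γ(1 + t) Γ(1 - t) sin(π t) = π t`. -/
theorem balance_of_sin {σ μ ν a b : ℝ} (hμ : μ ∈ Ioo (-1 : ℝ) 0) (hν : ν ∈ Ioo (-1 : ℝ) 0)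
    (hs : μ + ν = -σ) (hab : a * Real.sin (Real.pi * μ) = b * Real.sin (Real.pi * ν)) :
    a * (-2 * μ * 2 ^ (-σ) * ProbabilityTheory.beta (ν + 1) σ)
      = b * (-2 * ν * 2 ^ (-σ) * ProbabilityTheory.beta (μ + 1) σ) := by
  have key : ∀ t ∈ Ioo (-1 : ℝ) 0, Real.Gamma (t + 1) * Real.Gamma (1 - t) *
      Real.sin (Real.pi * t) = Real.pi * t := by
    intro t ht
    have hsin := (sin_pi_mul_neg ht.1 ht.2).ne
    rw [Real.Gamma_add_one ht.2.ne, mul_assoc t, Real.Gamma_mul_Gamma_one_sub, mul_assoc,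
      div_mul_cancel₀ _ hsin, mul_comm]
  have kμ := key μ hμ
  have kν := key ν hν
  have hG : ∀ t : ℝ, t < 0 → 0 < Real.Gamma (1 - t) := fun t ht =>
    Real.Gamma_pos_of_pos (by linarith)
  have g1 := hG μ hμ.2
  have g2 := hG ν hν.2
  have g3 : 0 < Real.Gamma (μ + 1) := Real.Gamma_pos_of_pos (by linarith [hμ.1])
  have g4 : 0 < Real.Gamma (ν + 1) := Real.Gamma_pos_of_pos (by linarith [hν.1])
  rw [ProbabilityTheory.beta, ProbabilityTheory.beta, show ν + 1 + σ = 1 - μ by linarith,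
    show μ + 1 + σ = 1 - ν by linarith]
  -- multiply by `π` and replace `π μ` and `π ν` by the reflection formula
  have e : a * μ * Real.Gamma (ν + 1) * Real.Gamma (1 - ν)
      = b * ν * Real.Gamma (μ + 1) * Real.Gamma (1 - μ) := by
    have hpi := Real.pi_pos.ne'
    refine mul_left_cancel₀ hpi ?_
    calc Real.pi * (a * μ * Real.Gamma (ν + 1) * Real.Gamma (1 - ν))
        = (Real.pi * μ) * a * Real.Gamma (ν + 1) * Real.Gamma (1 - ν) := by ring
      _ = (a * Real.sin (Real.pi * μ)) * (Real.Gamma (μ + 1) * Real.Gamma (1 - μ)) *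
            (Real.Gamma (ν + 1) * Real.Gamma (1 - ν)) := by
            linear_combination (-(a * Real.Gamma (ν + 1) * Real.Gamma (1 - ν))) * kμ
      _ = (Real.pi * ν) * b * Real.Gamma (μ + 1) * Real.Gamma (1 - μ) := by
            rw [hab]
            linear_combination (b * Real.Gamma (μ + 1) * Real.Gamma (1 - μ)) * kν
      _ = _ := by ring
  field_simp
  linear_combination (-Real.Gamma σ) * e

/-- The two-sided fractional integral of the Jacobi weight is a positive constant on `Λ`: the left
and the right integral are multiples of the integrals of `r^(-μ - 1) (2 - r)^(-ν - 1)` over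
`(0, 1 + x)` and over `(1 + x, 2)`, and `balance_of_sin` makes the two factors equal. If one
exponent vanishes, the operator is one-sided. -/
theorem exists_const_image {σ μ ν a b : ℝ} (hσ : 0 < σ) (hσ1 : σ < 1) (hμ : μ ≤ 0) (hν : ν ≤ 0)
    (hs : μ + ν = -σ) (ha : 0 ≤ a) (hb : 0 ≤ b) (hpos : 0 < a + b)
    (hab : a * Real.sin (Real.pi * μ) = b * Real.sin (Real.pi * ν)) :
    ∃ l : ℝ, 0 < l ∧ ∀ x ∈ Lam,
      a * (∫ y in Ioo (-1) x, (x - y) ^ (σ - 1) * jacobiWeight μ ν y) +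
      b * (∫ y in Ioo x 1, (y - x) ^ (σ - 1) * jacobiWeight μ ν y) = l := by
  have hμ1 : -1 < μ := by linarith
  have hν1 : -1 < ν := by linarith
  rcases hμ.eq_or_lt with rfl | hμ0
  · have hs' := sin_pi_mul_neg hν1 (by linarith)
    have hb0 : b = 0 := by
      rw [mul_zero, Real.sin_zero, mul_zero] at hab
      exact (mul_eq_zero.1 hab.symm).resolve_right hs'.ne
    subst hb0
    refine ⟨a * ProbabilityTheory.beta (ν + 1) σ,
      mul_pos (by linarith) (ProbabilityTheory.beta_pos (by linarith) hσ), fun x hx => ?_⟩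
    rw [integral_left_eq_of_zero hσ hν1 (by linarith) hx]
    ring
  rcases hν.eq_or_lt with rfl | hν0
  · have hs' := sin_pi_mul_neg hμ1 (by linarith)
    have ha0 : a = 0 := by
      rw [mul_zero, Real.sin_zero, mul_zero] at hab
      exact (mul_eq_zero.1 hab).resolve_right hs'.ne
    subst ha0
    refine ⟨b * ProbabilityTheory.beta (μ + 1) σ,
      mul_pos (by linarith) (ProbabilityTheory.beta_pos (by linarith) hσ), fun x hx => ?_⟩
    rw [integral_right_eq_left hx,
      integral_left_eq_of_zero hσ hμ1 (by linarith) (neg_mem_Lam hx)]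
    ring
  have hbal := balance_of_sin ⟨hμ1, hμ0⟩ ⟨hν1, hν0⟩ hs hab
  have s1 := sin_pi_mul_neg hμ1 hμ0
  have s2 := sin_pi_mul_neg hν1 hν0
  have ha0 : 0 < a := by
    rcases ha.eq_or_lt with rfl | h
    · have : b = 0 := by
        rw [zero_mul] at hab
        exact (mul_eq_zero.1 hab.symm).resolve_right s2.ne
      linarith
    · exact h
  let F : ℝ → ℝ := fun r => r ^ (-μ - 1) * (2 - r) ^ (-ν - 1)
  have hB := ProbabilityTheory.beta_pos (by linarith : 0 < ν + 1) hσ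
  -- the right integral in the variable of the left one
  have hright : ∀ x ∈ Lam, IntervalIntegrable F volume (1 + x) 2 ∧
      ∫ r in (0 : ℝ)..(1 - x), r ^ (-ν - 1) * (2 - r) ^ (-μ - 1) = ∫ r in (1 + x)..2, F r := by
    intro x hx
    have h := (intervalIntegrable_jacobi (μ := ν) (ν := μ) hν0 (s := 1 - x)
      ⟨by linarith [hx.2], by linarith [hx.1]⟩).comp_sub_left 2
    have h2 := intervalIntegral.integral_comp_sub_left (a := 0) (b := 1 - x) F 2
    have e : (fun r : ℝ => (2 - r) ^ (-ν - 1) * (2 - (2 - r)) ^ (-μ - 1)) = F := by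
      funext r
      simp only [F]
      rw [sub_sub_cancel, mul_comm]
    rw [e, sub_zero, show 2 - (1 - x) = 1 + x by ring] at h
    refine ⟨h.symm, ?_⟩
    rw [sub_zero, show 2 - (1 - x) = 1 + x by ring] at h2
    rw [← h2]
    congr 1
    funext r
    simp only [F]
    rw [sub_sub_cancel, mul_comm]
  have hleft : ∀ x ∈ Lam, IntervalIntegrable F volume 0 (1 + x) := fun x hx =>
    intervalIntegrable_jacobi hμ0 ⟨by linarith [hx.1], by linarith [hx.2]⟩
  have h0 : (0 : ℝ) ∈ Lam := ⟨by norm_num, by norm_num⟩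
  refine ⟨a * (-2 * μ * 2 ^ (-σ) * ProbabilityTheory.beta (ν + 1) σ) * ∫ r in (0 : ℝ)..2, F r,
    mul_pos ?_ ?_, fun x hx => ?_⟩
  · have h1 : 0 < -2 * μ := by linarith
    positivity
  · refine intervalIntegral.intervalIntegral_pos_of_pos_on
      ((hleft 0 h0).trans (hright 0 h0).1) (fun r hr => ?_) (by norm_num)
    exact mul_pos (Real.rpow_pos_of_pos hr.1 _) (Real.rpow_pos_of_pos (by linarith [hr.2]) _)
  · rw [integral_right_eq_left hx, integral_left_eq hσ hν1 hμ0 hs hx,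
      integral_left_eq hσ hμ1 hν0 (by linarith) (neg_mem_Lam hx), ← sub_eq_add_neg,
      (hright x hx).2, ← intervalIntegral.integral_add_adjacent_intervals (hleft x hx)
        (hright x hx).1]
    simp only [F]
    linear_combination (-∫ r in (1 + x)..2, r ^ (-μ - 1) * (2 - r) ^ (-ν - 1)) * hbal

/-! ### The two-sided fractional integral as an integral operator -/

/-- The homogeneous kernel of degree `σ - 1` with the factor `a` on the positive and `b` on the
negative half line. -/
def kern (a b σ z : ℝ) : ℝ := (if 0 < z then a else b) * |z| ^ (σ - 1)

/-- The integral operator on `Λ` with convolution kernel `kern a b σ`. -/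
def fracOp (a b σ : ℝ) (u : ℝ → ℝ) (x : ℝ) : ℝ := ∫ y in Lam, kern a b σ (x - y) * u y

theorem kern_neg {σ : ℝ} (hσ1 : σ < 1) (a b z : ℝ) : kern a b σ (-z) = kern b a σ z := by
  unfold kern
  rcases lt_trichotomy z 0 with h | rfl | h
  · rw [if_pos (by linarith), if_neg (by linarith), abs_neg]
  · simp [Real.zero_rpow (by linarith : σ - 1 ≠ 0)]
  · rw [if_neg (by linarith), if_pos h, abs_neg]

theorem kern_of_pos {a b σ z : ℝ} (hz : 0 < z) : kern a b σ z = a * z ^ (σ - 1) := by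
  rw [kern, if_pos hz, abs_of_pos hz]

theorem kern_of_neg {a b σ z : ℝ} (hz : z < 0) : kern a b σ z = b * (-z) ^ (σ - 1) := by
  rw [kern, if_neg hz.not_gt, abs_of_neg hz]

theorem measurable_kern (a b σ : ℝ) : Measurable (kern a b σ) := by
  unfold kern
  exact (Measurable.ite measurableSet_Ioi measurable_const measurable_const).mul
    (measurable_norm.pow_const _)

theorem kern_nonneg {a b : ℝ} (ha : 0 ≤ a) (hb : 0 ≤ b) (σ z : ℝ) : 0 ≤ kern a b σ z := by
  unfold kern
  split_ifs <;> positivity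

theorem intervalIntegrable_kern_zero_pos {σ : ℝ} (hσ : 0 < σ) (a b : ℝ) {d : ℝ} (hd : 0 ≤ d) :
    IntervalIntegrable (kern a b σ) volume 0 d := by
  have h : IntervalIntegrable (fun z : ℝ => a * z ^ (σ - 1)) volume 0 d :=
    (intervalIntegral.intervalIntegrable_rpow' (by linarith)).const_mul a
  refine h.congr fun z hz => ?_
  rw [uIoc_of_le hd] at hz
  exact (kern_of_pos hz.1).symm

theorem intervalIntegrable_kern_zero {σ : ℝ} (hσ : 0 < σ) (hσ1 : σ < 1) (a b d : ℝ) :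
    IntervalIntegrable (kern a b σ) volume 0 d := by
  rcases le_total 0 d with hd | hd
  · exact intervalIntegrable_kern_zero_pos hσ a b hd
  · have h := (intervalIntegrable_kern_zero_pos hσ b a (d := -d) (by linarith)).comp_sub_left 0
    simpa only [zero_sub, neg_neg, neg_zero, kern_neg hσ1] using h

theorem intervalIntegrable_kern {σ : ℝ} (hσ : 0 < σ) (hσ1 : σ < 1) (a b c d : ℝ) :
    IntervalIntegrable (kern a b σ) volume c d :=
  (intervalIntegrable_kern_zero hσ hσ1 a b c).symm.trans
    (intervalIntegrable_kern_zero hσ hσ1 a b d)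

/-- Euler's identity for the homogeneous kernel: `z ↦ z k(z)` is a primitive of `σ k`. -/
theorem integral_kern_zero {σ : ℝ} (hσ : 0 < σ) (hσ1 : σ < 1) (a b d : ℝ) :
    σ * ∫ z in (0 : ℝ)..d, kern a b σ z = d * kern a b σ d := by
  have pos : ∀ (a b : ℝ) {d : ℝ}, 0 ≤ d →
      σ * ∫ z in (0 : ℝ)..d, kern a b σ z = d * kern a b σ d := by
    intro a b d hd
    rcases hd.eq_or_lt with rfl | hd'
    · simp
    have : ∫ z in (0 : ℝ)..d, kern a b σ z = ∫ z in (0 : ℝ)..d, a * z ^ (σ - 1) := by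
      rw [intervalIntegral.integral_of_le hd, intervalIntegral.integral_of_le hd]
      exact setIntegral_congr_fun measurableSet_Ioc fun z hz => kern_of_pos hz.1
    rw [this, intervalIntegral.integral_const_mul, integral_rpow (Or.inl (by linarith)),
      kern_of_pos hd', sub_add_cancel, Real.zero_rpow hσ.ne', Real.rpow_sub_one hd'.ne']
    field_simp
    ring
  rcases le_total 0 d with hd | hd
  · exact pos a b hd
  · have h := pos b a (d := -d) (by linarith)
    have h2 := intervalIntegral.integral_comp_neg (a := 0) (b := -d) (kern a b σ)
    simp only [kern_neg hσ1] at h2 h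
    rw [h2, neg_neg, neg_zero, intervalIntegral.integral_symm] at h
    linarith

theorem mul_kern_sub_mul_kern {σ : ℝ} (hσ : 0 < σ) (hσ1 : σ < 1) (a b c d : ℝ) :
    d * kern a b σ d - c * kern a b σ c = σ * ∫ z in c..d, kern a b σ z := by
  rw [← integral_kern_zero hσ hσ1, ← integral_kern_zero hσ hσ1,
    ← intervalIntegral.integral_interval_sub_left (intervalIntegrable_kern_zero hσ hσ1 a b d)
      (intervalIntegrable_kern_zero hσ hσ1 a b c)]
  ring

theorem integrableOn_kern {σ : ℝ} (hσ : 0 < σ) (hσ1 : σ < 1) (a b : ℝ) :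
    IntegrableOn (kern a b σ) (Ioo (-2) 2) :=
  (intervalIntegrable_iff_integrableOn_Ioo_of_le (by norm_num)).1
    (intervalIntegrable_kern hσ hσ1 a b (-2) 2)

/-- Young's inequality in its qualitative form: the double integral of the kernel against an
integrable function converges absolutely. -/
theorem integrable_kern_mul_prod {σ : ℝ} (hσ : 0 < σ) (hσ1 : σ < 1) (a b : ℝ) {u : ℝ → ℝ}
    (hu : Integrable u muLam) :
    Integrable (fun q : ℝ × ℝ => kern a b σ (q.1 - q.2) * u q.2) (muLam.prod muLam) := by
  have hk : Integrable ((Ioo (-2) 2).indicator (kern a b σ)) :=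
    (integrable_indicator_iff measurableSet_Ioo).2 (integrableOn_kern hσ hσ1 a b)
  have hu' : Integrable (Lam.indicator u) := (integrable_indicator_iff measurableSet_Ioo).2 hu
  have h := (hu'.convolution_integrand (ContinuousLinearMap.mul ℝ ℝ) hk).mono_measure
    (Measure.restrict_le_self (s := Lam ×ˢ Lam))
  rw [Measure.prod_restrict]
  refine h.congr ?_
  rw [Filter.EventuallyEq, ae_restrict_iff' (measurableSet_Ioo.prod measurableSet_Ioo)]
  refine Filter.Eventually.of_forall fun ⟨x, y⟩ ⟨hx, hy⟩ => ?_
  simp only [ContinuousLinearMap.mul_apply']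
  rw [indicator_of_mem hy, indicator_of_mem, mul_comm]
  exact ⟨by linarith [hx.1, hy.2], by linarith [hx.2, hy.1]⟩

theorem ae_integrable_kern_mul {σ : ℝ} (hσ : 0 < σ) (hσ1 : σ < 1) (a b : ℝ) {u : ℝ → ℝ}
    (hu : Integrable u muLam) :
    ∀ᵐ x ∂muLam, Integrable (fun y => kern a b σ (x - y) * u y) muLam :=
  (integrable_kern_mul_prod hσ hσ1 a b hu).prod_right_ae

theorem integrable_fracOp {σ : ℝ} (hσ : 0 < σ) (hσ1 : σ < 1) (a b : ℝ) {u : ℝ → ℝ}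
    (hu : Integrable u muLam) : Integrable (fracOp a b σ u) muLam :=
  (integrable_kern_mul_prod hσ hσ1 a b hu).integral_prod_left

theorem integral_abs_fracOp_le {σ : ℝ} (hσ : 0 < σ) (hσ1 : σ < 1) (a b : ℝ) {u : ℝ → ℝ}
    (hu : Integrable u muLam) :
    ∫ x in Lam, |fracOp a b σ u x| ≤
      (∫ z in Ioo (-2 : ℝ) 2, |kern a b σ z|) * ∫ y in Lam, |u y| := by
  have hp := (integrable_kern_mul_prod hσ hσ1 a b hu).norm
  have hk := (integrableOn_kern hσ hσ1 a b).abs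
  calc ∫ x in Lam, |fracOp a b σ u x|
      ≤ ∫ x in Lam, ∫ y in Lam, ‖kern a b σ (x - y) * u y‖ :=
        integral_mono (integrable_fracOp hσ hσ1 a b hu).abs hp.integral_prod_left
          fun x => norm_integral_le_integral_norm (fun y => kern a b σ (x - y) * u y)
    _ = ∫ y in Lam, ∫ x in Lam, ‖kern a b σ (x - y) * u y‖ := integral_integral_swap hp
    _ ≤ ∫ y in Lam, (∫ z in Ioo (-2 : ℝ) 2, |kern a b σ z|) * |u y| := by
        refine setIntegral_mono_on hp.integral_prod_right (hu.abs.const_mul _)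
          measurableSet_Ioo fun y hy => ?_
        simp only [norm_mul, Real.norm_eq_abs]
        rw [integral_mul_const]
        refine mul_le_mul_of_nonneg_right ?_ (abs_nonneg _)
        have h := intervalIntegral.integral_comp_sub_right (a := -1) (b := 1)
          (fun z => |kern a b σ z|) y
        rw [intervalIntegral.integral_of_le (by norm_num : (-1 : ℝ) ≤ 1),
          intervalIntegral.integral_of_le (by linarith), integral_Ioc_eq_integral_Ioo,
          integral_Ioc_eq_integral_Ioo] at h
        rw [h]
        exact setIntegral_mono_set hk (Filter.Eventually.of_forall fun z => abs_nonneg _)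
          (LE.le.eventuallyLE
            (Ioo_subset_Ioo (by linarith [hy.2]) (by linarith [hy.1])))
    _ = _ := integral_const_mul _ _

/-- The transpose of the operator with kernel `kern a b σ` has the reflected kernel. -/
theorem integral_mul_fracOp {σ : ℝ} (hσ1 : σ < 1) (a b : ℝ) {u v : ℝ → ℝ}
    (h : Integrable (fun q : ℝ × ℝ => v q.1 * (kern a b σ (q.1 - q.2) * u q.2))
      (muLam.prod muLam)) :
    ∫ x in Lam, v x * fracOp a b σ u x = ∫ y in Lam, u y * fracOp b a σ v y := by
  have := integral_integral_swap (f := fun x y => v x * (kern a b σ (x - y) * u y)) h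
  simp only [fracOp, ← integral_const_mul]
  rw [this]
  refine integral_congr_ae (Filter.Eventually.of_forall fun y => ?_)
  refine integral_congr_ae (Filter.Eventually.of_forall fun x => ?_)
  simp only
  rw [← neg_sub, kern_neg hσ1]
  ring

theorem fracOp_congr {a b σ : ℝ} {u v : ℝ → ℝ} (h : u =ᵐ[muLam] v) :
    fracOp a b σ u = fracOp a b σ v := by
  funext x
  exact integral_congr_ae (by filter_upwards [h] with y hy; rw [hy])

theorem fracOp_add_ae {σ : ℝ} (hσ : 0 < σ) (hσ1 : σ < 1) (a b : ℝ) {u v : ℝ → ℝ}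
    (hu : Integrable u muLam) (hv : Integrable v muLam) :
    fracOp a b σ (fun y => u y + v y) =ᵐ[muLam] fun x => fracOp a b σ u x + fracOp a b σ v x := by
  filter_upwards [ae_integrable_kern_mul hσ hσ1 a b hu, ae_integrable_kern_mul hσ hσ1 a b hv]
    with x h1 h2
  simp only [fracOp, mul_add]
  exact integral_add h1 h2

theorem fracOp_const_mul (a b σ r : ℝ) (u : ℝ → ℝ) :
    fracOp a b σ (fun y => r * u y) = fun x => r * fracOp a b σ u x := by
  funext x
  simp only [fracOp, ← integral_const_mul]
  congr 1
  funext y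
  ring

/-- The commutator of the fractional integral with multiplication by the variable is `-σ` times a
primitive of the fractional integral, up to a constant. This follows from `d/dz (z k(z)) = σ k(z)`
for the kernel `k`. -/
theorem fracOp_id_mul {σ : ℝ} (hσ : 0 < σ) (hσ1 : σ < 1) (a b : ℝ) {u : ℝ → ℝ}
    (hu : Integrable u muLam) :
    ∃ c : ℝ, ∀ᵐ x ∂muLam, fracOp a b σ (fun y => y * u y) x
      = x * fracOp a b σ u x - σ * (∫ s in (-1 : ℝ)..x, fracOp a b σ u s) - c := by
  have hyu : Integrable (fun y => y * u y) muLam := by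
    refine hu.bdd_mul (c := 1) (by fun_prop) ?_
    refine (ae_restrict_iff' measurableSet_Ioo).2 (Filter.Eventually.of_forall fun y hy => ?_)
    exact abs_le.2 ⟨hy.1.le, hy.2.le⟩
  refine ⟨∫ y in Lam, (-1 - y) * kern a b σ (-1 - y) * u y, ?_⟩
  filter_upwards [ae_integrable_kern_mul hσ hσ1 a b hu, ae_integrable_kern_mul hσ hσ1 a b hyu,
    ae_restrict_mem measurableSet_Ioo] with x h1 h2 hx
  have hprod : Integrable (fun q : ℝ × ℝ => kern a b σ (q.1 - q.2) * u q.2)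
      ((volume.restrict (Ioo (-1) x)).prod muLam) := by
    refine (integrable_kern_mul_prod hσ hσ1 a b hu).mono_measure ?_
    rw [Measure.prod_restrict, Measure.prod_restrict]
    exact Measure.restrict_mono (prod_mono (Ioo_subset_Ioo le_rfl hx.2.le) subset_rfl) le_rfl
  have hsw := integral_integral_swap (f := fun x y => kern a b σ (x - y) * u y) hprod
  have hI := hprod.integral_prod_right
  have hpt : ∀ y ∈ Lam, (-1 - y) * kern a b σ (-1 - y) * u y
      = x * (kern a b σ (x - y) * u y) - kern a b σ (x - y) * (y * u y)
        - σ * ∫ s in Ioo (-1) x, kern a b σ (s - y) * u y := by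
    intro y _
    have h := mul_kern_sub_mul_kern hσ hσ1 a b (-1 - y) (x - y)
    rw [← intervalIntegral.integral_comp_sub_right (fun z => kern a b σ z) y,
      intervalIntegral.integral_of_le hx.1.le, integral_Ioc_eq_integral_Ioo] at h
    rw [integral_mul_const]
    linear_combination (-u y) * h
  have i3 : Integrable (fun y => x * (kern a b σ (x - y) * u y)
      - kern a b σ (x - y) * (y * u y)) muLam := (h1.const_mul x).sub h2
  have i4 : Integrable (fun y => σ * ∫ s in Ioo (-1) x, kern a b σ (s - y) * u y) muLam :=
    hI.const_mul σ
  rw [setIntegral_congr_fun measurableSet_Ioo hpt, integral_sub i3 i4,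
    integral_sub (h1.const_mul x) h2, integral_const_mul, integral_const_mul,
    intervalIntegral.integral_of_le hx.1.le, integral_Ioc_eq_integral_Ioo]
  simp only [fracOp]
  rw [hsw]
  ring

/-- The operator with kernel `kern a b σ` as a combination of the left and the right integral. -/
theorem fracOp_eq {a b σ x : ℝ} {u : ℝ → ℝ} (hx : x ∈ Lam)
    (h1 : IntegrableOn (fun y => (x - y) ^ (σ - 1) * u y) (Ioo (-1) x))
    (h2 : IntegrableOn (fun y => (y - x) ^ (σ - 1) * u y) (Ioo x 1)) :
    Integrable (fun y => kern a b σ (x - y) * u y) muLam ∧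
    fracOp a b σ u x = a * (∫ y in Ioo (-1) x, (x - y) ^ (σ - 1) * u y)
      + b * ∫ y in Ioo x 1, (y - x) ^ (σ - 1) * u y := by
  have e1 : ∀ y ∈ Ioo (-1) x, a * ((x - y) ^ (σ - 1) * u y) = kern a b σ (x - y) * u y :=
    fun y hy => by rw [kern_of_pos (by linarith [hy.2]), mul_assoc]
  have e2 : ∀ y ∈ Ioo x 1, b * ((y - x) ^ (σ - 1) * u y) = kern a b σ (x - y) * u y :=
    fun y hy => by rw [kern_of_neg (by linarith [hy.1]), neg_sub, mul_assoc]
  have i1 : IntegrableOn (fun y => kern a b σ (x - y) * u y) (Ioc (-1) x) :=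
    (integrableOn_Ioc_iff_integrableOn_Ioo (by finiteness)).2
      ((integrableOn_congr_fun e1 measurableSet_Ioo).1 (h1.const_mul a))
  have i2 : IntegrableOn (fun y => kern a b σ (x - y) * u y) (Ioo x 1) :=
    (integrableOn_congr_fun e2 measurableSet_Ioo).1 (h2.const_mul b)
  have hU : Ioc (-1) x ∪ Ioo x 1 = Lam := Ioc_union_Ioo_eq_Ioo hx.1.le hx.2
  refine ⟨?_, ?_⟩
  · have := i1.union i2
    rwa [hU] at this
  · rw [fracOp, ← hU, setIntegral_union _ measurableSet_Ioo i1 i2, integral_Ioc_eq_integral_Ioo,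
      ← setIntegral_congr_fun measurableSet_Ioo e1, ← setIntegral_congr_fun measurableSet_Ioo e2,
      integral_const_mul, integral_const_mul]
    exact disjoint_left.2 fun y hy hy' => hy.2.not_gt hy'.1

theorem fracOp_eq_ae {σ : ℝ} (hσ : 0 < σ) (hσ1 : σ < 1) (a b : ℝ) {u : ℝ → ℝ}
    (hu : Integrable u muLam) :
    ∀ᵐ x ∂muLam, fracOp a b σ u x = a * (∫ y in Ioo (-1) x, (x - y) ^ (σ - 1) * u y)
      + b * ∫ y in Ioo x 1, (y - x) ^ (σ - 1) * u y := by
  filter_upwards [ae_integrable_kern_mul hσ hσ1 1 1 hu, ae_restrict_mem measurableSet_Ioo]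
    with x h hx
  refine (fracOp_eq hx ?_ ?_).2
  · refine (integrableOn_congr_fun (fun y hy => ?_) measurableSet_Ioo).1
      (IntegrableOn.mono_set h (Ioo_subset_Ioo le_rfl hx.2.le))
    rw [kern_of_pos (by linarith [hy.2]), one_mul]
  · refine (integrableOn_congr_fun (fun y hy => ?_) measurableSet_Ioo).1
      (IntegrableOn.mono_set h (Ioo_subset_Ioo hx.1.le le_rfl))
    rw [kern_of_neg (by linarith [hy.1]), one_mul, neg_sub]

theorem integrable_jacobiWeight {μ ν : ℝ} (hμ : -1 < μ) (hν : -1 < ν) :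
    Integrable (jacobiWeight μ ν) muLam := by
  have h := integrableOn_rpow_mul_one_sub_rpow (a := ν + 1) (b := μ + 1) (by linarith)
    (by linarith)
  rw [← intervalIntegrable_iff_integrableOn_Ioo_of_le (by norm_num)] at h
  have h2 := ((h.comp_mul_left (c := 1 / 2)).comp_add_right 1).const_mul (2 ^ μ * 2 ^ ν)
  norm_num at h2
  rw [intervalIntegrable_iff_integrableOn_Ioo_of_le (by norm_num)] at h2
  refine (integrableOn_congr_fun (fun y hy => ?_) measurableSet_Ioo).1 h2
  have h3 : 0 < 1 + y := by linarith [hy.1]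
  have h4 : 0 < 1 - y := by linarith [hy.2]
  rw [jacobiWeight, show 1 - 1 / 2 * (y + 1) = (1 - y) / 2 by ring,
    show 1 / 2 * (y + 1) = (1 + y) / 2 by ring, Real.div_rpow h3.le (by norm_num),
    Real.div_rpow h4.le (by norm_num)]
  have : (0 : ℝ) < 2 ^ μ := by positivity
  have : (0 : ℝ) < 2 ^ ν := by positivity
  field_simp

/-- The order `σ`, the exponents `μ`, `ν` of the Jacobi weight and the factors `a`, `b` of the left
and the right integral, subject to the conditions under which `fracOp a b σ` maps the weight
`(1 - y)^μ (1 + y)^ν` to a constant. -/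
structure AbelData (σ μ ν a b : ℝ) : Prop where
  pos : 0 < σ
  lt_one : σ < 1
  left_nonpos : μ ≤ 0
  right_nonpos : ν ≤ 0
  add_eq : μ + ν = -σ
  a_nonneg : 0 ≤ a
  b_nonneg : 0 ≤ b
  add_pos : 0 < a + b
  balance : a * Real.sin (Real.pi * μ) = b * Real.sin (Real.pi * ν)

/-- Passing to the transposed operator exchanges the two exponents and the two factors. -/
theorem AbelData.swap {σ μ ν a b : ℝ} (h : AbelData σ μ ν a b) : AbelData σ ν μ b a :=
  ⟨h.1, h.2, h.4, h.3, by linarith [h.5], h.7, h.6, by linarith [h.8], h.9.symm⟩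

theorem AbelData.left_gt {σ μ ν a b : ℝ} (h : AbelData σ μ ν a b) : -1 < μ := by
  linarith [h.lt_one, h.right_nonpos, h.add_eq]

theorem AbelData.right_gt {σ μ ν a b : ℝ} (h : AbelData σ μ ν a b) : -1 < ν := h.swap.left_gt

theorem AbelData.exists_fracOp_jacobiWeight {σ μ ν a b : ℝ} (h : AbelData σ μ ν a b) :
    ∃ l : ℝ, 0 < l ∧ ∀ x ∈ Lam,
      Integrable (fun y => kern a b σ (x - y) * jacobiWeight μ ν y) muLam ∧
      fracOp a b σ (jacobiWeight μ ν) x = l := by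
  obtain ⟨l, hl, H⟩ := exists_const_image h.pos h.lt_one h.left_nonpos h.right_nonpos h.add_eq
    h.a_nonneg h.b_nonneg h.add_pos h.balance
  refine ⟨l, hl, fun x hx => ?_⟩
  have h1 := integral_left_pos h.pos h.right_gt h.left_nonpos h.add_eq hx
  have h2 := integral_left_pos h.pos h.left_gt h.right_nonpos h.swap.add_eq (neg_mem_Lam hx)
  rw [← integral_right_eq_left hx] at h2
  have := fracOp_eq (a := a) (b := b) hx (not_imp_comm.1 integral_undef h1.ne')
    (not_imp_comm.1 integral_undef h2.ne')
  exact ⟨this.1, this.2.trans (H x hx)⟩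

section

open Polynomial

/-! ### Polynomials and the Jacobi weight -/

theorem exists_derivative_eq (r : ℝ[X]) : ∃ R : ℝ[X], derivative R = r := by
  induction r using Polynomial.induction_on' with
  | add p q hp hq =>
    obtain ⟨P, rfl⟩ := hp
    obtain ⟨Q, rfl⟩ := hq
    exact ⟨P + Q, derivative_add⟩
  | monomial n a =>
    refine ⟨monomial (n + 1) (a / (n + 1)), ?_⟩
    rw [derivative_monomial]
    have : (n : ℝ) + 1 ≠ 0 := by positivity
    push_cast
    rw [div_mul_cancel₀ _ this]

theorem polynomial_eq_of_ae_eq {p q : ℝ[X]}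
    (h : (fun x => p.eval x) =ᵐ[muLam] fun x => q.eval x) : p = q := by
  have h1 := Measure.eqOn_open_of_ae_eq h isOpen_Ioo p.continuous.continuousOn
    q.continuous.continuousOn
  exact eq_of_infinite_eval_eq p q
    ((Ioo_infinite (by norm_num : (-1 : ℝ) < 1)).mono fun x hx => h1 hx)

theorem exists_abs_eval_le (q : ℝ[X]) : ∃ M : ℝ, 0 ≤ M ∧ ∀ x ∈ Lam, |q.eval x| ≤ M := by
  obtain ⟨M, hM⟩ := isCompact_Icc.exists_bound_of_continuousOn (s := Icc (-1 : ℝ) 1)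
    q.continuous.continuousOn
  exact ⟨M, (abs_nonneg _).trans (hM 0 ⟨by norm_num, by norm_num⟩),
    fun x hx => hM x (Ioo_subset_Icc_self hx)⟩

theorem integrable_mul_eval {u : ℝ → ℝ} (hu : Integrable u muLam) (q : ℝ[X]) :
    Integrable (fun x => u x * q.eval x) muLam := by
  obtain ⟨M, _, hM⟩ := exists_abs_eval_le q
  exact hu.mul_bdd (c := M) q.continuous.aestronglyMeasurable
    ((ae_restrict_iff' measurableSet_Ioo).2 (Filter.Eventually.of_forall hM))

/-- Integration against the Jacobi weight, as a linear functional on polynomials. -/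
def jacobiIntegral {μ ν : ℝ} (hμ : -1 < μ) (hν : -1 < ν) : ℝ[X] →ₗ[ℝ] ℝ where
  toFun q := ∫ x in Lam, jacobiWeight μ ν x * q.eval x
  map_add' p q := by
    simp only [eval_add, mul_add]
    exact integral_add (integrable_mul_eval (integrable_jacobiWeight hμ hν) p)
      (integrable_mul_eval (integrable_jacobiWeight hμ hν) q)
  map_smul' r q := by
    simp only [eval_smul, smul_eq_mul, RingHom.id_apply, ← integral_const_mul]
    congr 1
    funext x
    ring

theorem jacobiIntegral_apply {μ ν : ℝ} (hμ : -1 < μ) (hν : -1 < ν) (q : ℝ[X]) :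
    jacobiIntegral hμ hν q = ∫ x in Lam, jacobiWeight μ ν x * q.eval x := rfl

theorem jacobiIntegral_mul_self_nonneg {μ ν : ℝ} (hμ : -1 < μ) (hν : -1 < ν) (q : ℝ[X]) :
    0 ≤ jacobiIntegral hμ hν (q * q) := by
  refine setIntegral_nonneg measurableSet_Ioo fun x hx => ?_
  rw [eval_mul]
  exact mul_nonneg (jacobiWeight_pos μ ν hx).le (mul_self_nonneg _)

theorem jacobiIntegral_mul_self_pos {μ ν : ℝ} (hμ : -1 < μ) (hν : -1 < ν) {q : ℝ[X]}
    (hq : q ≠ 0) : 0 < jacobiIntegral hμ hν (q * q) := by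
  refine (jacobiIntegral_mul_self_nonneg hμ hν q).lt_of_ne fun h0 => hq ?_
  have h1 : (fun x => jacobiWeight μ ν x * (q * q).eval x) =ᵐ[muLam] 0 := by
    rw [← integral_eq_zero_iff_of_nonneg_ae _
      (integrable_mul_eval (integrable_jacobiWeight hμ hν) _)]
    · exact h0.symm
    · refine (ae_restrict_iff' measurableSet_Ioo).2 (Filter.Eventually.of_forall fun x hx => ?_)
      simp only [eval_mul, Pi.zero_apply]
      exact mul_nonneg (jacobiWeight_pos μ ν hx).le (mul_self_nonneg _)
  refine polynomial_eq_of_ae_eq ?_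
  filter_upwards [h1, ae_restrict_mem measurableSet_Ioo] with x hx hxm
  simp only [eval_mul, Pi.zero_apply] at hx
  rw [eval_zero]
  exact mul_self_eq_zero.1 ((mul_eq_zero.1 hx).resolve_left (jacobiWeight_pos μ ν hxm).ne')

/-- The orthogonal projection of a polynomial onto the polynomials of degree less than `n`, for the
inner product `(p, q) ↦ L (p * q)`. -/
theorem exists_orthogonal (L : ℝ[X] →ₗ[ℝ] ℝ) (hL : ∀ q : ℝ[X], q ≠ 0 → 0 < L (q * q)) (n : ℕ) :
    ∀ p : ℝ[X], ∃ r : ℝ[X], (∀ m, n ≤ m → r.coeff m = 0) ∧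
      ∀ s : ℝ[X], (∀ m, n ≤ m → s.coeff m = 0) → L ((p - r) * s) = 0 := by
  induction n with
  | zero =>
    intro p
    refine ⟨0, fun m _ => coeff_zero m, fun s hs => ?_⟩
    have : s = 0 := by
      ext m
      exact hs m (Nat.zero_le m)
    rw [this, mul_zero, map_zero]
  | succ n ih =>
    intro p
    obtain ⟨r0, hr0, h0⟩ := ih (X ^ n)
    obtain ⟨r, hr, h⟩ := ih p
    set P := X ^ n - r0 with hP
    have hPn : P.coeff n = 1 := by rw [hP, coeff_sub, hr0 n le_rfl, coeff_X_pow_self, sub_zero]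
    have hPm : ∀ m, n + 1 ≤ m → P.coeff m = 0 := fun m hm => by
      rw [hP, coeff_sub, hr0 m (by omega), coeff_X_pow, if_neg (by omega), sub_zero]
    have hP0 : P ≠ 0 := fun h => by simp [h] at hPn
    have hpos := hL P hP0
    set t := L ((p - r) * P) / L (P * P) with ht
    refine ⟨r + t • P, fun m hm => ?_, fun s hs => ?_⟩
    · rw [coeff_add, coeff_smul, hr m (by omega), hPm m hm, smul_zero, add_zero]
    · obtain ⟨s', hs', hss⟩ : ∃ s', (∀ m, n ≤ m → s'.coeff m = 0) ∧ s = s.coeff n • P + s' := by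
        refine ⟨s - s.coeff n • P, fun m hm => ?_, by ring⟩
        rw [coeff_sub, coeff_smul]
        rcases hm.eq_or_lt with rfl | hm
        · rw [hPn, smul_eq_mul, mul_one, sub_self]
        · rw [hs m hm, hPm m hm, smul_zero, sub_zero]
      have e : (p - (r + t • P)) * s = s.coeff n • ((p - r) * P) - (s.coeff n * t) • (P * P)
          + (p - r) * s' - t • (P * s') := by
        conv_lhs => rw [hss]
        simp only [smul_eq_C_mul, C_mul]
        ring
      rw [e, map_sub, map_add, map_sub, map_smul, map_smul, map_smul, h s' hs', h0 s' hs', ht]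
      simp only [smul_eq_mul]
      field_simp
      ring

/-- The Jacobi differential operator `r ↦ -ω⁻¹ ((1 - x²) ω r')'` with `ω = (1 - x)^μ (1 + x)^ν`,
acting on polynomials. -/
def sturmLiouville (μ ν : ℝ) (r : ℝ[X]) : ℝ[X] :=
  X * (X * derivative (derivative r)) + C (μ + ν + 2) * (X * derivative r)
    - C (ν - μ) * derivative r - derivative (derivative r)

/-- The Jacobi operator does not raise degrees and multiplies the coefficient of `X ^ n` by
`n (n + μ + ν + 1)`, if `n` bounds the degree. -/
theorem sturmLiouville_coeff {μ ν : ℝ} {r : ℝ[X]} {n : ℕ} (hr : ∀ m, n < m → r.coeff m = 0) :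
    (∀ m, n < m → (sturmLiouville μ ν r).coeff m = 0) ∧
    (sturmLiouville μ ν r).coeff n = n * (n + μ + ν + 1) * r.coeff n := by
  have key : ∀ m, n ≤ m →
      (sturmLiouville μ ν r).coeff m = m * (m + μ + ν + 1) * r.coeff m := by
    intro m hm
    have h1 : r.coeff (m + 1) = 0 := hr _ (by omega)
    have h2 : r.coeff (m + 1 + 1) = 0 := hr _ (by omega)
    rw [sturmLiouville]
    rcases m with _ | _ | k
    · simp [coeff_derivative, h1, h2]
    · simp only [coeff_sub, coeff_add, coeff_C_mul, coeff_X_mul, coeff_X_mul_zero,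
        coeff_derivative, h1, h2]
      push_cast
      ring
    · simp only [coeff_sub, coeff_add, coeff_C_mul, coeff_X_mul, coeff_derivative, h1, h2]
      push_cast
      ring
  exact ⟨fun m hm => by rw [key m hm.le, hr m hm, mul_zero], key n le_rfl⟩

/-- Integration by parts for the Jacobi operator; the boundary terms vanish since `μ + 1` and
`ν + 1` are positive. -/
theorem jacobiIntegral_sturmLiouville {μ ν : ℝ} (hμ : -1 < μ) (hν : -1 < ν) (r s : ℝ[X]) :
    jacobiIntegral hμ hν (sturmLiouville μ ν r * s)
      = jacobiIntegral hμ hν ((1 - X ^ 2) * (derivative r * derivative s)) := by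
  rw [← sub_eq_zero, ← map_sub, jacobiIntegral_apply]
  set G := sturmLiouville μ ν r * s - (1 - X ^ 2) * (derivative r * derivative s) with hG
  let F : ℝ → ℝ := fun x => -((1 - x) ^ (μ + 1) * (1 + x) ^ (ν + 1) *
    (derivative r * s).eval x)
  have hF : ContinuousOn F (Icc (-1) 1) := by
    have h1 : Continuous fun x : ℝ => (1 - x) ^ (μ + 1) :=
      (Real.continuous_rpow_const (by linarith)).comp (by fun_prop)
    have h2 : Continuous fun x : ℝ => (1 + x) ^ (ν + 1) :=
      (Real.continuous_rpow_const (by linarith)).comp (by fun_prop)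
    exact ((h1.mul h2).mul (derivative r * s).continuous).neg.continuousOn
  have hd : ∀ x ∈ Ioo (-1 : ℝ) 1, HasDerivAt F (jacobiWeight μ ν x * G.eval x) x := by
    intro x hx
    have p1 : 0 < 1 - x := by linarith [hx.2]
    have p2 : 0 < 1 + x := by linarith [hx.1]
    have d1 := ((hasDerivAt_id x).const_sub 1).rpow_const (p := μ + 1) (Or.inl p1.ne')
    have d2 := ((hasDerivAt_id x).const_add 1).rpow_const (p := ν + 1) (Or.inl p2.ne')
    refine ((d1.mul d2).mul ((derivative r * s).hasDerivAt x)).neg.congr_deriv ?_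
    simp only [id_eq, add_sub_cancel_right, Real.rpow_add_one p1.ne', Real.rpow_add_one p2.ne',
      jacobiWeight, hG, sturmLiouville, eval_sub, eval_add, eval_mul, eval_X, eval_C, eval_pow,
      eval_one, derivative_mul, Pi.mul_apply]
    ring
  have hi : IntervalIntegrable (fun x => jacobiWeight μ ν x * G.eval x) volume (-1) 1 :=
    (intervalIntegrable_iff_integrableOn_Ioo_of_le (by norm_num)).2
      (integrable_mul_eval (integrable_jacobiWeight hμ hν) G)
  have h := intervalIntegral.integral_eq_sub_of_hasDerivAt_of_le (by norm_num) hF hd hi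
  rw [intervalIntegral.integral_of_le (by norm_num), integral_Ioc_eq_integral_Ioo] at h
  rw [h]
  simp [F, Real.zero_rpow (by linarith : μ + 1 ≠ 0), Real.zero_rpow (by linarith : ν + 1 ≠ 0)]

/-! ### The fractional integral on weighted polynomials -/

/-- The fractional integral of the polynomial `q` times the Jacobi weight is the polynomial `r`,
almost everywhere on `Λ`. -/
def IsImage (μ ν a b σ : ℝ) (q r : ℝ[X]) : Prop :=
  fracOp a b σ (fun y => jacobiWeight μ ν y * q.eval y) =ᵐ[muLam] fun x => r.eval x

variable {σ μ ν a b : ℝ}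

theorem AbelData.integrable_weight (h : AbelData σ μ ν a b) (q : ℝ[X]) :
    Integrable (fun y => jacobiWeight μ ν y * q.eval y) muLam :=
  integrable_mul_eval (integrable_jacobiWeight h.left_gt h.right_gt) q

theorem IsImage.add (h : AbelData σ μ ν a b) {q₁ q₂ r₁ r₂ : ℝ[X]}
    (h₁ : IsImage μ ν a b σ q₁ r₁) (h₂ : IsImage μ ν a b σ q₂ r₂) :
    IsImage μ ν a b σ (q₁ + q₂) (r₁ + r₂) := by
  have e := fracOp_add_ae h.pos h.lt_one a b (h.integrable_weight q₁) (h.integrable_weight q₂)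
  unfold IsImage
  simp only [eval_add, mul_add]
  filter_upwards [e, h₁, h₂] with x hx hx1 hx2
  rw [hx, hx1, hx2]

theorem IsImage.smul {q r : ℝ[X]} (h : IsImage μ ν a b σ q r) (t : ℝ) :
    IsImage μ ν a b σ (t • q) (t • r) := by
  have e := fracOp_const_mul a b σ t (fun y => jacobiWeight μ ν y * q.eval y)
  unfold IsImage
  simp only [eval_smul, smul_eq_mul, mul_left_comm _ t, e]
  filter_upwards [h] with x hx
  rw [hx]

theorem IsImage.unique {q r₁ r₂ : ℝ[X]} (h₁ : IsImage μ ν a b σ q r₁)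
    (h₂ : IsImage μ ν a b σ q r₂) : r₁ = r₂ :=
  polynomial_eq_of_ae_eq (h₁.symm.trans h₂)

/-- The commutator identity `fracOp_id_mul` for weighted polynomials. -/
theorem IsImage.X_mul (h : AbelData σ μ ν a b) {q r R : ℝ[X]} (hq : IsImage μ ν a b σ q r)
    (hR : derivative R = r) : ∃ c : ℝ, IsImage μ ν a b σ (X * q) (X * r - C σ * R - C c) := by
  obtain ⟨c, hc⟩ := fracOp_id_mul h.pos h.lt_one a b (h.integrable_weight q)
  refine ⟨c - σ * R.eval (-1), ?_⟩
  unfold IsImage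
  filter_upwards [hc, hq, ae_restrict_mem measurableSet_Ioo] with x hx hqx hxm
  have e : (fun y => jacobiWeight μ ν y * (X * q).eval y)
      = fun y => y * (jacobiWeight μ ν y * q.eval y) := by
    funext y
    rw [eval_mul, eval_X]
    ring
  have e2 : ∫ s in (-1 : ℝ)..x, fracOp a b σ (fun y => jacobiWeight μ ν y * q.eval y) s
      = R.eval x - R.eval (-1) := by
    rw [← intervalIntegral.integral_eq_sub_of_hasDerivAt (fun s _ => R.hasDerivAt s)
      ((derivative R).continuous.intervalIntegrable _ _), hR]
    refine intervalIntegral.integral_congr_ae ?_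
    have := (ae_restrict_iff' measurableSet_Ioo).1 hq
    filter_upwards [this] with s hs hsm
    rw [uIoc_of_le hxm.1.le] at hsm
    exact hs ⟨hsm.1, hsm.2.trans_lt hxm.2⟩
  rw [e, hx, hqx, e2]
  simp only [eval_sub, eval_mul, eval_X, eval_C]
  ring

/-- The numbers `∏_{k=1}^n (1 - σ / k)`. Up to a common positive factor they are the diagonal
entries of the fractional integral, as a triangular map `q ↦ r` on polynomials. -/
def eigenFactor (σ : ℝ) : ℕ → ℝ
  | 0 => 1
  | n + 1 => eigenFactor σ n * (1 - σ / (n + 1))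

theorem eigenFactor_pos (hσ1 : σ < 1) (n : ℕ) : 0 < eigenFactor σ n := by
  induction n with
  | zero => exact one_pos
  | succ n ih =>
    refine mul_pos ih ?_
    have hn : (0 : ℝ) < n + 1 := by positivity
    rw [sub_pos, div_lt_one hn]
    have : (0 : ℝ) ≤ n := by positivity
    linarith

/-- The diagonal entries decay no faster than `1 / n`, so that inverting costs at most one
derivative. -/
theorem one_sub_le_mul_eigenFactor (hσ1 : σ < 1) (n : ℕ) :
    1 - σ ≤ (n + 1) * eigenFactor σ (n + 1) := by
  induction n with
  | zero => simp [eigenFactor]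
  | succ n ih =>
    refine ih.trans ?_
    have h := eigenFactor_pos hσ1 (n + 1)
    rw [eigenFactor.eq_2 σ (n + 1)]
    have hn : (0 : ℝ) < (n : ℝ) + 1 + 1 := by positivity
    push_cast
    have : ((n : ℝ) + 1 + 1) * (eigenFactor σ (n + 1) * (1 - σ / ((n : ℝ) + 1 + 1)))
        = eigenFactor σ (n + 1) * ((n : ℝ) + 1 + 1 - σ) := by field_simp
    rw [this, mul_comm]
    exact mul_le_mul_of_nonneg_left (by linarith) h.le

/-- The fractional integral maps the weight times a polynomial of degree at most `n` to a polynomial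
of degree at most `n`, and multiplies the coefficient of `X ^ n` by a positive factor. Induction
on `n` through `q = X * q.divX + C (q.coeff 0)` and the commutator identity. -/
theorem AbelData.exists_image (h : AbelData σ μ ν a b) : ∃ l : ℝ, 0 < l ∧
    ∀ (n : ℕ) (q : ℝ[X]), (∀ m, n < m → q.coeff m = 0) → ∃ r : ℝ[X], IsImage μ ν a b σ q r ∧
      (∀ m, n < m → r.coeff m = 0) ∧ r.coeff n = l * eigenFactor σ n * q.coeff n := by
  obtain ⟨l, hl, H⟩ := h.exists_fracOp_jacobiWeight
  have hC : ∀ t : ℝ, IsImage μ ν a b σ (C t) (C (l * t)) := by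
    intro t
    unfold IsImage
    simp only [eval_C, mul_comm _ t]
    rw [fracOp_const_mul]
    filter_upwards [ae_restrict_mem measurableSet_Ioo] with x hx
    rw [(H x hx).2]
  refine ⟨l, hl, fun n => ?_⟩
  induction n with
  | zero =>
    intro q hq
    have : q = C (q.coeff 0) := by
      ext m
      rcases m with _ | m
      · simp
      · rw [hq _ (by omega), coeff_C, if_neg (by omega)]
    refine ⟨C (l * q.coeff 0), ?_, fun m hm => ?_, ?_⟩
    · rw [this]
      simpa using hC (q.coeff 0)
    · rw [coeff_C, if_neg (by omega)]
    · simp [eigenFactor]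
  | succ n ih =>
    intro q hq
    obtain ⟨r, hr, hrm, hrn⟩ := ih q.divX fun m hm => by
      rw [coeff_divX]; exact hq _ (by omega)
    obtain ⟨R, hR⟩ := exists_derivative_eq r
    obtain ⟨c, hc⟩ := hr.X_mul h hR
    have hRc : ∀ m, R.coeff (m + 1) * (m + 1) = r.coeff m := fun m => by
      rw [← hR, coeff_derivative]
    have hRm : ∀ m, n < m → R.coeff (m + 1) = 0 := fun m hm => by
      have := hRc m
      rw [hrm m hm] at this
      exact (mul_eq_zero.1 this).resolve_right (by positivity)
    refine ⟨(X * r - C σ * R - C c) + C (l * q.coeff 0), ?_, fun m hm => ?_, ?_⟩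
    · have := hc.add h (hC (q.coeff 0))
      rwa [mul_comm X, divX_mul_X_add] at this
    · obtain ⟨k, rfl⟩ : ∃ k, m = k + 1 := ⟨m - 1, by omega⟩
      simp [coeff_X_mul, coeff_C_succ, hrm k (by omega), hRm k (by omega)]
    · have h1 := hRc n
      rw [coeff_divX] at hrn
      have hn : (n : ℝ) + 1 ≠ 0 := by positivity
      have h2 : R.coeff (n + 1) = r.coeff n / (n + 1) := by rw [← h1]; field_simp
      simp only [coeff_add, coeff_sub, coeff_X_mul, coeff_C_mul, coeff_C_succ, h2, hrn,
        eigenFactor]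
      ring

/-- A triangular map with nonzero diagonal is onto: every polynomial is the fractional integral of a
weighted polynomial. -/
theorem AbelData.exists_preimage (h : AbelData σ μ ν a b) (r : ℝ[X]) :
    ∃ q, IsImage μ ν a b σ q r := by
  obtain ⟨l, hl, H⟩ := h.exists_image
  have key : ∀ (n : ℕ) (r : ℝ[X]), (∀ m, n ≤ m → r.coeff m = 0) →
      ∃ q, IsImage μ ν a b σ q r := by
    intro n
    induction n with
    | zero =>
      intro r hr
      have : r = 0 := by ext m; exact hr m (Nat.zero_le m)
      subst this
      refine ⟨0, ?_⟩
      unfold IsImage fracOp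
      simp
    | succ n ih =>
      intro r hr
      obtain ⟨r', hr', hm, hn⟩ := H n (X ^ n) fun m hm => by
        rw [coeff_X_pow, if_neg (by omega)]
      have hpos := mul_pos hl (eigenFactor_pos h.lt_one n)
      rw [coeff_X_pow_self, mul_one] at hn
      set t := r.coeff n / (l * eigenFactor σ n) with ht
      obtain ⟨q, hq⟩ := ih (r - t • r') fun m hm' => by
        rw [coeff_sub, coeff_smul, smul_eq_mul]
        rcases hm'.eq_or_lt with rfl | hm''
        · rw [hn, ht, div_mul_cancel₀ _ hpos.ne', sub_self]
        · rw [hr m hm'', hm m hm'', mul_zero, sub_zero]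
      refine ⟨q + t • X ^ n, ?_⟩
      have := hq.add h (hr'.smul t)
      rwa [sub_add_cancel] at this
  exact key (r.natDegree + 1) r fun m hm => coeff_eq_zero_of_natDegree_lt (by omega)

/-- Absolute convergence of the double integral that pairs an integrable function with the image of
a weighted polynomial. It holds for `v ∈ L¹` since the positive kernel maps the weight to a
constant. -/
theorem AbelData.integrable_mul_kern (h : AbelData σ μ ν a b) {v : ℝ → ℝ}
    (hv : Integrable v muLam) (q : ℝ[X]) :
    Integrable (fun z : ℝ × ℝ => v z.1 * (kern a b σ (z.1 - z.2) *
      (jacobiWeight μ ν z.2 * q.eval z.2))) (muLam.prod muLam) := by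
  obtain ⟨l, hl, H⟩ := h.exists_fracOp_jacobiWeight
  have h1 : Integrable (fun z : ℝ × ℝ => v z.1 * (kern a b σ (z.1 - z.2) *
      jacobiWeight μ ν z.2)) (muLam.prod muLam) := by
    have hm : AEStronglyMeasurable (fun z : ℝ × ℝ => v z.1 * (kern a b σ (z.1 - z.2) *
        jacobiWeight μ ν z.2)) (muLam.prod muLam) := by
      refine hv.aestronglyMeasurable.comp_fst.mul (Measurable.aestronglyMeasurable ?_)
      exact ((measurable_kern a b σ).comp (measurable_fst.sub measurable_snd)).mul
        ((measurable_jacobiWeight μ ν).comp measurable_snd)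
    rw [integrable_prod_iff hm]
    refine ⟨?_, ?_⟩
    · filter_upwards [ae_restrict_mem measurableSet_Ioo] with x hx
      exact (H x hx).1.const_mul _
    · refine (hv.norm.mul_const l).congr ?_
      filter_upwards [ae_restrict_mem measurableSet_Ioo] with x hx
      simp only [norm_mul]
      rw [integral_const_mul, ← (H x hx).2, fracOp]
      congr 1
      refine setIntegral_congr_fun measurableSet_Ioo fun y hy => ?_
      rw [Real.norm_of_nonneg (kern_nonneg h.a_nonneg h.b_nonneg σ _),
        Real.norm_of_nonneg (jacobiWeight_pos μ ν hy).le]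
  obtain ⟨M, _, hM⟩ := exists_abs_eval_le q
  have := h1.mul_bdd (c := M) (g := fun z : ℝ × ℝ => q.eval z.2)
    (q.continuous.comp continuous_snd).aestronglyMeasurable (by
      rw [Measure.prod_restrict, ae_restrict_iff' (measurableSet_Ioo.prod measurableSet_Ioo)]
      exact Filter.Eventually.of_forall fun z hz => hM z.2 hz.2)
  refine this.congr (Filter.Eventually.of_forall fun z => ?_)
  simp only
  ring

/-- Transposition, for an arbitrary integrable function and a weighted polynomial. -/
theorem AbelData.integral_mul_image (h : AbelData σ μ ν a b) {v : ℝ → ℝ}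
    (hv : Integrable v muLam) {q r : ℝ[X]} (hq : IsImage μ ν a b σ q r) :
    ∫ x in Lam, v x * r.eval x
      = ∫ y in Lam, jacobiWeight μ ν y * q.eval y * fracOp b a σ v y := by
  rw [← integral_mul_fracOp h.lt_one a b (h.integrable_mul_kern hv q)]
  refine integral_congr_ae ?_
  filter_upwards [hq] with x hx
  rw [hx]

/-- Transposition for two weighted polynomials. The transposed operator belongs to the weight with
exchanged exponents. -/
theorem AbelData.jacobiIntegral_mul_image (h : AbelData σ μ ν a b) {q r s t : ℝ[X]}
    (hq : IsImage μ ν a b σ q r) (hs : IsImage ν μ b a σ s t) :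
    jacobiIntegral h.right_gt h.left_gt (s * r) = jacobiIntegral h.left_gt h.right_gt (q * t) := by
  have e := h.integral_mul_image (h.swap.integrable_weight s) hq
  rw [jacobiIntegral_apply, jacobiIntegral_apply]
  simp only [eval_mul, ← mul_assoc]
  rw [e]
  refine integral_congr_ae ?_
  filter_upwards [hs] with x hx
  rw [hx]

/-- The weighted `L²` norm of `q` is bounded by a weighted `H¹` norm of the image `r` of `q` times
the weight. Induction on the degree: the fractional integral maps a polynomial `P` orthogonal to
all lower degrees for the weight `(1 - x)^μ (1 + x)^ν` to a polynomial `Q` with the same property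
for `(1 - x)^ν (1 + x)^μ`. Hence the contribution of `P` splits off from all three integrals, the
last one by `jacobiIntegral_sturmLiouville`, and the one-dimensional inequality for `P` and `Q`
is `one_sub_le_mul_eigenFactor`. -/
theorem AbelData.energy_estimate (h : AbelData σ μ ν a b) : ∃ δ : ℝ, 0 < δ ∧
    ∀ q r : ℝ[X], IsImage μ ν a b σ q r →
      δ * jacobiIntegral h.left_gt h.right_gt (q * q) ≤
        jacobiIntegral h.right_gt h.left_gt (r * r) +
        jacobiIntegral h.right_gt h.left_gt ((1 - X ^ 2) * (derivative r * derivative r)) := by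
  obtain ⟨l, hl, H⟩ := h.exists_image
  obtain ⟨l', hl', H'⟩ := h.swap.exists_image
  set L := jacobiIntegral h.left_gt h.right_gt with hLdef
  set L' := jacobiIntegral h.right_gt h.left_gt with hLdef'
  have hσ := h.pos
  have hσ1 : 0 < 1 - σ := by linarith [h.lt_one]
  refine ⟨l * l' * (1 - σ) ^ 2, by positivity, ?_⟩
  have hfac : ∀ n : ℕ, (1 - σ) ^ 2 ≤ (1 + n * (n + ν + μ + 1)) * eigenFactor σ n ^ 2 := by
    intro n
    rcases n with _ | n
    · simp only [eigenFactor]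
      norm_num
      rw [abs_le]
      constructor <;> linarith
    · have h1 := one_sub_le_mul_eigenFactor h.lt_one n
      have h2 : (1 - σ) ^ 2 ≤ ((n + 1) * eigenFactor σ (n + 1)) ^ 2 := by gcongr
      refine h2.trans ?_
      rw [mul_pow]
      refine mul_le_mul_of_nonneg_right ?_ (sq_nonneg _)
      have h3 : ν + μ = -σ := by linarith [h.add_eq]
      have hn : (0 : ℝ) ≤ n := by positivity
      push_cast
      nlinarith
  have key : ∀ (n : ℕ) (q r : ℝ[X]), (∀ m, n ≤ m → q.coeff m = 0) → IsImage μ ν a b σ q r →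
      l * l' * (1 - σ) ^ 2 * L (q * q) ≤
        L' (r * r) + L' ((1 - X ^ 2) * (derivative r * derivative r)) := by
    intro n
    induction n with
    | zero =>
      intro q r hq hr
      have hq0 : q = 0 := by ext m; exact hq m (Nat.zero_le m)
      have hr0 : r = 0 := by
        refine hr.unique ?_
        rw [hq0]
        unfold IsImage fracOp
        simp
      simp [hq0, hr0]
    | succ n ih =>
      intro q r hq hr
      obtain ⟨p, hp, hporth⟩ := exists_orthogonal L
        (fun q hq => jacobiIntegral_mul_self_pos _ _ hq) n (X ^ n)
      set P := X ^ n - p with hP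
      have hPn : P.coeff n = 1 := by rw [hP, coeff_sub, hp n le_rfl, coeff_X_pow_self, sub_zero]
      have hPm : ∀ m, n < m → P.coeff m = 0 := fun m hm => by
        rw [hP, coeff_sub, hp m hm.le, coeff_X_pow, if_neg (by omega), sub_zero]
      obtain ⟨Q, hQ, hQm, hQn⟩ := H n P hPm
      rw [hPn, mul_one] at hQn
      obtain ⟨Q', hQ', hQm', hQn'⟩ := H' n Q hQm
      -- `Q` is orthogonal to the polynomials of degree less than `n`
      have hQorth : ∀ s : ℝ[X], (∀ m, n ≤ m → s.coeff m = 0) → L' (s * Q) = 0 := by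
        intro s hs
        obtain ⟨t, ht, htm, htn⟩ := H' n s fun m hm => hs m hm.le
        rw [hs n le_rfl, mul_zero] at htn
        rw [hLdef', h.jacobiIntegral_mul_image hQ ht]
        refine hporth t fun m hm => ?_
        rcases hm.eq_or_lt with rfl | hm
        · exact htn
        · exact htm m hm
      -- hence only the coefficient of `X ^ n` matters in a pairing with `Q`
      have hpair : ∀ s : ℝ[X], (∀ m, n < m → s.coeff m = 0) →
          l * eigenFactor σ n * L' (s * Q) = s.coeff n * L' (Q * Q) := by
        intro s hs
        have h0 := hQorth ((l * eigenFactor σ n) • s - s.coeff n • Q) fun m hm => by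
          rw [coeff_sub, coeff_smul, coeff_smul, smul_eq_mul, smul_eq_mul]
          rcases hm.eq_or_lt with rfl | hm
          · rw [hQn]; ring
          · rw [hs m hm, hQm m hm]; ring
        rw [sub_mul, map_sub, smul_mul_assoc, smul_mul_assoc, map_smul, map_smul,
          smul_eq_mul, smul_eq_mul] at h0
        linarith
      have hnorm : L' (Q * Q) = l * l' * eigenFactor σ n ^ 2 * L (P * P) := by
        rw [hLdef', h.jacobiIntegral_mul_image hQ hQ', ← hLdef]
        have h0 := hporth (Q' - (l * l' * eigenFactor σ n ^ 2) • P) fun m hm => by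
          rw [coeff_sub, coeff_smul, smul_eq_mul]
          rcases hm.eq_or_lt with rfl | hm
          · rw [hQn', hQn, hPn]; ring
          · rw [hQm' m hm, hPm m hm]; ring
        rw [mul_sub, map_sub, mul_smul_comm, map_smul, smul_eq_mul] at h0
        linarith
      have he : 0 < l * eigenFactor σ n := mul_pos hl (eigenFactor_pos h.lt_one n)
      obtain ⟨hSm, hSn⟩ := sturmLiouville_coeff (μ := ν) (ν := μ) hQm
      have hSQ : L' (sturmLiouville ν μ Q * Q) = n * (n + ν + μ + 1) * L' (Q * Q) := by
        have := hpair _ hSm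
        rw [hSn, hQn] at this
        refine mul_left_cancel₀ he.ne' ?_
        rw [this]
        ring
      -- split off the component along `P`
      set t := q.coeff n with ht
      set q₀ := q - t • P with hq₀
      have hq₀m : ∀ m, n ≤ m → q₀.coeff m = 0 := fun m hm => by
        rw [hq₀, coeff_sub, coeff_smul, smul_eq_mul]
        rcases hm.eq_or_lt with rfl | hm
        · rw [hPn, ht]; ring
        · rw [hq m hm, hPm m hm]; ring
      obtain ⟨r₀, hr₀, hr₀m, hr₀n⟩ := H n q₀ fun m hm => hq₀m m hm.le
      rw [hq₀m n le_rfl, mul_zero] at hr₀n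
      have hr₀' : ∀ m, n ≤ m → r₀.coeff m = 0 := fun m hm => by
        rcases hm.eq_or_lt with rfl | hm
        · exact hr₀n
        · exact hr₀m m hm
      have hrr : r = r₀ + t • Q := by
        refine hr.unique ?_
        have := hr₀.add h (hQ.smul t)
        rwa [hq₀, sub_add_cancel] at this
      have hqq : q = q₀ + t • P := by rw [hq₀, sub_add_cancel]
      have IH := ih q₀ r₀ hq₀m hr₀
      have c1 : L (q * q) = L (q₀ * q₀) + t ^ 2 * L (P * P) := by
        have e : q * q = q₀ * q₀ + (2 * t) • (P * q₀) + (t ^ 2) • (P * P) := by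
          rw [hqq]
          simp only [smul_eq_C_mul, C_mul, C_pow]
          rw [show (C 2 : ℝ[X]) = 2 from rfl]
          ring
        rw [e, map_add, map_add, map_smul, map_smul, hporth q₀ hq₀m]
        simp
      have c2 : L' (r * r) = L' (r₀ * r₀) + t ^ 2 * L' (Q * Q) := by
        have e : r * r = r₀ * r₀ + (2 * t) • (r₀ * Q) + (t ^ 2) • (Q * Q) := by
          rw [hrr]
          simp only [smul_eq_C_mul, C_mul, C_pow]
          rw [show (C 2 : ℝ[X]) = 2 from rfl]
          ring
        rw [e, map_add, map_add, map_smul, map_smul, hQorth r₀ hr₀']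
        simp
      have c3 : L' ((1 - X ^ 2) * (derivative r * derivative r))
          = L' ((1 - X ^ 2) * (derivative r₀ * derivative r₀))
            + t ^ 2 * (n * (n + ν + μ + 1) * L' (Q * Q)) := by
        have e : (1 - X ^ 2) * (derivative r * derivative r)
            = (1 - X ^ 2) * (derivative r₀ * derivative r₀)
              + (2 * t) • ((1 - X ^ 2) * (derivative r₀ * derivative Q))
              + (t ^ 2) • ((1 - X ^ 2) * (derivative Q * derivative Q)) := by
          rw [hrr, derivative_add, derivative_smul]
          simp only [smul_eq_C_mul, C_mul, C_pow]
          rw [show (C 2 : ℝ[X]) = 2 from rfl]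
          ring
        have hS₀ := sturmLiouville_coeff (μ := ν) (ν := μ) hr₀m
        rw [e, map_add, map_add, map_smul, map_smul, hLdef',
          ← jacobiIntegral_sturmLiouville h.right_gt h.left_gt r₀ Q,
          ← jacobiIntegral_sturmLiouville h.right_gt h.left_gt Q Q, ← hLdef', hSQ,
          hQorth _ fun m hm => ?_]
        · simp
        · rcases hm.eq_or_lt with rfl | hm
          · rw [hS₀.2, hr₀n, mul_zero]
          · exact hS₀.1 m hm
      rw [c1, c2, c3, hnorm]
      have hPP : 0 ≤ L (P * P) := jacobiIntegral_mul_self_nonneg _ _ P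
      have hll : 0 ≤ l * l' * L (P * P) * t ^ 2 := by positivity
      have := mul_le_mul_of_nonneg_left (hfac n) hll
      linarith
  intro q r hr
  exact key (q.natDegree + 1) q r (fun m hm => coeff_eq_zero_of_natDegree_lt (by omega)) hr

/-! ### The Sobolev space on the interval -/

theorem HasWeakDeriv.ae_unique {w g g' : ℝ → ℝ} (h : HasWeakDeriv w g) (h' : HasWeakDeriv w g')
    (hg : Integrable g muLam) (hg' : Integrable g' muLam) : g =ᵐ[muLam] g' := by
  have main : ∀ᵐ x ∂(volume : Measure ℝ), x ∈ Lam → g x - g' x = 0 := by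
    refine isOpen_Ioo.ae_eq_zero_of_integral_contDiff_smul_eq_zero
      (IntegrableOn.locallyIntegrableOn (hg.sub hg')) fun φ h1 h2 h3 => ?_
    have e := (h φ h1 h2 h3).symm.trans (h' φ h1 h2 h3)
    rw [← setIntegral_eq_integral_of_forall_compl_eq_zero (s := Lam)]
    · have i1 := integrable_mul_of_continuous hg h1.continuous h2
      have i2 := integrable_mul_of_continuous hg' h1.continuous h2
      have : ∫ x in Lam, φ x • (g x - g' x) = (∫ x in Lam, g x * φ x) - ∫ x in Lam, g' x * φ x := by
        rw [← integral_sub i1 i2]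
        refine integral_congr_ae (Filter.Eventually.of_forall fun x => ?_)
        simp only [smul_eq_mul]
        ring
      rw [this]
      linarith
    · intro x hx
      rw [image_eq_zero_of_notMem_tsupport fun h => hx (h3 h), zero_smul]
  filter_upwards [(ae_restrict_iff' (μ := volume) measurableSet_Ioo).2 main] with x hx
  linarith

theorem H1.ext_fst {w z : H1} (h : w.1.fst = z.1.fst) : w = z := by
  have hz := z.2.congr (by rw [← h]) (Filter.EventuallyEq.refl _ _)
  have e := HasWeakDeriv.ae_unique w.2 hz (integrable_of_L2 _) (integrable_of_L2 _)
  refine Subtype.ext ((WithLp.ofLp_injective 2) (Prod.ext h (Lp.ext e)))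

theorem L2_norm_sq (g : Lp ℝ 2 muLam) : ‖g‖ ^ 2 = ∫ x in Lam, g x ^ 2 := by
  rw [← real_inner_self_eq_norm_sq, L2.inner_def]
  refine integral_congr_ae (Filter.Eventually.of_forall fun x => ?_)
  simp [sq]

theorem integral_abs_le_L2_norm (g : Lp ℝ 2 muLam) : ∫ x in Lam, |g x| ≤ 2 * ‖g‖ := by
  have hi := (integrable_of_L2 g).abs
  have hs : Integrable (fun x => g x ^ 2) muLam := (Lp.memLp g).integrable_sq
  rcases (norm_nonneg g).eq_or_lt with h0 | hpos
  · have : g = 0 := norm_eq_zero.1 h0.symm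
    subst this
    have e : ∫ x in Lam, |(0 : Lp ℝ 2 muLam) x| = ∫ x in Lam, (0 : ℝ) := by
      refine integral_congr_ae ?_
      filter_upwards [Lp.coeFn_zero ℝ 2 muLam] with x hx
      rw [hx]
      simp
    rw [e]
    simp
  · have hle : ∫ x in Lam, |g x| ≤ ∫ x in Lam, (‖g‖ / 2 + (1 / (2 * ‖g‖)) * g x ^ 2) := by
      refine integral_mono hi ((integrable_const _).add (hs.const_mul _)) fun x => ?_
      have : 0 ≤ (|g x| - ‖g‖) ^ 2 := sq_nonneg _
      simp only
      rw [← sq_abs (g x)]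
      have e : ‖g‖ / 2 + 1 / (2 * ‖g‖) * |g x| ^ 2
          = |g x| + (|g x| - ‖g‖) ^ 2 / (2 * ‖g‖) := by
        field_simp
        ring
      rw [e]
      have : 0 ≤ (|g x| - ‖g‖) ^ 2 / (2 * ‖g‖) := by positivity
      linarith
    refine hle.trans ?_
    rw [integral_add (integrable_const _) (hs.const_mul _), integral_const_mul, ← L2_norm_sq]
    have : ∫ x in Lam, ‖g‖ / 2 = ‖g‖ := by
      simp
      norm_num
      ring
    rw [this]
    field_simp
    norm_num

theorem intervalIntegrable_L2 (g : Lp ℝ 2 muLam) : IntervalIntegrable g volume (-1) 1 := by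
  rw [intervalIntegrable_iff_integrableOn_Ioo_of_le (by norm_num)]
  exact integrable_of_L2 g

theorem abs_integral_le_L2_norm (g : Lp ℝ 2 muLam) {x y : ℝ} (hx : x ∈ Icc (-1 : ℝ) 1)
    (hy : y ∈ Icc (-1 : ℝ) 1) : |∫ t in x..y, g t| ≤ 2 * ‖g‖ := by
  refine le_trans ?_ (integral_abs_le_L2_norm g)
  rw [← Real.norm_eq_abs]
  refine intervalIntegral.norm_integral_le_integral_norm_uIoc.trans ?_
  have hs : uIoc x y ⊆ Ioc (-1) 1 := Ioc_subset_Ioc (le_min hx.1 hy.1) (max_le hx.2 hy.2)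
  rw [← integral_Ioc_eq_integral_Ioo]
  exact setIntegral_mono_set ((integrableOn_Ioc_iff_integrableOn_Ioo (by finiteness)).2
    (integrable_of_L2 g).norm) (Filter.Eventually.of_forall fun t => norm_nonneg _)
    (LE.le.eventuallyLE hs)

theorem trace_continuousOn (w : H1) : ContinuousOn (trace w) (Icc (-1) 1) :=
  (H1.exists_continuous_rep w).choose_spec.1

theorem trace_ae_eq (w : H1) : w.1.fst =ᵐ[muLam] trace w :=
  (H1.exists_continuous_rep w).choose_spec.2

theorem eqOn_Icc_of_ae_eq_muLam {f g : ℝ → ℝ} (h : f =ᵐ[muLam] g)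
    (hf : ContinuousOn f (Icc (-1) 1)) (hg : ContinuousOn g (Icc (-1) 1)) :
    EqOn f g (Icc (-1) 1) := by
  refine Measure.eqOn_Icc_of_ae_eq (μ := volume) (by norm_num) ?_ hf hg
  rwa [Measure.restrict_congr_set Ioo_ae_eq_Icc.symm]

theorem trace_eq_of_ae_eq {w : H1} {W : ℝ → ℝ} (hW : ContinuousOn W (Icc (-1) 1))
    (h : w.1.fst =ᵐ[muLam] W) {x : ℝ} (hx : x ∈ Icc (-1 : ℝ) 1) : trace w x = W x :=
  eqOn_Icc_of_ae_eq_muLam ((trace_ae_eq w).symm.trans h) (trace_continuousOn w) hW hx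

theorem trace_add (w z : H1) {x : ℝ} (hx : x ∈ Icc (-1 : ℝ) 1) :
    trace (w + z) x = trace w x + trace z x := by
  refine trace_eq_of_ae_eq (W := fun x => trace w x + trace z x)
    ((trace_continuousOn w).add (trace_continuousOn z)) ?_ hx
  have h : (w + z).1.fst = w.1.fst + z.1.fst := rfl
  rw [h]
  filter_upwards [Lp.coeFn_add w.1.fst z.1.fst, trace_ae_eq w, trace_ae_eq z] with t h1 h2 h3
  rw [h1, Pi.add_apply, h2, h3]

theorem trace_smul (r : ℝ) (w : H1) {x : ℝ} (hx : x ∈ Icc (-1 : ℝ) 1) :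
    trace (r • w) x = r * trace w x := by
  refine trace_eq_of_ae_eq (W := fun x => r * trace w x)
    (continuousOn_const.mul (trace_continuousOn w)) ?_ hx
  have h : (r • w).1.fst = r • w.1.fst := rfl
  rw [h]
  filter_upwards [Lp.coeFn_smul r w.1.fst, trace_ae_eq w] with t h1 h2
  rw [h1, Pi.smul_apply, h2, smul_eq_mul]

theorem hasWeakDeriv_integral {g : ℝ → ℝ} (hg : IntervalIntegrable g volume (-1) 1) :
    HasWeakDeriv (fun x => ∫ t in (-1 : ℝ)..x, g t) g := by
  intro φ h1 h2 h3
  have hGac := hg.absolutelyContinuousOnInterval_intervalIntegral (c := -1) (by simp)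
  have hφac : AbsolutelyContinuousOnInterval φ (-1) 1 :=
    ContDiffOn.absolutelyContinuousOnInterval
      ((h1.of_le (by exact_mod_cast le_top)).contDiffOn)
  have ibp := hGac.integral_mul_deriv_eq_deriv_mul hφac
  have z1 : φ 1 = 0 := image_eq_zero_of_notMem_tsupport fun h => by
    have := (h3 h).2
    norm_num at this
  have z2 : φ (-1) = 0 := image_eq_zero_of_notMem_tsupport fun h => by
    have := (h3 h).1
    norm_num at this
  rw [z1, z2, mul_zero, mul_zero, sub_zero, zero_sub, intervalIntegral.integral_of_le (by norm_num),
    intervalIntegral.integral_of_le (by norm_num), integral_Ioc_eq_integral_Ioo,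
    integral_Ioc_eq_integral_Ioo] at ibp
  rw [ibp, neg_inj]
  refine setIntegral_congr_ae (s := Lam) measurableSet_Ioo ?_
  filter_upwards [hg.ae_hasDerivAt_integral] with x hx hxm
  have hx' : x ∈ uIcc (-1 : ℝ) 1 := by
    rw [uIcc_of_le (by norm_num)]
    exact Ioo_subset_Icc_self hxm
  rw [(hx hx' (-1) (by simp)).deriv]

/-- The continuous representative of `w ∈ H¹(Λ)` is a primitive of the weak derivative. -/
theorem trace_eq_add_integral (w : H1) {x : ℝ} (hx : x ∈ Icc (-1 : ℝ) 1) :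
    trace w x = trace w (-1) + ∫ t in (-1 : ℝ)..x, w.1.snd t := by
  have hg := intervalIntegrable_L2 w.1.snd
  have hGc : ContinuousOn (fun x => ∫ t in (-1 : ℝ)..x, w.1.snd t) (Icc (-1) 1) := by
    have := (hg.absolutelyContinuousOnInterval_intervalIntegral (c := -1) (by simp)).continuousOn
    rwa [uIcc_of_le (by norm_num)] at this
  have hGi : Integrable (fun x => ∫ t in (-1 : ℝ)..x, w.1.snd t) muLam :=
    (hGc.integrableOn_Icc).mono_set Ioo_subset_Icc_self
  have hWi : Integrable (fun x => w.1.fst x) muLam := integrable_of_L2 _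
  obtain ⟨c, hc⟩ := ae_const_of_integral_mul_deriv_eq_zero (hWi.sub hGi) (by
    intro φ h1 h2 h3
    have hd : Continuous (deriv φ) := h1.continuous_deriv (by simp)
    simp only [Pi.sub_apply, sub_mul]
    rw [integral_sub (integrable_mul_of_continuous hWi hd h2.deriv)
      (integrable_mul_of_continuous hGi hd h2.deriv), w.2 φ h1 h2 h3,
      hasWeakDeriv_integral hg φ h1 h2 h3, sub_self])
  have h : ∀ x ∈ Icc (-1 : ℝ) 1, trace w x = (∫ t in (-1 : ℝ)..x, w.1.snd t) + c := by
    intro x hx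
    refine trace_eq_of_ae_eq (W := fun x => (∫ t in (-1 : ℝ)..x, w.1.snd t) + c)
      (hGc.add continuousOn_const) ?_ hx
    filter_upwards [hc] with t ht
    rw [Pi.sub_apply] at ht
    linarith
  rw [h x hx, h (-1) ⟨le_rfl, by norm_num⟩, intervalIntegral.integral_same]
  ring

theorem H1.norm_sq (w : H1) : ‖w‖ ^ 2 = ‖w.1.fst‖ ^ 2 + ‖w.1.snd‖ ^ 2 :=
  WithLp.prod_norm_sq_eq_of_L2 w.1

theorem H1.norm_fst_le (w : H1) : ‖w.1.fst‖ ≤ ‖w‖ :=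
  le_of_sq_le_sq (by rw [H1.norm_sq w]; nlinarith [sq_nonneg ‖w.1.snd‖]) (norm_nonneg _)

theorem H1.norm_snd_le (w : H1) : ‖w.1.snd‖ ≤ ‖w‖ :=
  le_of_sq_le_sq (by rw [H1.norm_sq w]; nlinarith [sq_nonneg ‖w.1.fst‖]) (norm_nonneg _)

/-- The embedding of `H¹(Λ)` into the bounded continuous functions: compare with the mean of the
function over `Λ`. -/
theorem abs_trace_le (w : H1) {x : ℝ} (hx : x ∈ Icc (-1 : ℝ) 1) : |trace w x| ≤ 3 * ‖w‖ := by
  have hpt : ∀ y ∈ Lam, |trace w x| - 2 * ‖w.1.snd‖ ≤ |trace w y| := by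
    intro y hy
    have hy' := Ioo_subset_Icc_self hy
    have hm : (-1 : ℝ) ∈ Icc (-1 : ℝ) 1 := ⟨le_rfl, by norm_num⟩
    have hg := intervalIntegrable_L2 w.1.snd
    have e : trace w x - trace w y = ∫ t in y..x, w.1.snd t := by
      rw [trace_eq_add_integral w hx, trace_eq_add_integral w hy',
        ← intervalIntegral.integral_interval_sub_left (a := -1) (b := x) (c := y)
          (hg.mono_set (uIcc_subset_uIcc (by simp) (by rwa [uIcc_of_le (by norm_num)])))
          (hg.mono_set (uIcc_subset_uIcc (by simp) (by rwa [uIcc_of_le (by norm_num)])))]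
      ring
    have h1 := abs_integral_le_L2_norm w.1.snd hy' hx
    rw [← e] at h1
    have := abs_sub_abs_le_abs_sub (trace w x) (trace w y)
    linarith
  have hi : Integrable (fun y => |trace w y|) muLam :=
    ((trace_continuousOn w).abs.integrableOn_Icc).mono_set Ioo_subset_Icc_self
  have h2 := setIntegral_mono_on (integrable_const (μ := muLam) (|trace w x| - 2 * ‖w.1.snd‖)) hi
    measurableSet_Ioo hpt
  have h3 : ∫ y in Lam, |trace w y| = ∫ y in Lam, |w.1.fst y| :=
    integral_congr_ae (by filter_upwards [trace_ae_eq w] with y hy; rw [hy])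
  have h4 := integral_abs_le_L2_norm w.1.fst
  rw [h3] at h2
  have h5 : ∫ y in Lam, (|trace w x| - 2 * ‖w.1.snd‖) = 2 * (|trace w x| - 2 * ‖w.1.snd‖) := by
    simp
    norm_num
  rw [h5] at h2
  linarith [H1.norm_fst_le w, H1.norm_snd_le w]

/-- Poincaré's inequality for functions that vanish at the left end point. -/
theorem H1.norm_le_of_trace_eq_zero {w : H1} (h : trace w (-1) = 0) : ‖w‖ ≤ 3 * ‖w.1.snd‖ := by
  have h1 : ‖w.1.fst‖ ^ 2 ≤ 8 * ‖w.1.snd‖ ^ 2 := by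
    rw [L2_norm_sq w.1.fst]
    have h2 : ∫ x in Lam, w.1.fst x ^ 2 ≤ ∫ x in Lam, (2 * ‖w.1.snd‖) ^ 2 := by
      refine integral_mono_ae (Lp.memLp w.1.fst).integrable_sq (integrable_const _) ?_
      filter_upwards [trace_ae_eq w, ae_restrict_mem measurableSet_Ioo] with x hx hxm
      have hx' := Ioo_subset_Icc_self hxm
      rw [hx, trace_eq_add_integral w hx', h, zero_add, ← sq_abs]
      have := abs_integral_le_L2_norm w.1.snd (x := -1) ⟨le_rfl, by norm_num⟩ hx'
      gcongr
    have h3 : ∫ x in Lam, (2 * ‖w.1.snd‖) ^ 2 = 8 * ‖w.1.snd‖ ^ 2 := by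
      simp
      ring
    linarith
  refine le_of_sq_le_sq ?_ (by positivity)
  rw [H1.norm_sq w]
  linarith [mul_pow 3 ‖w.1.snd‖ 2]

theorem isClosed_H1 : IsClosed (H1 : Set (WithLp 2 (Lp ℝ 2 muLam × Lp ℝ 2 muLam))) := by
  have hL2 : ∀ φ : ℝ → ℝ, Continuous φ → HasCompactSupport φ →
      ∃ l : Lp ℝ 2 muLam → ℝ, Continuous l ∧ ∀ g, l g = ∫ x in Lam, g x * φ x := by
    intro φ h1 h2
    have hφ : MemLp φ 2 muLam := (h1.memLp_of_hasCompactSupport (μ := volume) h2).restrict _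
    refine ⟨fun g => inner ℝ g (hφ.toLp φ), by fun_prop, fun g => ?_⟩
    refine (L2.inner_def _ _).trans (integral_congr_ae ?_)
    filter_upwards [hφ.coeFn_toLp] with x hx
    simp [hx, mul_comm]
  have : (H1 : Set (WithLp 2 (Lp ℝ 2 muLam × Lp ℝ 2 muLam)))
      = ⋂ φ ∈ {φ : ℝ → ℝ | ContDiff ℝ ∞ φ ∧ HasCompactSupport φ ∧ tsupport φ ⊆ Lam},
        {z | ∫ x in Lam, z.fst x * deriv φ x = -∫ x in Lam, z.snd x * φ x} := by
    ext z
    simp only [mem_iInter, mem_ofPred_eq, and_imp]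
    exact Iff.rfl
  rw [this]
  refine isClosed_biInter fun φ hφ => ?_
  obtain ⟨l1, c1, e1⟩ := hL2 (deriv φ) (hφ.1.continuous_deriv (by simp)) hφ.2.1.deriv
  obtain ⟨l2, c2, e2⟩ := hL2 φ hφ.1.continuous hφ.2.1
  simp only [← e1, ← e2]
  exact isClosed_eq (c1.comp (WithLp.prod_continuous_ofLp 2 _ _).fst)
    (c2.comp (WithLp.prod_continuous_ofLp 2 _ _).snd).neg

instance : CompleteSpace H1 := isClosed_H1.completeSpace_coe

theorem memLp_eval (r : ℝ[X]) : MemLp (fun x => r.eval x) 2 muLam := by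
  obtain ⟨M, _, hM⟩ := exists_abs_eval_le r
  exact MemLp.of_bound r.continuous.aestronglyMeasurable M
    ((ae_restrict_iff' measurableSet_Ioo).2 (Filter.Eventually.of_forall hM))

theorem hasWeakDeriv_eval (r : ℝ[X]) :
    HasWeakDeriv (fun x => r.eval x) (fun x => (derivative r).eval x) := by
  intro φ h1 h2 h3
  have hd : Continuous (deriv φ) := h1.continuous_deriv (by simp)
  have ibp := intervalIntegral.integral_mul_deriv_eq_deriv_mul (a := -1) (b := 1)
    (fun x _ => r.hasDerivAt x)
    (fun x _ => ((h1.differentiable (by simp)) x).hasDerivAt)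
    ((derivative r).continuous.intervalIntegrable _ _) (hd.intervalIntegrable _ _)
  have z1 : φ 1 = 0 := image_eq_zero_of_notMem_tsupport fun h => by
    have := (h3 h).2
    norm_num at this
  have z2 : φ (-1) = 0 := image_eq_zero_of_notMem_tsupport fun h => by
    have := (h3 h).1
    norm_num at this
  rw [z1, z2, intervalIntegral.integral_of_le (by norm_num),
    intervalIntegral.integral_of_le (by norm_num), integral_Ioc_eq_integral_Ioo,
    integral_Ioc_eq_integral_Ioo] at ibp
  rw [ibp]
  ring

/-- The restriction of a polynomial to `Λ`, as an element of `H¹(Λ)`. -/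
def polyH1 : ℝ[X] →ₗ[ℝ] H1 where
  toFun r := ⟨WithLp.toLp 2 ((memLp_eval r).toLp _, (memLp_eval (derivative r)).toLp _),
    (hasWeakDeriv_eval r).congr (memLp_eval r).coeFn_toLp.symm
      (memLp_eval (derivative r)).coeFn_toLp.symm⟩
  map_add' p q := by
    refine H1.ext_fst (Lp.ext ?_)
    refine (memLp_eval (p + q)).coeFn_toLp.trans ?_
    refine Filter.EventuallyEq.trans ?_ (Lp.coeFn_add _ _).symm
    filter_upwards [(memLp_eval p).coeFn_toLp, (memLp_eval q).coeFn_toLp] with x h1 h2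
    rw [Pi.add_apply, eval_add]
    exact (congrArg₂ (· + ·) h1 h2).symm
  map_smul' t p := by
    refine H1.ext_fst (Lp.ext ?_)
    refine (memLp_eval (t • p)).coeFn_toLp.trans ?_
    refine Filter.EventuallyEq.trans ?_ (Lp.coeFn_smul _ _).symm
    filter_upwards [(memLp_eval p).coeFn_toLp] with x h1
    rw [Pi.smul_apply, eval_smul]
    exact (congrArg (t • ·) h1).symm

theorem polyH1_fst (r : ℝ[X]) : (polyH1 r).1.fst =ᵐ[muLam] fun x => r.eval x :=
  (memLp_eval r).coeFn_toLp

theorem polyH1_snd (r : ℝ[X]) : (polyH1 r).1.snd =ᵐ[muLam] fun x => (derivative r).eval x :=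
  (memLp_eval (derivative r)).coeFn_toLp

theorem trace_polyH1 (r : ℝ[X]) {x : ℝ} (hx : x ∈ Icc (-1 : ℝ) 1) :
    trace (polyH1 r) x = r.eval x :=
  trace_eq_of_ae_eq r.continuous.continuousOn (polyH1_fst r) hx

theorem exists_polynomial_L2_near (g : Lp ℝ 2 muLam) {ε : ℝ} (hε : 0 < ε) :
    ∃ r : ℝ[X], ‖g - (memLp_eval r).toLp _‖ < ε := by
  obtain ⟨f, _, hf, hfc, hfL⟩ := (Lp.memLp g).exists_hasCompactSupport_eLpNorm_sub_le
    (by norm_num) (ε := ENNReal.ofReal (ε / 4)) (by simpa using hε)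
  obtain ⟨r, hr⟩ := exists_polynomial_near_of_continuousOn (-1) 1 f hfc.continuousOn (ε / 8)
    (by positivity)
  refine ⟨r, ?_⟩
  have e1 : ‖g - hfL.toLp f‖ ≤ ε / 4 := by
    rw [Lp.norm_def, ← ENNReal.toReal_ofReal (by positivity : 0 ≤ ε / 4)]
    refine ENNReal.toReal_mono (by simp) ?_
    refine le_trans (le_of_eq (eLpNorm_congr_ae ?_)) hf
    filter_upwards [Lp.coeFn_sub g (hfL.toLp f), hfL.coeFn_toLp] with x h1 h2
    rw [h1, Pi.sub_apply, h2, Pi.sub_apply]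
  have e2 : ‖hfL.toLp f - (memLp_eval r).toLp _‖ ≤ ε / 4 := by
    refine le_of_sq_le_sq ?_ (by positivity)
    rw [L2_norm_sq]
    have : ∫ x in Lam, (hfL.toLp f - (memLp_eval r).toLp _ : Lp ℝ 2 muLam) x ^ 2
        ≤ ∫ x in Lam, (ε / 8) ^ 2 := by
      refine integral_mono_ae (Lp.memLp _).integrable_sq (integrable_const _) ?_
      filter_upwards [Lp.coeFn_sub (hfL.toLp f) ((memLp_eval r).toLp _), hfL.coeFn_toLp,
        (memLp_eval r).coeFn_toLp, ae_restrict_mem measurableSet_Ioo] with x h1 h2 h3 hx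
      rw [h1, Pi.sub_apply, h2, h3, ← sq_abs, abs_sub_comm]
      have := (hr x (Ioo_subset_Icc_self hx)).le
      gcongr
    refine this.trans ?_
    simp
    nlinarith [sq_nonneg ε]
  calc ‖g - (memLp_eval r).toLp _‖
      ≤ ‖g - hfL.toLp f‖ + ‖hfL.toLp f - (memLp_eval r).toLp _‖ :=
        norm_sub_le_norm_sub_add_norm_sub _ _ _
    _ < ε := by linarith

/-- Polynomials are dense in `H¹(Λ)`: approximate the derivative in `L²(Λ)` and integrate from `-1`,
with the right value there. -/
theorem denseRange_polyH1 : DenseRange polyH1 := by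
  intro w
  rw [Metric.mem_closure_iff]
  intro ε hε
  obtain ⟨g, hg⟩ := exists_polynomial_L2_near w.1.snd (ε := ε / 3) (by positivity)
  obtain ⟨R, hR⟩ := exists_derivative_eq g
  set r := R + C (trace w (-1) - R.eval (-1)) with hr
  have hdr : derivative r = g := by rw [hr, derivative_add, derivative_C, add_zero, hR]
  refine ⟨polyH1 r, ⟨r, rfl⟩, ?_⟩
  have hm : (-1 : ℝ) ∈ Icc (-1 : ℝ) 1 := ⟨le_rfl, by norm_num⟩
  have h0 : trace (w - polyH1 r) (-1) = 0 := by
    rw [sub_eq_add_neg, ← neg_one_smul ℝ, trace_add _ _ hm, trace_smul _ _ hm,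
      trace_polyH1 r hm, hr]
    simp
  have h1 := H1.norm_le_of_trace_eq_zero h0
  have h2 : (w - polyH1 r).1.snd = w.1.snd - (memLp_eval g).toLp _ := by
    change w.1.snd - (memLp_eval (derivative r)).toLp _ = _
    congr 2
    rw [hdr]
  rw [h2] at h1
  rw [dist_eq_norm]
  linarith

/-! ### Positivity -/

/-- The one-sided power `z ↦ z₊^(β - 1)`. -/
def posPow (β z : ℝ) : ℝ := if 0 < z then z ^ (β - 1) else 0

theorem measurable_posPow (β : ℝ) : Measurable (posPow β) :=
  Measurable.ite measurableSet_Ioi (by fun_prop) measurable_const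

theorem posPow_nonneg (β z : ℝ) : 0 ≤ posPow β z := by
  unfold posPow
  split_ifs <;> positivity

theorem integrableOn_rpow_mul_one_add_rpow {β : ℝ} (hβ : 0 < β) (hβ1 : β < 1 / 2) :
    IntegrableOn (fun t : ℝ => t ^ (β - 1) * (1 + t) ^ (β - 1)) (Ioi 0) := by
  rw [← Ioc_union_Ioi_eq_Ioi (zero_le_one' ℝ)]
  have hm : Measurable fun t : ℝ => t ^ (β - 1) * (1 + t) ^ (β - 1) := by fun_prop
  refine IntegrableOn.union ?_ ?_
  · have h : IntegrableOn (fun t : ℝ => t ^ (β - 1)) (Ioc 0 1) := by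
      rw [← intervalIntegrable_iff_integrableOn_Ioc_of_le zero_le_one]
      exact intervalIntegral.intervalIntegrable_rpow' (by linarith)
    refine Integrable.mono' h hm.aestronglyMeasurable ?_
    refine (ae_restrict_iff' measurableSet_Ioc).2 (Filter.Eventually.of_forall fun t ht => ?_)
    have h1 : (1 + t) ^ (β - 1) ≤ 1 :=
      Real.rpow_le_one_of_one_le_of_nonpos (by linarith [ht.1]) (by linarith)
    have h2 : 0 ≤ t ^ (β - 1) := Real.rpow_nonneg ht.1.le _
    have h3 : 0 ≤ (1 + t) ^ (β - 1) := Real.rpow_nonneg (by linarith [ht.1]) _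
    rw [Real.norm_of_nonneg (mul_nonneg h2 h3)]
    exact mul_le_of_le_one_right h2 h1
  · have h : IntegrableOn (fun t : ℝ => t ^ (2 * β - 2)) (Ioi 1) :=
      integrableOn_Ioi_rpow_of_lt (by linarith) one_pos
    refine Integrable.mono' h hm.aestronglyMeasurable ?_
    refine (ae_restrict_iff' measurableSet_Ioi).2 (Filter.Eventually.of_forall fun t ht => ?_)
    have ht0 : 0 < t := one_pos.trans ht
    have h1 : (1 + t) ^ (β - 1) ≤ t ^ (β - 1) :=
      Real.rpow_le_rpow_of_nonpos ht0 (by linarith) (by linarith)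
    have h2 : 0 ≤ t ^ (β - 1) := Real.rpow_nonneg ht0.le _
    have h3 : 0 ≤ (1 + t) ^ (β - 1) := Real.rpow_nonneg (by linarith) _
    rw [Real.norm_of_nonneg (mul_nonneg h2 h3), show 2 * β - 2 = (β - 1) + (β - 1) by ring,
      Real.rpow_add ht0]
    exact mul_le_mul_of_nonneg_left h1 h2

/-- The constant in the composition formula `integral_posPow_mul_posPow`. -/
def rieszConst (β : ℝ) : ℝ := ∫ t in Ioi (0 : ℝ), t ^ (β - 1) * (1 + t) ^ (β - 1)

theorem rieszConst_pos {β : ℝ} (hβ : 0 < β) (hβ1 : β < 1 / 2) : 0 < rieszConst β := by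
  unfold rieszConst
  rw [setIntegral_pos_iff_support_of_nonneg_ae]
  · have : Ioi (0 : ℝ) ⊆
        Function.support (fun t : ℝ => t ^ (β - 1) * (1 + t) ^ (β - 1)) ∩ Ioi 0 := by
      intro t ht
      have ht0 : 0 < t := ht
      have : 0 < t ^ (β - 1) * (1 + t) ^ (β - 1) := by positivity
      exact ⟨this.ne', ht⟩
    exact lt_of_lt_of_le (by simp) (measure_mono this)
  · refine (ae_restrict_iff' measurableSet_Ioi).2 (Filter.Eventually.of_forall fun t ht => ?_)
    have ht0 : 0 < t := ht
    simp only [Pi.zero_apply]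
    positivity
  · exact integrableOn_rpow_mul_one_add_rpow hβ hβ1

theorem integral_posPow_mul_posPow_of_lt {β x y : ℝ}
    (hxy : x < y) :
    ∫ s, posPow β (x - s) * posPow β (y - s) = rieszConst β * |x - y| ^ (2 * β - 1) := by
  have hd : 0 < y - x := by linarith
  have e1 : ∫ s, posPow β (x - s) * posPow β (y - s)
      = ∫ t, posPow β t * posPow β ((y - x) + t) := by
    rw [← integral_sub_left_eq_self (fun t => posPow β t * posPow β ((y - x) + t)) volume x]
    congr 1
    funext s
    congr 2
    ring
  have e2 : ∫ t, posPow β t * posPow β ((y - x) + t)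
      = ∫ t in Ioi (0 : ℝ), t ^ (β - 1) * ((y - x) + t) ^ (β - 1) := by
    rw [← integral_indicator measurableSet_Ioi]
    congr 1
    funext t
    by_cases ht : 0 < t
    · rw [indicator_of_mem (mem_Ioi.2 ht), posPow, posPow, if_pos ht, if_pos (by linarith)]
    · rw [indicator_of_notMem (by simpa using ht), posPow, if_neg ht, zero_mul]
  have e3 := integral_comp_mul_left_Ioi
    (fun t : ℝ => t ^ (β - 1) * ((y - x) + t) ^ (β - 1)) 0 hd
  rw [mul_zero] at e3
  have e4 : ∫ t in Ioi (0 : ℝ), ((y - x) * t) ^ (β - 1) * ((y - x) + (y - x) * t) ^ (β - 1)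
      = (y - x) ^ (2 * β - 2) * rieszConst β := by
    rw [rieszConst, ← integral_const_mul]
    refine setIntegral_congr_fun measurableSet_Ioi fun t ht => ?_
    have ht0 : 0 < t := ht
    rw [show (y - x) + (y - x) * t = (y - x) * (1 + t) by ring, Real.mul_rpow hd.le ht0.le,
      Real.mul_rpow hd.le (by positivity), show 2 * β - 2 = (β - 1) + (β - 1) by ring,
      Real.rpow_add hd]
    ring
  rw [e1, e2, abs_sub_comm, abs_of_pos hd]
  rw [e4, smul_eq_mul] at e3
  have e5 : (y - x) ^ (2 * β - 1) = (y - x) * (y - x) ^ (2 * β - 2) := by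
    rw [show 2 * β - 1 = 1 + (2 * β - 2) by ring, Real.rpow_add hd, Real.rpow_one]
  rw [e5, mul_left_comm, mul_comm (rieszConst β), e3, ← mul_assoc, mul_inv_cancel₀ hd.ne', one_mul]

/-- The kernel `|x - y|^(2 β - 1)` as a superposition of products of one-sided powers. This is what
makes it positive semidefinite. -/
theorem integral_posPow_mul_posPow {β x y : ℝ} (hxy : x ≠ y) :
    ∫ s, posPow β (x - s) * posPow β (y - s) = rieszConst β * |x - y| ^ (2 * β - 1) := by
  rcases lt_or_gt_of_ne hxy with h | h
  · exact integral_posPow_mul_posPow_of_lt h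
  · rw [abs_sub_comm, ← integral_posPow_mul_posPow_of_lt h]
    congr 1
    funext s
    ring

theorem integrable_posPow_mul_posPow {β x y : ℝ} (hβ : 0 < β) (hβ1 : β < 1 / 2) (hxy : x ≠ y) :
    Integrable fun s => posPow β (x - s) * posPow β (y - s) := by
  refine not_imp_comm.1 integral_undef ?_
  rw [integral_posPow_mul_posPow hxy]
  have h1 := rieszConst_pos hβ hβ1
  have h2 : 0 < |x - y| := abs_pos.2 (sub_ne_zero.2 hxy)
  positivity

theorem ae_prod_ne : ∀ᵐ z ∂(muLam.prod muLam), z.1 ≠ z.2 := by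
  have hd : MeasurableSet {z : ℝ × ℝ | z.1 = z.2} :=
    measurableSet_eq_fun measurable_fst measurable_snd
  have : (muLam.prod muLam) {z : ℝ × ℝ | z.1 = z.2} = 0 := by
    rw [Measure.measure_prod_null hd]
    refine Filter.Eventually.of_forall fun x => ?_
    have : Prod.mk x ⁻¹' {z : ℝ × ℝ | z.1 = z.2} = {x} := by
      ext y
      simp [eq_comm]
    simp [this]
  exact measure_eq_zero_iff_ae_notMem.1 this

/-- The kernel `|x - y|^(σ - 1)` is positive semidefinite: by `integral_posPow_mul_posPow` with
`β = σ / 2`, its quadratic form is an integral of squares. -/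
theorem integral_riesz_nonneg {σ : ℝ} (hσ : 0 < σ) (hσ1 : σ < 1) {u : ℝ → ℝ}
    (hu : AEStronglyMeasurable u muLam)
    (hint : Integrable (fun z : ℝ × ℝ => u z.1 * (|z.1 - z.2| ^ (σ - 1) * u z.2))
      (muLam.prod muLam)) :
    0 ≤ ∫ z, u z.1 * (|z.1 - z.2| ^ (σ - 1) * u z.2) ∂(muLam.prod muLam) := by
  set β := σ / 2 with hβdef
  have hβ : 0 < β := by positivity
  have hβ1 : β < 1 / 2 := by linarith
  have hσβ : σ - 1 = 2 * β - 1 := by linarith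
  have hC := rieszConst_pos hβ hβ1
  let F : ℝ × ℝ → ℝ → ℝ := fun z s =>
    (posPow β (z.1 - s) * u z.1) * (posPow β (z.2 - s) * u z.2)
  have hFm : AEStronglyMeasurable (Function.uncurry F) ((muLam.prod muLam).prod volume) := by
    have hm1 : Measurable fun w : (ℝ × ℝ) × ℝ => posPow β (w.1.1 - w.2) :=
      (measurable_posPow β).comp (by fun_prop)
    have hm2 : Measurable fun w : (ℝ × ℝ) × ℝ => posPow β (w.1.2 - w.2) :=
      (measurable_posPow β).comp (by fun_prop)
    exact (hm1.aestronglyMeasurable.mul hu.comp_fst.comp_fst).mul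
      (hm2.aestronglyMeasurable.mul hu.comp_snd.comp_fst)
  have hFi : Integrable (Function.uncurry F) ((muLam.prod muLam).prod volume) := by
    rw [integrable_prod_iff hFm]
    refine ⟨?_, ?_⟩
    · filter_upwards [ae_prod_ne] with z hz
      refine ((integrable_posPow_mul_posPow hβ hβ1 hz).const_mul (u z.1 * u z.2)).congr
        (Filter.Eventually.of_forall fun s => ?_)
      simp only [Function.uncurry, F]
      ring
    · refine (hint.norm.const_mul (rieszConst β)).congr ?_
      filter_upwards [ae_prod_ne] with z hz
      have : ∀ s, ‖Function.uncurry F (z, s)‖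
          = (|u z.1| * |u z.2|) * (posPow β (z.1 - s) * posPow β (z.2 - s)) := by
        intro s
        simp only [Function.uncurry, F, norm_mul, Real.norm_eq_abs]
        rw [abs_of_nonneg (posPow_nonneg β (z.1 - s)), abs_of_nonneg (posPow_nonneg β (z.2 - s))]
        ring
      simp only [this]
      rw [integral_const_mul, integral_posPow_mul_posPow hz, norm_mul, norm_mul,
        Real.norm_of_nonneg (Real.rpow_nonneg (abs_nonneg (z.1 - z.2)) (σ - 1)),
        Real.norm_eq_abs, Real.norm_eq_abs, hσβ]
      ring
  have hswap := integral_integral_swap hFi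
  have hL : ∫ z, ∫ s, F z s ∂volume ∂(muLam.prod muLam)
      = rieszConst β * ∫ z, u z.1 * (|z.1 - z.2| ^ (σ - 1) * u z.2) ∂(muLam.prod muLam) := by
    rw [← integral_const_mul]
    refine integral_congr_ae ?_
    filter_upwards [ae_prod_ne] with z hz
    have : ∀ s, F z s = (u z.1 * u z.2) * (posPow β (z.1 - s) * posPow β (z.2 - s)) := by
      intro s
      simp only [F]
      ring
    simp only [this]
    rw [integral_const_mul, integral_posPow_mul_posPow hz, hσβ]
    ring
  have hR : 0 ≤ ∫ s, ∫ z, F z s ∂(muLam.prod muLam) ∂volume := by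
    refine integral_nonneg fun s => ?_
    have := integral_prod_mul (μ := muLam) (ν := muLam) (fun x => posPow β (x - s) * u x)
      (fun y => posPow β (y - s) * u y)
    simp only [F]
    rw [this]
    exact mul_self_nonneg _
  rw [← hswap, hL] at hR
  exact nonneg_of_mul_nonneg_right hR hC

theorem kern_add_kern (a b σ z : ℝ) : kern a b σ z + kern b a σ z = (a + b) * |z| ^ (σ - 1) := by
  unfold kern
  split_ifs <;> ring

/-- Positivity of the fractional integral on weighted polynomials: the antisymmetric part of the
kernel does not contribute to the quadratic form, and the symmetric part is a positive multiple of
`|x - y|^(σ - 1)`. -/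
theorem AbelData.jacobiIntegral_mul_nonneg (h : AbelData σ μ ν a b) {q r : ℝ[X]}
    (hq : IsImage μ ν a b σ q r) : 0 ≤ jacobiIntegral h.left_gt h.right_gt (q * r) := by
  set u : ℝ → ℝ := fun y => jacobiWeight μ ν y * q.eval y with hu
  have hui : Integrable u muLam := h.integrable_weight q
  have i1 : Integrable (fun z : ℝ × ℝ => u z.1 * (kern a b σ (z.1 - z.2) * u z.2))
      (muLam.prod muLam) := h.integrable_mul_kern hui q
  have i2 : Integrable (fun z : ℝ × ℝ => u z.1 * (kern b a σ (z.1 - z.2) * u z.2))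
      (muLam.prod muLam) := by
    refine i1.swap.congr (Filter.Eventually.of_forall fun z => ?_)
    simp only [Function.comp, Prod.swap]
    rw [← neg_sub, kern_neg h.lt_one]
    ring
  have e1 : jacobiIntegral h.left_gt h.right_gt (q * r) = ∫ x in Lam, u x * fracOp a b σ u x := by
    rw [jacobiIntegral_apply]
    refine integral_congr_ae ?_
    filter_upwards [hq] with x hx
    rw [hx, eval_mul, ← mul_assoc]
  have e2 : ∀ {a b : ℝ}, Integrable (fun z : ℝ × ℝ => u z.1 * (kern a b σ (z.1 - z.2) * u z.2))
      (muLam.prod muLam) → ∫ x in Lam, u x * fracOp a b σ u x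
        = ∫ z, u z.1 * (kern a b σ (z.1 - z.2) * u z.2) ∂(muLam.prod muLam) := by
    intro a b hi
    rw [integral_prod _ hi]
    simp only [fracOp, ← integral_const_mul]
  have e3 := integral_mul_fracOp h.lt_one a b i1
  have hsum : ∀ z : ℝ × ℝ, u z.1 * (kern a b σ (z.1 - z.2) * u z.2)
      + u z.1 * (kern b a σ (z.1 - z.2) * u z.2)
      = (a + b) * (u z.1 * (|z.1 - z.2| ^ (σ - 1) * u z.2)) := by
    intro z
    linear_combination (u z.1 * u z.2) * kern_add_kern a b σ (z.1 - z.2)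
  have hab := h.add_pos
  have i3 : Integrable (fun z : ℝ × ℝ => u z.1 * (|z.1 - z.2| ^ (σ - 1) * u z.2))
      (muLam.prod muLam) := by
    refine ((i1.add i2).const_mul (a + b)⁻¹).congr (Filter.Eventually.of_forall fun z => ?_)
    simp only [Pi.add_apply]
    rw [hsum, ← mul_assoc, inv_mul_cancel₀ hab.ne', one_mul]
  have e4 : (∫ x in Lam, u x * fracOp a b σ u x) + ∫ x in Lam, u x * fracOp a b σ u x
      = (a + b) * ∫ z, u z.1 * (|z.1 - z.2| ^ (σ - 1) * u z.2) ∂(muLam.prod muLam) := by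
    nth_rewrite 2 [e3]
    rw [e2 i1, e2 i2, ← integral_add i1 i2, ← integral_const_mul]
    exact integral_congr_ae (Filter.Eventually.of_forall hsum)
  have := mul_nonneg hab.le
    (integral_riesz_nonneg h.pos h.lt_one hui.aestronglyMeasurable i3)
  rw [e1]
  linarith

/-! ### Inversion of the fractional integral -/

/-- The fractional integral is injective on `L¹(Λ)`: if it vanishes at `v`, then by transposition
`v` is orthogonal to the images of all weighted polynomials under the transposed operator, that is,
to all polynomials. -/
theorem AbelData.ae_eq_zero_of_fracOp (h : AbelData σ μ ν a b) {v : ℝ → ℝ}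
    (hv : Integrable v muLam) (hv0 : fracOp a b σ v =ᵐ[muLam] 0) : v =ᵐ[muLam] 0 := by
  have hpoly : ∀ r : ℝ[X], ∫ x in Lam, v x * r.eval x = 0 := by
    intro r
    obtain ⟨q, hq⟩ := h.swap.exists_preimage r
    rw [h.swap.integral_mul_image hv hq]
    refine integral_eq_zero_of_ae ?_
    filter_upwards [hv0] with x hx
    rw [hx, Pi.zero_apply, mul_zero]
  have main : ∀ᵐ x ∂(volume : Measure ℝ), x ∈ Lam → v x = 0 := by
    refine isOpen_Ioo.ae_eq_zero_of_integral_contDiff_smul_eq_zero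
      (IntegrableOn.locallyIntegrableOn hv) fun φ h1 h2 h3 => ?_
    rw [← setIntegral_eq_integral_of_forall_compl_eq_zero (s := Lam)]
    · have hφi := integrable_mul_of_continuous hv h1.continuous h2
      have hle : ∀ ε : ℝ, 0 < ε → |∫ x in Lam, v x * φ x| ≤ ε * ∫ x in Lam, |v x| := by
        intro ε hε
        obtain ⟨r, hr⟩ := exists_polynomial_near_of_continuousOn (-1) 1 φ
          h1.continuous.continuousOn ε hε
        have e : ∫ x in Lam, v x * φ x = ∫ x in Lam, (v x * φ x - v x * r.eval x) := by
          rw [integral_sub hφi (integrable_mul_eval hv r), hpoly r, sub_zero]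
        rw [e, ← integral_const_mul]
        rw [← Real.norm_eq_abs]
        refine norm_integral_le_of_norm_le (hv.abs.const_mul ε) ?_
        filter_upwards [ae_restrict_mem measurableSet_Ioo] with x hx
        have := (hr x (Ioo_subset_Icc_self hx)).le
        rw [← mul_sub, norm_mul, Real.norm_eq_abs, Real.norm_eq_abs, abs_sub_comm, mul_comm]
        exact mul_le_mul_of_nonneg_right this (abs_nonneg _)
      have hnn : 0 ≤ ∫ x in Lam, |v x| := integral_nonneg fun x => abs_nonneg _
      have h0 : |∫ x in Lam, v x * φ x| ≤ 0 := by
        refine le_of_forall_pos_le_add fun ε hε => ?_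
        have hd : 0 < (∫ x in Lam, |v x|) + 1 := by linarith
        refine (hle (ε / ((∫ x in Lam, |v x|) + 1)) (by positivity)).trans ?_
        rw [zero_add, div_mul_eq_mul_div, div_le_iff₀ hd]
        nlinarith
      rw [← abs_nonpos_iff]
      simpa only [smul_eq_mul, mul_comm] using h0
    · intro x hx
      rw [image_eq_zero_of_notMem_tsupport fun h => hx (h3 h), zero_smul]
  exact (ae_restrict_iff' (μ := volume) measurableSet_Ioo).2 main

/-- The inverse of the fractional integral is bounded from the polynomials with the norm of `H¹(Λ)`
to `L¹(Λ)`. The weighted norms in `energy_estimate` are controlled by the norm of `H¹(Λ)`, since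
the weight is integrable and `(1 - x²) (1 - x)^ν (1 + x)^μ` is bounded. -/
theorem AbelData.exists_integral_abs_le (h : AbelData σ μ ν a b) : ∃ M : ℝ, ∀ q r : ℝ[X],
    IsImage μ ν a b σ q r → ∫ x in Lam, |jacobiWeight μ ν x * q.eval x| ≤ M * ‖polyH1 r‖ := by
  obtain ⟨δ, hδ, H⟩ := h.energy_estimate
  set W := jacobiIntegral h.left_gt h.right_gt 1 with hW
  set W' := jacobiIntegral h.right_gt h.left_gt 1 with hW'
  have hW'0 : 0 ≤ W' := by simpa using jacobiIntegral_mul_self_nonneg h.right_gt h.left_gt 1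
  refine ⟨(W + (9 * W' + 4) / δ) / 2, fun q r hq => ?_⟩
  have h1 : jacobiIntegral h.right_gt h.left_gt (r * r) ≤ 9 * W' * ‖polyH1 r‖ ^ 2 := by
    rw [hW', jacobiIntegral_apply, jacobiIntegral_apply, mul_comm 9, mul_assoc,
      ← integral_mul_const]
    refine setIntegral_mono_on (h.swap.integrable_weight _)
      ((h.swap.integrable_weight 1).mul_const _) measurableSet_Ioo fun x hx => ?_
    have hx' := Ioo_subset_Icc_self hx
    have h2 := abs_trace_le (polyH1 r) hx'
    rw [trace_polyH1 r hx'] at h2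
    rw [eval_one, mul_one]
    refine mul_le_mul_of_nonneg_left ?_ (jacobiWeight_pos ν μ hx).le
    rw [eval_mul, ← sq, ← sq_abs]
    calc |r.eval x| ^ 2 ≤ (3 * ‖polyH1 r‖) ^ 2 := by gcongr
      _ = _ := by ring
  have h2 : jacobiIntegral h.right_gt h.left_gt ((1 - X ^ 2) * (derivative r * derivative r))
      ≤ 4 * ‖polyH1 r‖ ^ 2 := by
    have h3 : ∫ x in Lam, (derivative r).eval x ^ 2 ≤ ‖polyH1 r‖ ^ 2 := by
      have e : ∫ x in Lam, (derivative r).eval x ^ 2 = ‖(polyH1 r).1.snd‖ ^ 2 := by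
        rw [L2_norm_sq]
        refine integral_congr_ae ?_
        filter_upwards [polyH1_snd r] with x hx
        rw [hx]
      rw [e]
      have := H1.norm_snd_le (polyH1 r)
      gcongr
    refine le_trans ?_ (mul_le_mul_of_nonneg_left h3 (by norm_num))
    rw [jacobiIntegral_apply, ← integral_const_mul]
    refine setIntegral_mono_on (h.swap.integrable_weight _)
      ((memLp_eval (derivative r)).integrable_sq.const_mul 4) measurableSet_Ioo fun x hx => ?_
    have p1 : 0 < 1 - x := by linarith [hx.2]
    have p2 : 0 < 1 + x := by linarith [hx.1]
    -- `(1 - x²) (1 - x)^ν (1 + x)^μ = (1 - x)^(1 + ν) (1 + x)^(1 + μ)`, both exponents in `[0, 1]`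
    have hle : ∀ {t e : ℝ}, 0 < t → t < 2 → -1 < e → e ≤ 0 → t ^ e * t ≤ 2 := by
      intro t e ht ht2 he he0
      rw [← Real.rpow_add_one ht.ne']
      calc t ^ (e + 1) ≤ 2 ^ (e + 1) := Real.rpow_le_rpow ht.le ht2.le (by linarith)
        _ ≤ 2 ^ (1 : ℝ) := Real.rpow_le_rpow_of_exponent_le (by norm_num) (by linarith)
        _ = 2 := Real.rpow_one 2
    have b1 := hle p1 (by linarith [hx.1]) h.right_gt h.right_nonpos
    have b2 := hle p2 (by linarith [hx.2]) h.left_gt h.left_nonpos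
    have b3 : jacobiWeight ν μ x * (1 - x ^ 2) ≤ 4 := by
      have : jacobiWeight ν μ x * (1 - x ^ 2)
          = ((1 - x) ^ ν * (1 - x)) * ((1 + x) ^ μ * (1 + x)) := by
        rw [jacobiWeight]
        ring
      rw [this]
      have n1 : 0 ≤ (1 - x) ^ ν * (1 - x) := by positivity
      have n2 : 0 ≤ (1 + x) ^ μ * (1 + x) := by positivity
      nlinarith
    have := mul_le_mul_of_nonneg_right b3 (sq_nonneg ((derivative r).eval x))
    simp only [eval_mul, eval_sub, eval_one, eval_pow, eval_X]
    linarith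
  have h3 := H q r hq
  have hQ : jacobiIntegral h.left_gt h.right_gt (q * q) ≤ (9 * W' + 4) / δ * ‖polyH1 r‖ ^ 2 := by
    rw [div_mul_eq_mul_div, le_div_iff₀ hδ]
    linarith
  have hW0 : 0 ≤ W := by simpa using jacobiIntegral_mul_self_nonneg h.left_gt h.right_gt 1
  have hD0 : 0 ≤ (9 * W' + 4) / δ := by positivity
  -- `|q| ≤ (t + q² / t) / 2` for every `t > 0`, applied with `t` tending to the norm of `r`
  have key : ∀ t : ℝ, ‖polyH1 r‖ < t →
      ∫ x in Lam, |jacobiWeight μ ν x * q.eval x| ≤ (W + (9 * W' + 4) / δ) / 2 * t := by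
    intro t ht
    have ht0 : 0 < t := (norm_nonneg _).trans_lt ht
    have hpt : ∫ x in Lam, |jacobiWeight μ ν x * q.eval x| ≤
        t / 2 * W + 1 / (2 * t) * jacobiIntegral h.left_gt h.right_gt (q * q) := by
      rw [hW, jacobiIntegral_apply, jacobiIntegral_apply, ← integral_const_mul,
        ← integral_const_mul, ← integral_add ((h.integrable_weight 1).const_mul _)
          ((h.integrable_weight _).const_mul _)]
      refine setIntegral_mono_on (h.integrable_weight q).abs
        (((h.integrable_weight 1).const_mul _).add ((h.integrable_weight _).const_mul _))
        measurableSet_Ioo fun x hx => ?_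
      have hw := jacobiWeight_pos μ ν hx
      rw [abs_mul, abs_of_pos hw, eval_one, eval_mul, ← abs_mul_abs_self (q.eval x)]
      have e : t / 2 * (jacobiWeight μ ν x * 1) +
          1 / (2 * t) * (jacobiWeight μ ν x * (|q.eval x| * |q.eval x|))
          = jacobiWeight μ ν x * |q.eval x|
            + jacobiWeight μ ν x * (|q.eval x| - t) ^ 2 / (2 * t) := by
        field_simp
        ring
      rw [e]
      have : 0 ≤ jacobiWeight μ ν x * (|q.eval x| - t) ^ 2 / (2 * t) := by positivity
      linarith
    refine hpt.trans ?_
    have h4 : jacobiIntegral h.left_gt h.right_gt (q * q) ≤ (9 * W' + 4) / δ * t ^ 2 :=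
      hQ.trans (mul_le_mul_of_nonneg_left (by gcongr) hD0)
    calc t / 2 * W + 1 / (2 * t) * jacobiIntegral h.left_gt h.right_gt (q * q)
        ≤ t / 2 * W + 1 / (2 * t) * ((9 * W' + 4) / δ * t ^ 2) := by gcongr
      _ = _ := by field_simp
  refine le_of_forall_gt_imp_ge_of_dense fun y hy => ?_
  have hc : 0 ≤ (W + (9 * W' + 4) / δ) / 2 := by positivity
  rcases hc.eq_or_lt with h0 | hpos
  · have := key (‖polyH1 r‖ + 1) (by linarith)
    rw [← h0, zero_mul] at this hy
    linarith
  · have := key (y / ((W + (9 * W' + 4) / δ) / 2)) (by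
      rw [lt_div_iff₀ hpos]
      linarith)
    rwa [mul_div_cancel₀ _ hpos.ne'] at this

/-- The fractional integral as a bounded operator on `L¹(Λ)`. -/
def fracOpL1 (hσ : 0 < σ) (hσ1 : σ < 1) (a b : ℝ) : Lp ℝ 1 muLam →L[ℝ] Lp ℝ 1 muLam :=
  LinearMap.mkContinuous
    { toFun := fun u => (integrable_fracOp hσ hσ1 a b (L1.integrable_coeFn u)).toL1 _
      map_add' := fun u v => by
        refine Lp.ext ?_
        filter_upwards [Integrable.coeFn_toL1
            (integrable_fracOp hσ hσ1 a b (L1.integrable_coeFn (u + v))),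
          Lp.coeFn_add ((integrable_fracOp hσ hσ1 a b (L1.integrable_coeFn u)).toL1 _)
            ((integrable_fracOp hσ hσ1 a b (L1.integrable_coeFn v)).toL1 _),
          Integrable.coeFn_toL1 (integrable_fracOp hσ hσ1 a b (L1.integrable_coeFn u)),
          Integrable.coeFn_toL1 (integrable_fracOp hσ hσ1 a b (L1.integrable_coeFn v)),
          fracOp_add_ae hσ hσ1 a b (L1.integrable_coeFn u) (L1.integrable_coeFn v)]
          with x h1 h2 h3 h4 h5
        rw [h1, h2, Pi.add_apply, h3, h4, ← h5, fracOp_congr (Lp.coeFn_add u v)]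
        rfl
      map_smul' := fun t u => by
        refine Lp.ext ?_
        filter_upwards [Integrable.coeFn_toL1
            (integrable_fracOp hσ hσ1 a b (L1.integrable_coeFn (t • u))),
          Lp.coeFn_smul t ((integrable_fracOp hσ hσ1 a b (L1.integrable_coeFn u)).toL1 _),
          Integrable.coeFn_toL1 (integrable_fracOp hσ hσ1 a b (L1.integrable_coeFn u))]
          with x h1 h2 h3
        rw [h1, RingHom.id_apply, h2, Pi.smul_apply, h3, fracOp_congr (Lp.coeFn_smul t u)]
        exact congrFun (fracOp_const_mul a b σ t u) x }
    (∫ z in Ioo (-2 : ℝ) 2, |kern a b σ z|) (fun u => by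
      have h1 := L1.norm_of_fun_eq_integral_norm
        (integrable_fracOp hσ hσ1 a b (L1.integrable_coeFn u))
      have h2 := L1.norm_eq_integral_norm u
      rw [h2]
      exact h1.le.trans (integral_abs_fracOp_le hσ hσ1 a b (L1.integrable_coeFn u)))

theorem fracOpL1_ae (hσ : 0 < σ) (hσ1 : σ < 1) (a b : ℝ) (u : Lp ℝ 1 muLam) :
    fracOpL1 hσ hσ1 a b u =ᵐ[muLam] fracOp a b σ u :=
  Integrable.coeFn_toL1 (integrable_fracOp hσ hσ1 a b (L1.integrable_coeFn u))

/-- The embedding of `H¹(Λ)` into `L¹(Λ)`. -/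
def H1toL1 : H1 →L[ℝ] Lp ℝ 1 muLam :=
  LinearMap.mkContinuous
    { toFun := fun w => (integrable_of_L2 w.1.fst).toL1 _
      map_add' := fun w z => by
        refine Lp.ext ?_
        filter_upwards [Integrable.coeFn_toL1 (integrable_of_L2 (w + z).1.fst),
          Lp.coeFn_add ((integrable_of_L2 w.1.fst).toL1 _) ((integrable_of_L2 z.1.fst).toL1 _),
          Integrable.coeFn_toL1 (integrable_of_L2 w.1.fst),
          Integrable.coeFn_toL1 (integrable_of_L2 z.1.fst), Lp.coeFn_add w.1.fst z.1.fst]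
          with x h1 h2 h3 h4 h5
        rw [h1, h2, Pi.add_apply, h3, h4]
        exact h5
      map_smul' := fun t w => by
        refine Lp.ext ?_
        filter_upwards [Integrable.coeFn_toL1 (integrable_of_L2 (t • w).1.fst),
          Lp.coeFn_smul t ((integrable_of_L2 w.1.fst).toL1 _),
          Integrable.coeFn_toL1 (integrable_of_L2 w.1.fst), Lp.coeFn_smul t w.1.fst]
          with x h1 h2 h3 h5
        rw [h1, RingHom.id_apply, h2, Pi.smul_apply, h3]
        exact h5 }
    2 (fun w => by
      have h1 := L1.norm_of_fun_eq_integral_norm (integrable_of_L2 w.1.fst)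
      refine h1.le.trans ((integral_abs_le_L2_norm w.1.fst).trans ?_)
      linarith [H1.norm_fst_le w])

theorem H1toL1_ae (w : H1) : H1toL1 w =ᵐ[muLam] w.1.fst :=
  Integrable.coeFn_toL1 (integrable_of_L2 w.1.fst)

theorem AbelData.fracOpL1_injective (h : AbelData σ μ ν a b) :
    Function.Injective (fracOpL1 h.pos h.lt_one a b) := by
  rw [injective_iff_map_eq_zero]
  intro u hu
  refine Lp.ext ?_
  have h1 := fracOpL1_ae h.pos h.lt_one a b u
  rw [hu] at h1
  exact (h.ae_eq_zero_of_fracOp (L1.integrable_coeFn u)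
    (h1.symm.trans (Lp.coeFn_zero _ _ _))).trans (Lp.coeFn_zero _ _ _).symm

/-- The Jacobi weight times a polynomial, as an element of `L¹(Λ)`. -/
def AbelData.weightL1 (h : AbelData σ μ ν a b) : ℝ[X] →ₗ[ℝ] Lp ℝ 1 muLam where
  toFun q := (h.integrable_weight q).toL1 _
  map_add' p q := by
    rw [← Integrable.toL1_add]
    congr 1
    funext x
    simp [mul_add]
  map_smul' t q := by
    rw [RingHom.id_apply, ← Integrable.toL1_smul]
    congr 1
    funext x
    simp [mul_left_comm]

theorem AbelData.weightL1_ae (h : AbelData σ μ ν a b) (q : ℝ[X]) :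
    h.weightL1 q =ᵐ[muLam] fun x => jacobiWeight μ ν x * q.eval x :=
  Integrable.coeFn_toL1 (h.integrable_weight q)

theorem AbelData.fracOpL1_weightL1 (h : AbelData σ μ ν a b) {q r : ℝ[X]}
    (hq : IsImage μ ν a b σ q r) :
    fracOpL1 h.pos h.lt_one a b (h.weightL1 q) = H1toL1 (polyH1 r) := by
  refine Lp.ext ?_
  have h1 := fracOpL1_ae h.pos h.lt_one a b (h.weightL1 q)
  rw [fracOp_congr (h.weightL1_ae q)] at h1
  exact (h1.trans hq).trans ((H1toL1_ae _).trans (polyH1_fst r)).symm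

/-- The graph of the fractional integral on weighted polynomials: the pairs `(q, r)` of polynomials
such that `r` is the fractional integral of `q` times the weight. -/
def AbelData.imageGraph (h : AbelData σ μ ν a b) : Submodule ℝ (ℝ[X] × ℝ[X]) where
  carrier := {z | IsImage μ ν a b σ z.1 z.2}
  add_mem' hx hy := IsImage.add h hx hy
  zero_mem' := by
    change IsImage μ ν a b σ 0 0
    unfold IsImage fracOp
    simp
  smul_mem' t _ hx := IsImage.smul hx t

/-- A bounded right inverse `A : H¹(Λ) → L¹(Λ)` of the fractional integral, extended by density from
the polynomials. -/
theorem AbelData.exists_inverse (h : AbelData σ μ ν a b) : ∃ A : H1 →L[ℝ] Lp ℝ 1 muLam,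
    (∀ w, fracOpL1 h.pos h.lt_one a b (A w) = H1toL1 w) ∧
    ∀ q r : ℝ[X], IsImage μ ν a b σ q r → A (polyH1 r) = h.weightL1 q := by
  obtain ⟨M, hM⟩ := h.exists_integral_abs_le
  let f : h.imageGraph →ₗ[ℝ] Lp ℝ 1 muLam :=
    h.weightL1 ∘ₗ LinearMap.fst ℝ ℝ[X] ℝ[X] ∘ₗ h.imageGraph.subtype
  let e : h.imageGraph →ₗ[ℝ] H1 :=
    polyH1 ∘ₗ LinearMap.snd ℝ ℝ[X] ℝ[X] ∘ₗ h.imageGraph.subtype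
  have hbound : ∀ z, ‖f z‖ ≤ M * ‖e z‖ := by
    rintro ⟨⟨q, r⟩, hz⟩
    have h1 := L1.norm_of_fun_eq_integral_norm (h.integrable_weight q)
    exact h1.le.trans (hM q r hz)
  have hdense : DenseRange e := by
    refine denseRange_polyH1.mono ?_
    rintro _ ⟨r, rfl⟩
    obtain ⟨q, hq⟩ := h.exists_preimage r
    exact ⟨⟨(q, r), hq⟩, rfl⟩
  have hA : ∀ q r : ℝ[X], IsImage μ ν a b σ q r →
      f.extendOfNorm e (polyH1 r) = h.weightL1 q := fun q r hq =>
    LinearMap.extendOfNorm_eq hdense ⟨M, hbound⟩ ⟨(q, r), hq⟩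
  refine ⟨f.extendOfNorm e, fun w => ?_, hA⟩
  refine denseRange_polyH1.induction_on (p := fun w =>
    fracOpL1 h.pos h.lt_one a b (f.extendOfNorm e w) = H1toL1 w) w
    (isClosed_eq (by fun_prop) (by fun_prop)) fun r => ?_
  obtain ⟨q, hq⟩ := h.exists_preimage r
  rw [hA q r hq, h.fracOpL1_weightL1 hq]

/-! ### The coercive form -/

theorem integrable_mul_fst {u : ℝ → ℝ} (hu : Integrable u muLam) (w : H1) :
    Integrable (fun x => u x * w.1.fst x) muLam := by
  refine hu.mul_bdd (c := 3 * ‖w‖) (Lp.aestronglyMeasurable _) ?_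
  filter_upwards [trace_ae_eq w, ae_restrict_mem measurableSet_Ioo] with x hx hxm
  rw [hx]
  exact abs_trace_le w (Ioo_subset_Icc_self hxm)

/-- The bilinear form underlying `pairing`, before its continuity is recorded. -/
def pairingAux : Lp ℝ 1 muLam →ₗ[ℝ] H1 →ₗ[ℝ] ℝ :=
  LinearMap.mk₂ ℝ (fun (u : Lp ℝ 1 muLam) (w : H1) => ∫ x in Lam, u x * w.1.fst x)
      (fun u v w => by
        rw [← integral_add (integrable_mul_fst (L1.integrable_coeFn u) w)
          (integrable_mul_fst (L1.integrable_coeFn v) w)]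
        refine integral_congr_ae ?_
        filter_upwards [Lp.coeFn_add u v] with x hx
        rw [hx, Pi.add_apply, add_mul])
      (fun t u w => by
        rw [smul_eq_mul, ← integral_const_mul]
        refine integral_congr_ae ?_
        filter_upwards [Lp.coeFn_smul t u] with x hx
        rw [hx, Pi.smul_apply, smul_eq_mul, mul_assoc])
      (fun u w z => by
        rw [← integral_add (integrable_mul_fst (L1.integrable_coeFn u) w)
          (integrable_mul_fst (L1.integrable_coeFn u) z)]
        refine integral_congr_ae ?_
        filter_upwards [Lp.coeFn_add w.1.fst z.1.fst] with x hx
        rw [← mul_add]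
        exact congrArg (u x * ·) hx)
      (fun t u w => by
        rw [smul_eq_mul, ← integral_const_mul]
        refine integral_congr_ae ?_
        filter_upwards [Lp.coeFn_smul t w.1.fst] with x hx
        rw [mul_left_comm]
        exact congrArg (u x * ·) hx)

theorem norm_pairingAux_le (u : Lp ℝ 1 muLam) (w : H1) :
    ‖pairingAux u w‖ ≤ 3 * ‖u‖ * ‖w‖ := by
  rw [pairingAux, LinearMap.mk₂_apply, L1.norm_eq_integral_norm u]
  have : 3 * (∫ x, ‖u x‖ ∂muLam) * ‖w‖ = ∫ x, ‖u x‖ * (3 * ‖w‖) ∂muLam := by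
    rw [integral_mul_const]
    ring
  rw [this]
  refine norm_integral_le_of_norm_le ((L1.integrable_coeFn u).norm.mul_const _) ?_
  filter_upwards [trace_ae_eq w, ae_restrict_mem measurableSet_Ioo] with x hx hxm
  rw [norm_mul, hx]
  exact mul_le_mul_of_nonneg_left (abs_trace_le w (Ioo_subset_Icc_self hxm)) (norm_nonneg _)

/-- The pairing `(u, w) ↦ ∫ u w` of `L¹(Λ)` with `H¹(Λ)`, which is continuous since the elements of
`H¹(Λ)` are bounded. -/
def pairing : Lp ℝ 1 muLam →L[ℝ] H1 →L[ℝ] ℝ :=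
  pairingAux.mkContinuous₂ 3 norm_pairingAux_le

theorem pairing_apply (u : Lp ℝ 1 muLam) (w : H1) :
    pairing u w = ∫ x in Lam, u x * w.1.fst x := rfl

/-- The weak derivative as a bounded operator from `H¹(Λ)` to `L²(Λ)`. -/
def derivL : H1 →L[ℝ] Lp ℝ 2 muLam := (WithLp.sndL 2 ℝ _ _).comp H1.subtypeL

theorem derivL_apply (w : H1) : derivL w = w.1.snd := rfl

/-- Evaluation of the continuous representative at a point of `[-1, 1]`, as a bounded functional on
`H¹(Λ)`. -/
def traceL {x : ℝ} (hx : x ∈ Icc (-1 : ℝ) 1) : H1 →L[ℝ] ℝ :=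
  LinearMap.mkContinuous
    { toFun := fun w => trace w x
      map_add' := fun w z => trace_add w z hx
      map_smul' := fun t w => trace_smul t w hx } 3 (fun w => abs_trace_le w hx)

theorem pairing_weightL1 (h : AbelData σ μ ν a b) (q r : ℝ[X]) :
    pairing (h.weightL1 q) (polyH1 r) = jacobiIntegral h.left_gt h.right_gt (q * r) := by
  rw [pairing_apply, jacobiIntegral_apply]
  refine integral_congr_ae ?_
  filter_upwards [h.weightL1_ae q, polyH1_fst r] with x h1 h2
  rw [h1, h2, eval_mul, mul_assoc]

theorem abs_pairing_le (u : Lp ℝ 1 muLam) (w : H1) : |pairing u w| ≤ 3 * ‖u‖ * ‖w‖ :=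
  norm_pairingAux_le u w

/-- The bilinear form of the problem in the variable `w`, the fractional integral of the unknown:
`c ∫ (A w) z + ∫ w' z'`, where `A` is the inverse of the fractional integral. -/
def energyForm (A : H1 →L[ℝ] Lp ℝ 1 muLam) (c : ℝ) : H1 →ₗ[ℝ] H1 →ₗ[ℝ] ℝ :=
  LinearMap.mk₂ ℝ (fun w z => c * pairing (A w) z + inner ℝ (derivL w) (derivL z))
    (fun w w' z => by
      simp only [map_add, add_apply, inner_add_left]
      ring)
    (fun t w z => by
      simp only [map_smul, smul_apply, real_inner_smul_left, smul_eq_mul]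
      ring)
    (fun w z z' => by
      simp only [map_add, inner_add_right]
      ring)
    (fun t w z => by
      simp only [map_smul, real_inner_smul_right, smul_eq_mul]
      ring)

theorem energyForm_apply (A : H1 →L[ℝ] Lp ℝ 1 muLam) (c : ℝ) (w z : H1) :
    energyForm A c w z = c * pairing (A w) z + inner ℝ w.1.snd z.1.snd := rfl

theorem abs_energyForm_le (A : H1 →L[ℝ] Lp ℝ 1 muLam) {c : ℝ} (hc : 0 ≤ c) (w z : H1) :
    |energyForm A c w z| ≤ (c * (3 * ‖A‖) + 1) * ‖w‖ * ‖z‖ := by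
  have h1 : |pairing (A w) z| ≤ 3 * (‖A‖ * ‖w‖) * ‖z‖ := by
    refine (abs_pairing_le (A w) z).trans ?_
    gcongr
    exact A.le_opNorm w
  have h2 : |inner ℝ w.1.snd z.1.snd| ≤ ‖w‖ * ‖z‖ := by
    refine (abs_real_inner_le_norm _ _).trans ?_
    gcongr
    · exact H1.norm_snd_le w
    · exact H1.norm_snd_le z
  rw [energyForm_apply]
  refine (abs_add_le _ _).trans ?_
  rw [abs_mul, abs_of_nonneg hc]
  have := mul_le_mul_of_nonneg_left h1 hc
  linarith

/-- The Lax–Milgram theorem for a bounded coercive bilinear form that is not given as a continuous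
one. -/
theorem existsUnique_of_coercive {V : Type*} [NormedAddCommGroup V] [InnerProductSpace ℝ V]
    [CompleteSpace V] (B : V →ₗ[ℝ] V →ₗ[ℝ] ℝ) {M δ : ℝ}
    (hM : ∀ v w, |B v w| ≤ M * ‖v‖ * ‖w‖) (hδ : 0 < δ) (hB : ∀ v, δ * ‖v‖ * ‖v‖ ≤ B v v)
    (l : V →L[ℝ] ℝ) : ∃! v, ∀ w, B v w = l w := by
  have hco : IsCoercive (B.mkContinuous₂ M hM) := ⟨δ, hδ, hB⟩
  set E := hco.continuousLinearEquivOfBilin with hE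
  have key : ∀ v, (∀ w, B v w = l w) ↔ E v = (InnerProductSpace.toDual ℝ V).symm l := by
    intro v
    have h1 : ∀ w, inner ℝ (E v) w = B v w := hco.continuousLinearEquivOfBilin_apply v
    constructor
    · intro h
      refine ext_inner_right ℝ fun w => ?_
      rw [h1, h, InnerProductSpace.toDual_symm_apply]
    · intro h w
      rw [← h1, h, InnerProductSpace.toDual_symm_apply]
  refine ⟨E.symm ((InnerProductSpace.toDual ℝ V).symm l), ?_, fun v hv => ?_⟩
  · exact (key _).2 (E.apply_symm_apply _)
  · rw [← (key v).1 hv, E.symm_apply_apply]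

/-- The positivity of the fractional integral carries over to its inverse. -/
theorem AbelData.pairing_nonneg (h : AbelData σ μ ν a b) {A : H1 →L[ℝ] Lp ℝ 1 muLam}
    (hA : ∀ q r : ℝ[X], IsImage μ ν a b σ q r → A (polyH1 r) = h.weightL1 q) (w : H1) :
    0 ≤ pairing (A w) w := by
  refine denseRange_polyH1.induction_on (p := fun w => 0 ≤ pairing (A w) w) w
    (isClosed_le continuous_const (by fun_prop)) fun r => ?_
  obtain ⟨q, hq⟩ := h.exists_preimage r
  rw [hA q r hq, pairing_weightL1]
  exact h.jacobiIntegral_mul_nonneg hq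

/-- Strict positivity at the constant `1`, whose preimage is a positive multiple of the weight. -/
theorem AbelData.pairing_one_pos (h : AbelData σ μ ν a b) {A : H1 →L[ℝ] Lp ℝ 1 muLam}
    (hA : ∀ q r : ℝ[X], IsImage μ ν a b σ q r → A (polyH1 r) = h.weightL1 q) :
    0 < pairing (A (polyH1 1)) (polyH1 1) := by
  obtain ⟨l, hl, H⟩ := h.exists_fracOp_jacobiWeight
  have h1 : IsImage μ ν a b σ (l⁻¹ • 1) 1 := by
    have : IsImage μ ν a b σ 1 (l • 1) := by
      unfold IsImage
      simp only [eval_one, mul_one, eval_smul, smul_eq_mul]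
      filter_upwards [ae_restrict_mem measurableSet_Ioo] with x hx
      exact (H x hx).2
    have h2 := this.smul l⁻¹
    rwa [smul_smul, inv_mul_cancel₀ hl.ne', one_smul] at h2
  rw [hA _ _ h1, pairing_weightL1, mul_one, map_smul]
  have := jacobiIntegral_mul_self_pos h.left_gt h.right_gt (one_ne_zero (α := ℝ[X]))
  rw [mul_one] at this
  exact mul_pos (inv_pos.2 hl) this

/-- The form `c ∫ (A w) w + ∫ |w'|²` is coercive on `H¹(Λ)`. The part of `w` vanishing at `-1` is
controlled by `w'` through Poincaré's inequality. The remaining constant is controlled by the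
nonnegative form `∫ (A w) w`, which is strictly positive at the constants. -/
theorem AbelData.exists_coercive (h : AbelData σ μ ν a b) {A : H1 →L[ℝ] Lp ℝ 1 muLam}
    (hA : ∀ q r : ℝ[X], IsImage μ ν a b σ q r → A (polyH1 r) = h.weightL1 q) {c : ℝ}
    (hc : 0 < c) : ∃ δ : ℝ, 0 < δ ∧ ∀ w, δ * ‖w‖ * ‖w‖ ≤ energyForm A c w w := by
  have hm : (-1 : ℝ) ∈ Icc (-1 : ℝ) 1 := ⟨le_rfl, by norm_num⟩
  set κ := pairing (A (polyH1 1)) (polyH1 1) with hκ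
  have hκ0 : 0 < κ := h.pairing_one_pos hA
  set e := ‖polyH1 1‖ with he
  set N := 3 * ‖A‖ with hN
  have hN0 : 0 ≤ N := by positivity
  -- `‖w‖² ≤ K₁ ⟨A w, w⟩ + K₂ ‖w'‖²`
  set K₁ := 4 * e ^ 2 / κ with hK₁
  set K₂ := 36 * e ^ 2 * N / κ + 18 with hK₂
  have hK₁0 : 0 ≤ K₁ := by positivity
  have hK₂0 : 0 < K₂ := by positivity
  have main : ∀ w : H1, ‖w‖ ^ 2 ≤ K₁ * pairing (A w) w + K₂ * ‖w.1.snd‖ ^ 2 := by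
    intro w
    set m := trace w (-1) with hmdef
    set z := w - m • polyH1 1 with hz
    have hwz : w = m • polyH1 1 + z := by rw [hz, add_sub_cancel]
    have hz0 : trace z (-1) = 0 := by
      rw [hz, sub_eq_add_neg, ← neg_one_smul ℝ, trace_add _ _ hm, trace_smul _ _ hm,
        trace_smul _ _ hm, trace_polyH1 _ hm, eval_one]
      ring
    have hzs : z.1.snd = w.1.snd := by
      have h1 : derivL (polyH1 1) = 0 := by
        refine Lp.ext ((polyH1_snd 1).trans ?_)
        filter_upwards [Lp.coeFn_zero ℝ 2 muLam] with x hx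
        rw [hx]
        simp
      rw [← derivL_apply, ← derivL_apply, hz, map_sub, map_smul, h1, smul_zero, sub_zero]
    have h1 := H1.norm_le_of_trace_eq_zero hz0
    rw [hzs] at h1
    have hz2 : ‖z‖ ^ 2 ≤ 9 * ‖w.1.snd‖ ^ 2 := by
      calc ‖z‖ ^ 2 ≤ (3 * ‖w.1.snd‖) ^ 2 := by gcongr
        _ = _ := by ring
    have hpz : pairing (A z) z ≤ N * ‖z‖ ^ 2 := by
      refine (le_abs_self _).trans ((abs_pairing_le (A z) z).trans ?_)
      have := mul_le_mul_of_nonneg_right (A.le_opNorm z) (norm_nonneg z)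
      rw [hN, sq]
      linarith
    -- parallelogram law for the nonnegative form `⟨A w, w⟩`
    have hpar : m ^ 2 * κ ≤ 2 * pairing (A w) w + 2 * pairing (A z) z := by
      have h2 := h.pairing_nonneg hA (w + z)
      have e1 : pairing (A (m • polyH1 1)) (m • polyH1 1) = m ^ 2 * κ := by
        simp only [map_smul, smul_apply, smul_eq_mul, hκ]
        ring
      have e2 : m • polyH1 1 = w - z := by rw [hwz]; abel
      rw [e2] at e1
      simp only [map_add, map_sub, add_apply,
        sub_apply] at h2 e1
      linarith
    have hm2 : m ^ 2 ≤ (2 * pairing (A w) w + 18 * N * ‖w.1.snd‖ ^ 2) / κ := by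
      rw [le_div_iff₀ hκ0]
      nlinarith
    have hw : ‖w‖ ^ 2 ≤ 2 * (m ^ 2 * e ^ 2) + 2 * ‖z‖ ^ 2 := by
      have h3 : ‖w‖ ≤ |m| * e + ‖z‖ := by
        conv_lhs => rw [hwz]
        refine (norm_add_le _ _).trans ?_
        rw [norm_smul, Real.norm_eq_abs]
      calc ‖w‖ ^ 2 ≤ (|m| * e + ‖z‖) ^ 2 := by gcongr
        _ ≤ 2 * ((|m| * e) ^ 2 + ‖z‖ ^ 2) := add_sq_le
        _ = _ := by rw [mul_pow, sq_abs]; ring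
    have hm3 := mul_le_mul_of_nonneg_right hm2 (sq_nonneg e)
    calc ‖w‖ ^ 2 ≤ 2 * ((2 * pairing (A w) w + 18 * N * ‖w.1.snd‖ ^ 2) / κ * e ^ 2)
          + 2 * (9 * ‖w.1.snd‖ ^ 2) := by linarith
      _ = _ := by
        rw [hK₁, hK₂]
        field_simp
        ring
  have hK : 0 < K₁ / c + K₂ := by positivity
  refine ⟨(K₁ / c + K₂)⁻¹, inv_pos.2 hK, fun w => ?_⟩
  rw [mul_assoc, inv_mul_le_iff₀ hK, energyForm_apply, real_inner_self_eq_norm_sq, ← sq]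
  refine (main w).trans ?_
  have hq := h.pairing_nonneg hA w
  have t1 : 0 ≤ K₁ / c * ‖w.1.snd‖ ^ 2 := by positivity
  have t2 : 0 ≤ K₂ * (c * pairing (A w) w) := by positivity
  have t3 : K₁ / c * (c * pairing (A w) w) = K₁ * pairing (A w) w := by field_simp
  nlinarith

end

section

variable {α p μ ν : ℝ}

/-! ### The Neumann problem -/

/-- Both sines in the numerator are nonpositive and at least one of them is negative, and so is the
denominator. -/
theorem normConst_pos (hα : α ∈ Ioo (1 : ℝ) 2) (hμ : μ ∈ Icc (α - 2) 0)
    (hν : ν ∈ Icc (α - 2) 0) (hμν : μ + ν = α - 2) : 0 < normConst α μ ν := by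
  have hs : ∀ t ∈ Icc (α - 2) 0, Real.sin (Real.pi * t) ≤ 0 := by
    intro t ht
    rcases ht.2.eq_or_lt with rfl | h0
    · simp
    · exact (sin_pi_mul_neg (by linarith [ht.1, hα.1]) h0).le
  have hden : Real.sin (Real.pi * α) < 0 := by
    have h := sin_pi_mul_neg (t := α - 2) (by linarith [hα.1]) (by linarith [hα.2])
    have e : Real.pi * (α - 2) = Real.pi * α - 2 * Real.pi := by ring
    rwa [e, Real.sin_sub_two_pi] at h
  refine div_pos_of_neg_of_neg ?_ hden
  have h1 := hs μ hμ
  have h2 := hs ν hν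
  rcases hμ.2.eq_or_lt with h0 | h0
  · have := sin_pi_mul_neg (t := ν) (by linarith [hν.1, hα.1]) (by linarith [hα.2])
    linarith
  · have := sin_pi_mul_neg (t := μ) (by linarith [hμ.1, hα.1]) h0
    linarith

/-- The factor `C_{α,p} / Γ(2 - α)` in front of the two-sided integral. -/
def kernCoeff (α μ ν : ℝ) : ℝ := normConst α μ ν / Real.Gamma (2 - α)

theorem abelData (hα : α ∈ Ioo (1 : ℝ) 2) (hp : p ∈ Icc (0 : ℝ) 1)
    (hμ : μ ∈ Icc (α - 2) 0) (hν : ν ∈ Icc (α - 2) 0) (hμν : μ + ν = α - 2)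
    (hsin : p * Real.sin (Real.pi * μ) = (1 - p) * Real.sin (Real.pi * ν)) :
    AbelData (2 - α) μ ν (kernCoeff α μ ν * p) (kernCoeff α μ ν * (1 - p)) := by
  have hσ : 0 < 2 - α := by linarith [hα.2]
  have hC : 0 < kernCoeff α μ ν := div_pos (normConst_pos hα hμ hν hμν) (Real.Gamma_pos_of_pos hσ)
  have hp1 : 0 ≤ 1 - p := by linarith [hp.2]
  exact
    { pos := hσ
      lt_one := by linarith [hα.1]
      left_nonpos := hμ.2
      right_nonpos := hν.2
      add_eq := by linarith
      a_nonneg := mul_nonneg hC.le hp.1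
      b_nonneg := mul_nonneg hC.le hp1
      add_pos := by linarith
      balance := by rw [mul_assoc, hsin, mul_assoc] }

theorem twoSidedInt_ae_eq (hα : α ∈ Ioo (1 : ℝ) 2) {v : ℝ → ℝ} (hv : Integrable v muLam) :
    twoSidedInt α p μ ν (2 - α) v =ᵐ[muLam]
      fracOp (kernCoeff α μ ν * p) (kernCoeff α μ ν * (1 - p)) (2 - α) v := by
  filter_upwards [fracOp_eq_ae (by linarith [hα.2] : 0 < 2 - α) (by linarith [hα.1])
    (kernCoeff α μ ν * p) (kernCoeff α μ ν * (1 - p)) hv] with x hx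
  have e : ∀ t : ℝ, 0 < t → ∀ r : ℝ, r / t ^ (1 - (2 - α)) = t ^ (2 - α - 1) * r := by
    intro t ht r
    rw [show 2 - α - 1 = -(1 - (2 - α)) by ring, Real.rpow_neg ht.le, div_eq_inv_mul]
  have e1 : ∫ y in Ioo (-1) x, v y / (x - y) ^ (1 - (2 - α))
      = ∫ y in Ioo (-1) x, (x - y) ^ (2 - α - 1) * v y :=
    setIntegral_congr_fun measurableSet_Ioo fun y hy => e _ (by linarith [hy.2]) _
  have e2 : ∫ y in Ioo x 1, v y / (y - x) ^ (1 - (2 - α))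
      = ∫ y in Ioo x 1, (y - x) ^ (2 - α - 1) * v y :=
    setIntegral_congr_fun measurableSet_Ioo fun y hy => e _ (by linarith [hy.1]) _
  rw [hx, twoSidedInt, leftInt, rightInt, e1, e2, kernCoeff]
  ring

theorem fracInt_fst_ae (v : HRL α p μ ν) :
    (fracInt v).1.fst =ᵐ[muLam] twoSidedInt α p μ ν (2 - α) v.1 :=
  v.2.1.coeFn_toLp

theorem fracInt_snd (v : HRL α p μ ν) : (fracInt v).1.snd = rlDeriv v := rfl

theorem hrlNorm_eq (v : HRL α p μ ν) : hrlNorm v = ‖fracInt v‖ := by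
  have h1 : ∫ x in Lam, (twoSidedInt α p μ ν (2 - α) v.1 x) ^ 2 = ‖(fracInt v).1.fst‖ ^ 2 := by
    rw [L2_norm_sq]
    refine integral_congr_ae ?_
    filter_upwards [fracInt_fst_ae v] with x hx
    rw [hx]
  rw [hrlNorm, h1, ← L2_norm_sq, ← fracInt_snd, ← H1.norm_sq, Real.sqrt_sq (norm_nonneg _)]

/-- A right inverse of the fractional integral on `L¹(Λ)` makes `fracInt` a bijection from
`H_RL^{α-1}(Λ)` onto `H¹(Λ)`, with the given operator as its inverse. -/
theorem exists_inverse_fracInt (hα : α ∈ Ioo (1 : ℝ) 2)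
    (h : AbelData (2 - α) μ ν (kernCoeff α μ ν * p) (kernCoeff α μ ν * (1 - p)))
    {A : H1 →L[ℝ] Lp ℝ 1 muLam}
    (hA : ∀ w, fracOpL1 h.pos h.lt_one (kernCoeff α μ ν * p)
      (kernCoeff α μ ν * (1 - p)) (A w) = H1toL1 w) :
    (∀ v : HRL α p μ ν, A (fracInt v) = v.1) ∧ ∀ w, ∃ v : HRL α p μ ν, fracInt v = w := by
  refine ⟨fun v => h.fracOpL1_injective ?_, fun w => ?_⟩
  · rw [hA]
    refine Lp.ext ?_
    exact ((H1toL1_ae _).trans (fracInt_fst_ae v)).trans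
      ((twoSidedInt_ae_eq hα (L1.integrable_coeFn v.1)).trans (fracOpL1_ae _ _ _ _ _).symm)
  · have e : twoSidedInt α p μ ν (2 - α) (A w) =ᵐ[muLam] w.1.fst := by
      refine (twoSidedInt_ae_eq hα (L1.integrable_coeFn (A w))).trans
        ((fracOpL1_ae h.pos h.lt_one _ _ _).symm.trans ?_)
      rw [hA]
      exact H1toL1_ae w
    have hv : A w ∈ HRL α p μ ν :=
      ⟨(Lp.memLp w.1.fst).ae_eq e.symm, w.1.snd, w.2.congr e.symm (Filter.EventuallyEq.refl _ _)⟩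
    exact ⟨⟨A w, hv⟩, H1.ext_fst (Lp.ext ((fracInt_fst_ae _).trans e))⟩

/-- In the variable `fracInt u`, the bilinear form of the weak formulation is `energyForm`. -/
theorem bilin_eq_energyForm (c : ℝ) {A : H1 →L[ℝ] Lp ℝ 1 muLam}
    (hA : ∀ v : HRL α p μ ν, A (fracInt v) = v.1) (u v : HRL α p μ ν) :
    bilin c u v = energyForm A c (fracInt u) (fracInt v) := by
  rw [bilin, energyForm_apply, hA, pairing_apply, L2.inner_def]
  congr 2
  · refine integral_congr_ae ?_
    filter_upwards [fracInt_fst_ae v] with x hx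
    rw [hx]
  · funext x
    simp [fracInt_snd, mul_comm]

theorem neg_one_mem : (-1 : ℝ) ∈ Icc (-1 : ℝ) 1 := ⟨le_rfl, by norm_num⟩

theorem one_mem : (1 : ℝ) ∈ Icc (-1 : ℝ) 1 := ⟨by norm_num, le_rfl⟩

/-- The right-hand side of the weak formulation, as a functional on `H¹(Λ)`. -/
def neumannL (f : HNegOne) (g₁ g₂ : ℝ) : H1 →L[ℝ] ℝ :=
  f + g₂ • traceL one_mem - g₁ • traceL neg_one_mem

theorem neumannL_apply (f : HNegOne) (g₁ g₂ : ℝ) (w : H1) :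
    neumannL f g₁ g₂ w = f w + g₂ * trace w 1 - g₁ * trace w (-1) := rfl

theorem abs_neumannL_le (f : HNegOne) (g₁ g₂ : ℝ) (w : H1) :
    |neumannL f g₁ g₂ w| ≤ (‖f‖ + 3 * (|g₁| + |g₂|)) * ‖w‖ := by
  have h1 : |f w| ≤ ‖f‖ * ‖w‖ := f.le_opNorm w
  have h2 := mul_le_mul_of_nonneg_left (abs_trace_le w one_mem) (abs_nonneg g₂)
  have h3 := mul_le_mul_of_nonneg_left (abs_trace_le w neg_one_mem) (abs_nonneg g₁)
  rw [← abs_mul] at h2 h3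
  rw [neumannL_apply]
  have h4 := abs_sub (f w + g₂ * trace w 1) (g₁ * trace w (-1))
  have h5 := abs_add_le (f w) (g₂ * trace w 1)
  linarith

end

end FracNeumann

end

theorem theorem3p2 (α p μ ν c : ℝ) (hα : α ∈ Set.Ioo (1 : ℝ) 2) (hp : p ∈ Set.Icc (0 : ℝ) 1)
    (hμ : μ ∈ Set.Icc (α - 2) 0) (hν : ν ∈ Set.Icc (α - 2) 0) (hμν : μ + ν = α - 2)
    (hsin : p * Real.sin (Real.pi * μ) = (1 - p) * Real.sin (Real.pi * ν)) (hc : 0 < c) :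
    ∃ K C : ℝ, 0 < K ∧ 0 < C ∧
      ∀ (f : FracNeumann.HNegOne) (g₁ g₂ : ℝ),
        (∃! u : FracNeumann.HRL α p μ ν, FracNeumann.IsWeakSolution c f g₁ g₂ u) ∧
        ∀ u : FracNeumann.HRL α p μ ν, FracNeumann.IsWeakSolution c f g₁ g₂ u →
          FracNeumann.hrlNorm u ≤ K * (‖f‖ + C * (|g₁| + |g₂|)) := by
  have h := FracNeumann.abelData hα hp hμ hν hμν hsin
  obtain ⟨A, hA, hAq⟩ := h.exists_inverse
  obtain ⟨hinv, hsurj⟩ := FracNeumann.exists_inverse_fracInt hα h hA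
  obtain ⟨δ, hδ, hco⟩ := h.exists_coercive hAq hc
  have hiff : ∀ (f : FracNeumann.HNegOne) (g₁ g₂ : ℝ) (u : FracNeumann.HRL α p μ ν),
      FracNeumann.IsWeakSolution c f g₁ g₂ u ↔
        ∀ w, FracNeumann.energyForm A c (FracNeumann.fracInt u) w
          = FracNeumann.neumannL f g₁ g₂ w := by
    intro f g₁ g₂ u
    constructor
    · intro hu w
      obtain ⟨v, rfl⟩ := hsurj w
      rw [← FracNeumann.bilin_eq_energyForm c hinv, hu v]
      rfl
    · intro hu v
      rw [FracNeumann.bilin_eq_energyForm c hinv, hu]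
      rfl
  -- `δ` is the coercivity constant, `3` the norm bound for the boundary values in `abs_trace_le`
  refine ⟨δ⁻¹, 3, inv_pos.2 hδ, by norm_num, fun f g₁ g₂ => ⟨?_, fun u hu => ?_⟩⟩
  · obtain ⟨w, hw, huniq⟩ := FracNeumann.existsUnique_of_coercive (FracNeumann.energyForm A c)
      (FracNeumann.abs_energyForm_le A hc.le) hδ hco (FracNeumann.neumannL f g₁ g₂)
    obtain ⟨u, rfl⟩ := hsurj w
    refine ⟨u, (hiff f g₁ g₂ u).2 hw, fun u' hu' => ?_⟩
    have := huniq _ ((hiff f g₁ g₂ u').1 hu')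
    exact Subtype.ext (by rw [← hinv u', ← hinv u, this])
  · have hw := (hiff f g₁ g₂ u).1 hu (FracNeumann.fracInt u)
    have h1 := hco (FracNeumann.fracInt u)
    rw [hw] at h1
    have h2 := h1.trans ((le_abs_self _).trans (FracNeumann.abs_neumannL_le f g₁ g₂ _))
    rw [FracNeumann.hrlNorm_eq, le_inv_mul_iff₀ hδ]
    rcases (norm_nonneg (FracNeumann.fracInt u)).eq_or_lt with h0 | hpos
    · rw [← h0, mul_zero]
      positivity
    · exact le_of_mul_le_mul_right h2 hpos
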